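/- A symmetric function $F:\{0,1\}^d\to\mathbb{R}_{\ge 0}$ is written $[f_0,f_1,\dots,f_d]$, where $f_i$ is the value of $F$ on inputs of Hamming weight $i$. For $c,p>0$ let $\mathcal{F}_c^p$ be the set of all symmetric functions $[f_0,\dots,f_d]$ with non-negative values, of any arity $d\ge 0$, such that $f_{i+2}=c f_{i+1}+f_i$ for $0\le i\le d-2$ and $f_{i+1}\ge p f_i$ for $0\le i\le d-1$. For $0<\lambda_1\le\lambda_2$ let $\Lambda_{\lambda_1,\lambda_2}=[\lambda_1,\lambda_2]$. An instance $\Omega$ of $\mathrm{Holant}(\mathcal{F}_c^p,\Lambda_{\lambda_1,\lambda_2})$ consists of a finite graph $G=(V,E)$ (parallel edges and loops are allowed; a loop counts twice at its vertex), a function $F_v\in\mathcal{F}_c^p$ of arity $\deg(v)$ for every vertex $v$, and a weight $\lambda_e\in\Lambda_{\lambda_1,\lambda_2}$ for every edge $e$. Its partition function is $$Z(\Omega)=\sum_{\sigma:E\to\{0,1\}}\ \prod_{e\in E}\lambda_e^{\sigma(e)}\ \prod_{v\in V}F_v(\sigma|_{E(v)}),$$ where $E(v)$ denotes the edges incident to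 $v$. A (deterministic) FPTAS for this problem is one deterministic algorithm that, for every instance $\Omega$ and every $\varepsilon>0$, outputs a number $Z'$ with $(1-\varepsilon)Z(\Omega)<Z'<(1+\varepsilon)Z(\Omega)$ (with $Z'=0$ in case $Z(\Omega)=0$) in time polynomial in $|V|+|E|$ and $1/\varepsilon$. Since the data are real numbers, algorithms are programs of a real random access machine, in which each exact operation $+,-,\cdot,/$ and each comparison of real numbers costs one unit of time, as do additions, subtractions and comparisons of natural numbers and (indirect) memory accesses; the only constants in a program are natural numbers. **Theorem.** For every $c>0$ and $p>0$ there are $\lambda_1=\lambda_1(p,c)\in(0,1)$ and $\lambda_2=\lambda_2(p,c)>1$ such that there is a deterministic FPTAS for $\mathrm{Holant}(\mathcal{F}_c^p,\Lambda_{\lambda_1,\lambda_2})$. -/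

import Mathlib

/-! ### Weighted Holant instances -/

/-- How often the vertex `v` occurs as an end of an edge with ends `e` (`2` for a loop at `v`). -/
def endCount {n : ℕ} (e : Fin n × Fin n) (v : Fin n) : ℕ :=
  (if e.1 = v then 1 else 0) + (if e.2 = v then 1 else 0)

/-- A weighted Holant instance whose vertex functions are symmetric.
The graph has vertex set `Fin n` and edge set `Fin m` (parallel edges and loops are allowed).
The function at `v` is the list `[f_0, …, f_d]`, where `d` is the degree of `v` and `f_i` is the
value on inputs of Hamming weight `i`. The edge weight is `λ_e(1)`, with `λ_e(0) = 1`. -/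
structure HolantInstance where
  n : ℕ
  m : ℕ
  ends : Fin m → Fin n × Fin n
  weight : Fin m → ℝ
  sig : Fin n → List ℝ
  length_sig : ∀ v, (sig v).length = (∑ e, endCount (ends e) v) + 1
  weight_nonneg : ∀ e, 0 ≤ weight e
  sig_nonneg : ∀ v, ∀ x ∈ sig v, 0 ≤ x

namespace HolantInstance

/-- The Hamming weight of the restriction of the configuration `σ` to the edges at `v`. -/
def hamming (Ω : HolantInstance) (σ : Fin Ω.m → Bool) (v : Fin Ω.n) : ℕ :=
  ∑ e, if σ e then endCount (Ω.ends e) v else 0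

/-- The weight of a configuration. The default value of `getD` is never used. -/
noncomputable def configWeight (Ω : HolantInstance) (σ : Fin Ω.m → Bool) : ℝ :=
  (∏ e, if σ e then Ω.weight e else 1) * ∏ v, (Ω.sig v).getD (Ω.hamming σ v) 0

/-- The partition function `Z(Ω)`. -/
noncomputable def partitionFunction (Ω : HolantInstance) : ℝ :=
  ∑ σ : Fin Ω.m → Bool, Ω.configWeight σ

/-- `Ω` is an instance of the problem `Holant(𝓕, Λ)`. -/
def IsOver (Ω : HolantInstance) (𝓕 : Set (List ℝ)) (Λ : Set ℝ) : Prop :=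
  (∀ v, Ω.sig v ∈ 𝓕) ∧ ∀ e, Ω.weight e ∈ Λ

end HolantInstance

/-- The symmetric functions `[f_0, …, f_d]` with `f_{i+2} = c f_{i+1} + f_i` for `i ≤ d - 2`
and `f_{i+1} ≥ p f_i` for `i ≤ d - 1`. -/
def fibonacciFamily (c p : ℝ) : Set (List ℝ) :=
  {f | (∀ i, i + 2 < f.length → f.getD (i + 2) 0 = c * f.getD (i + 1) 0 + f.getD i 0) ∧
    ∀ i, i + 1 < f.length → p * f.getD i 0 ≤ f.getD (i + 1) 0}

/-! ### Real random access machines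

A deterministic machine with a memory of natural numbers and a memory of real numbers, both
indexed by `ℕ`. Addresses are natural numbers that may themselves be computed (indirect
addressing). Program texts are finite and contain no numbers other than natural numbers, so a
program has no real constants built into it. -/

/-- Natural number expressions. -/
inductive NatExp where
  | lit (k : ℕ)
  | read (addr : NatExp)
  | add (a b : NatExp)
  | sub (a b : NatExp)

/-- Real expressions. -/
inductive RealExp where
  | lit (k : ℕ)
  | read (addr : NatExp)
  | add (x y : RealExp)
  | sub (x y : RealExp)
  | mul (x y : RealExp)
  | div (x y : RealExp)

/-- Tests. -/
inductive Test where
  | natLe (a b : NatExp)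
  | realLe (x y : RealExp)
  | neg (b : Test)

/-- Programs. -/
inductive Program where
  | skip
  | writeNat (addr val : NatExp)
  | writeReal (addr : NatExp) (val : RealExp)
  | seq (P Q : Program)
  | cond (b : Test) (P Q : Program)
  | loop (b : Test) (P : Program)

/-- The contents of the two memories. -/
structure Memory where
  nats : ℕ → ℕ
  reals : ℕ → ℝ

/-- Value of a natural number expression (subtraction is truncated at `0`). -/
def NatExp.eval (M : Memory) : NatExp → ℕ
  | lit k => k
  | read a => M.nats (a.eval M)
  | add a b => a.eval M + b.eval M
  | sub a b => a.eval M - b.eval M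

/-- Value of a real expression (arithmetic is exact, and division by `0` returns `0`). -/
noncomputable def RealExp.eval (M : Memory) : RealExp → ℝ
  | lit k => k
  | read a => M.reals (a.eval M)
  | add x y => x.eval M + y.eval M
  | sub x y => x.eval M - y.eval M
  | mul x y => x.eval M * y.eval M
  | div x y => x.eval M / y.eval M

/-- Truth of a test. -/
def Test.Holds (M : Memory) : Test → Prop
  | natLe a b => a.eval M ≤ b.eval M
  | realLe x y => x.eval M ≤ y.eval M
  | neg b => ¬ b.Holds M

/-- `Runs P M t M₂`: the program `P`, started in memory `M`, halts after `t` steps in memory `M₂`.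
Every write and every test is one step; the expressions in it have a size fixed by the program. -/
inductive Runs : Program → Memory → ℕ → Memory → Prop
  | skip (M : Memory) : Runs .skip M 1 M
  | writeNat (M : Memory) (a b : NatExp) :
      Runs (.writeNat a b) M 1 { M with nats := Function.update M.nats (a.eval M) (b.eval M) }
  | writeReal (M : Memory) (a : NatExp) (x : RealExp) :
      Runs (.writeReal a x) M 1 { M with reals := Function.update M.reals (a.eval M) (x.eval M) }
  | seq {P Q : Program} {M₁ M₂ M₃ : Memory} {s t : ℕ} :
      Runs P M₁ s M₂ → Runs Q M₂ t M₃ → Runs (.seq P Q) M₁ (s + t) M₃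
  | condTrue {b : Test} {P Q : Program} {M₁ M₂ : Memory} {t : ℕ} :
      b.Holds M₁ → Runs P M₁ t M₂ → Runs (.cond b P Q) M₁ (t + 1) M₂
  | condFalse {b : Test} {P Q : Program} {M₁ M₂ : Memory} {t : ℕ} :
      ¬ b.Holds M₁ → Runs Q M₁ t M₂ → Runs (.cond b P Q) M₁ (t + 1) M₂
  | loopStop {b : Test} {P : Program} {M : Memory} :
      ¬ b.Holds M → Runs (.loop b P) M 1 M
  | loopStep {b : Test} {P : Program} {M₁ M₂ M₃ : Memory} {s t : ℕ} :
      b.Holds M₁ → Runs P M₁ s M₂ → Runs (.loop b P) M₂ t M₃ →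
      Runs (.loop b P) M₁ (s + t + 1) M₃

/-- Memory that contains the input `(Ω, ε)` and is zero elsewhere. The natural numbers are `n`, `m`
and the ends of the edges; the real numbers are `ε`, the edge weights and the values of the vertex
functions, vertex by vertex. -/
noncomputable def HolantInstance.input (Ω : HolantInstance) (ε : ℝ) : Memory where
  nats i := (Ω.n :: Ω.m ::
    (List.ofFn fun e => [((Ω.ends e).1 : ℕ), ((Ω.ends e).2 : ℕ)]).flatten).getD i 0
  reals i := (ε :: (List.ofFn Ω.weight ++ (List.ofFn Ω.sig).flatten)).getD i 0

/-- There is a (deterministic) fully polynomial-time approximation scheme for `Holant(𝓕, Λ)`: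
one program that, on every instance `Ω` and every `ε > 0`, halts after at most
`C (n + m + 1/ε + 1) ^ k` steps with an output `Z'` (in the real cell `0`) such that
`(1 - ε) Z < Z' < (1 + ε) Z`, or `Z' = 0` in case `Z = 0`. -/
def HasFPTAS (𝓕 : Set (List ℝ)) (Λ : Set ℝ) : Prop :=
  ∃ (P : Program) (C k : ℕ), ∀ Ω : HolantInstance, Ω.IsOver 𝓕 Λ → ∀ ε : ℝ, 0 < ε →
    ∃ (t : ℕ) (M : Memory), Runs P (Ω.input ε) t M ∧
      (t : ℝ) ≤ C * ((Ω.n : ℝ) + Ω.m + 1 / ε + 1) ^ k ∧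
      (Ω.partitionFunction ≠ 0 →
        (1 - ε) * Ω.partitionFunction < M.reals 0 ∧
        M.reals 0 < (1 + ε) * Ω.partitionFunction) ∧
      (Ω.partitionFunction = 0 → M.reals 0 = 0)

/-! ### Partition functions of networks of two-term recurrences -/

/-! A sequence with f_{i+2} = c f_{i+1} + f_i is determined by its first two terms, so it may be
read as an element a₀ + a₁x of the ring ℝ[x]/(x² - cx - 1). Setting one input to 1 is multiplication
by x (`shift`), and joining two vertices along an edge of weight 1 is multiplication in the ring
(`conv`). Hence an edge of weight 1 between distinct vertices can be contracted exactly
(`netZ_contract`), and an edge of weight 1 + δ adds only δ times the network in which that edge is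
set to 1.

The partition function is linear in the sequence at a base vertex w, so up to scale it is known from
the ratio X = Z(1,0)/Z(1,1), which lies in [0, 1]. Expansion along an edge wu expresses X through
three such ratios: X₁ of the contracted network, and X₂, X₃ of networks without the edge, seen from
w and from u (`Net.Good.expand`). For δ = 0 only X₁ enters, by a Möbius map. The geometric sequences
(1, r) and (1, s), with r and s the roots of x² = cx + 1, are eigenvectors of every multiplication,
so in the variable `coord` this map is multiplication by a number of modulus at most max(1/r², 1/(1
+ pr)) < 1; the condition f_{i+1} ≥ p f_i makes the bound uniform. For small |δ| the whole recursion
therefore still contracts at a rate θ < 1 (`exists_contracts`), and this determines the interval [1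
- δ₀, 1 + δ₀] of weights.

Unrolled, the recursion is a ternary tree. It is numbered like a heap and cut at the node N, where
every ratio is guessed to be 1. If 4θ^q ≤ 1, the error at the node j is at most 6((j+1)/N)^{1/q}
(`TreeSpec.error`), so polynomially many nodes give inverse polynomial accuracy. The edges are
contracted one after the other; the factor by which Z changes is approximated each time from a fresh
tree, and the factors are multiplied up (`Progress.step`, `Progress.finish`).

The program may not contain c. If a vertex of degree at least 2 has f_1 > 0, then c = (f_2 -
f_0)/f_1; otherwise all functions of arity at least 2 vanish and the instance also obeys the
recurrence with coefficient 1 (`isOver_of_detected`). So the constants are chosen to serve both c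
and 1 (`exists_works`). The algorithm is written in a small language with named arrays, verified
with time bounds (`HT`), and compiled to the machine step by step (`Exec.runs`). -/

namespace FibonacciHolant

/-- The shift of the sequence `f_{i+2} = c f_{i+1} + f_i`, in terms of `(f_0, f_1)`. -/
def shift (c : ℝ) (a : ℝ × ℝ) : ℝ × ℝ := (a.2, a.1 + c * a.2)

/-- The sequence obtained by joining two sequences along an unweighted edge. -/
def conv (c : ℝ) (a b : ℝ × ℝ) : ℝ × ℝ :=
  (a.1 * b.1 + a.2 * b.2, a.2 * b.1 + a.1 * b.2 + c * a.2 * b.2)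

def shiftAt (c : ℝ) (v : ℕ) (g : ℕ → ℝ × ℝ) : ℕ → ℝ × ℝ :=
  Function.update g v (shift c (g v))

/-- The partition function of the network with vertices below `n` carrying the sequences `g`,
and edges below `m` with ends `E₁`, `E₂` and weights `L`. -/
def netZ (c : ℝ) (n : ℕ) (E₁ E₂ : ℕ → ℕ) (L : ℕ → ℝ) : ℕ → (ℕ → ℝ × ℝ) → ℝ
  | 0, g => ∏ v ∈ Finset.range n, (g v).1
  | m + 1, g => netZ c n E₁ E₂ L m g +
      L m * netZ c n E₁ E₂ L m (shiftAt c (E₁ m) (shiftAt c (E₂ m) g))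

variable {c : ℝ} {n : ℕ}

/-- With a read as a₀ + a₁x modulo x² = cx + 1, `conv` is the product and `shift` is multiplication
by x, so this is associativity. -/
theorem shift_conv_left (a b : ℝ × ℝ) : conv c (shift c a) b = shift c (conv c a b) := by
  ext <;> simp only [conv, shift] <;> ring

theorem shift_conv_right (a b : ℝ × ℝ) : conv c a (shift c b) = shift c (conv c a b) := by
  ext <;> simp only [conv, shift] <;> ring

theorem shiftAt_comm (u v : ℕ) (g : ℕ → ℝ × ℝ) :
    shiftAt c u (shiftAt c v g) = shiftAt c v (shiftAt c u g) := by
  by_cases h : u = v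
  · rw [h]
  · unfold shiftAt
    rw [Function.update_of_ne h, Function.update_of_ne (Ne.symm h), Function.update_comm h]

theorem shiftAt_update_self (w : ℕ) (g : ℕ → ℝ × ℝ) (a : ℝ × ℝ) :
    shiftAt c w (Function.update g w a) = Function.update g w (shift c a) := by
  simp [shiftAt]

theorem shiftAt_update_of_ne {v w : ℕ} (h : v ≠ w) (g : ℕ → ℝ × ℝ) (a : ℝ × ℝ) :
    shiftAt c v (Function.update g w a) = Function.update (shiftAt c v g) w a := by
  simp only [shiftAt]
  rw [Function.update_of_ne h, Function.update_comm h]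

theorem shiftAt_congr {v : ℕ} {g g' : ℕ → ℝ × ℝ} (h : ∀ x < n, g x = g' x) :
    ∀ x < n, shiftAt c v g x = shiftAt c v g' x := by
  intro x hx
  by_cases hv : x = v
  · subst hv; simp [shiftAt, h x hx]
  · simp [shiftAt, hv, h x hx]

theorem netZ_congr {E₁ E₁' E₂ E₂' : ℕ → ℕ} {L L' : ℕ → ℝ} {m : ℕ} {g g' : ℕ → ℝ × ℝ}
    (h₁ : ∀ e < m, E₁ e = E₁' e) (h₂ : ∀ e < m, E₂ e = E₂' e) (hL : ∀ e < m, L e = L' e)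
    (hg : ∀ v < n, g v = g' v) : netZ c n E₁ E₂ L m g = netZ c n E₁' E₂' L' m g' := by
  induction m generalizing g g' with
  | zero => exact Finset.prod_congr rfl fun v hv => by rw [hg v (Finset.mem_range.1 hv)]
  | succ m ih =>
    have ih' := fun {g g'} => @ih g g' (fun e he => h₁ e (by omega)) (fun e he => h₂ e (by omega))
      (fun e he => hL e (by omega))
    rw [netZ, netZ, ih' hg, hL m (by omega), h₁ m (by omega), h₂ m (by omega),
      ih' (shiftAt_congr (shiftAt_congr hg))]

/-- The two terms of a sequence enter the partition function linearly. -/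
theorem netZ_update_linear {E₁ E₂ : ℕ → ℕ} {L : ℕ → ℝ} {m w : ℕ} (hw : w < n) (g : ℕ → ℝ × ℝ)
    (x y : ℝ) (a b : ℝ × ℝ) :
    netZ c n E₁ E₂ L m (Function.update g w (x * a.1 + y * b.1, x * a.2 + y * b.2)) =
      x * netZ c n E₁ E₂ L m (Function.update g w a) +
      y * netZ c n E₁ E₂ L m (Function.update g w b) := by
  induction m generalizing g a b with
  | zero =>
    have key : ∀ d : ℝ × ℝ, ∏ v ∈ Finset.range n, (Function.update g w d v).1 =
        d.1 * ∏ v ∈ (Finset.range n).erase w, (g v).1 := by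
      intro d
      rw [← Finset.mul_prod_erase _ _ (Finset.mem_range.2 hw)]
      simp only [Function.update_self]
      congr 1
      refine Finset.prod_congr rfl fun v hv => ?_
      rw [Function.update_of_ne (Finset.ne_of_mem_erase hv)]
    simp only [netZ, key]; ring
  | succ m ih =>
    -- A shift at v either commutes with the update at w or acts on the updated sequence. Which of
    -- the two happens does not depend on d, so linearity survives the two shifts of an edge.
    have key : ∀ v (g : ℕ → ℝ × ℝ), ∃ g' : ℕ → ℝ × ℝ, ∃ s : Bool, ∀ d,
        shiftAt c v (Function.update g w d) =
          Function.update g' w (if s then shift c d else d) := by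
      intro v g
      by_cases h : v = w
      · subst h; exact ⟨g, true, fun d => by simp [shiftAt_update_self]⟩
      · exact ⟨shiftAt c v g, false, fun d => by simp [shiftAt_update_of_ne h]⟩
    obtain ⟨g₂, s₂, h₂⟩ := key (E₂ m) g
    obtain ⟨g₁, s₁, h₁⟩ := key (E₁ m) g₂
    have lin : ∀ (s : Bool) (a b : ℝ × ℝ),
        (if s then shift c (x * a.1 + y * b.1, x * a.2 + y * b.2)
          else (x * a.1 + y * b.1, x * a.2 + y * b.2)) =
        (x * (if s then shift c a else a).1 + y * (if s then shift c b else b).1,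
         x * (if s then shift c a else a).2 + y * (if s then shift c b else b).2) := by
      intro s a b
      cases s
      · simp
      · simp only [shift, if_true]; ext <;> ring
    simp only [netZ, h₂, h₁]
    rw [lin, lin, ih, ih]; ring

theorem netZ_update_eq {E₁ E₂ : ℕ → ℕ} {L : ℕ → ℝ} {m w : ℕ} (hw : w < n) (g : ℕ → ℝ × ℝ)
    (a : ℝ × ℝ) :
    netZ c n E₁ E₂ L m (Function.update g w a) =
      a.1 * netZ c n E₁ E₂ L m (Function.update g w (1, 0)) +
      a.2 * netZ c n E₁ E₂ L m (Function.update g w (0, 1)) := by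
  rw [← netZ_update_linear hw]; simp

/-- Conditioning on the value of the edge `k`. -/
theorem netZ_delete {E₁ E₂ : ℕ → ℕ} {L : ℕ → ℝ} {m k : ℕ} (hk : k < m) (g : ℕ → ℝ × ℝ) :
    netZ c n E₁ E₂ L m g = netZ c n E₁ E₂ (Function.update L k 0) m g +
      L k * netZ c n E₁ E₂ (Function.update L k 0) m
        (shiftAt c (E₁ k) (shiftAt c (E₂ k) g)) := by
  induction m generalizing g with
  | zero => omega
  | succ m ih =>
    by_cases h : k = m
    · subst h
      have : ∀ g, netZ c n E₁ E₂ (Function.update L k 0) k g = netZ c n E₁ E₂ L k g := fun g =>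
        netZ_congr (fun _ _ => rfl) (fun _ _ => rfl)
          (fun e he => Function.update_of_ne (by omega) _ _) (fun _ _ => rfl)
      simp only [netZ, this, Function.update_self]; ring
    · have hk' : k < m := by omega
      simp only [netZ]
      rw [ih hk' g, ih hk' (shiftAt c (E₁ m) (shiftAt c (E₂ m) g)),
        Function.update_of_ne (Ne.symm h)]
      rw [shiftAt_comm (E₂ k) (E₁ m), shiftAt_comm (E₂ k) (E₂ m), shiftAt_comm (E₁ k) (E₁ m),
        shiftAt_comm (E₁ k) (E₂ m)]
      ring

/-- Contraction of an unweighted edge between distinct vertices `w` and `u`. -/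
theorem netZ_contract {E₁ E₂ : ℕ → ℕ} {L : ℕ → ℝ} {m w u : ℕ} (hw : w < n) (hu : u < n)
    (hwu : w ≠ u) (d : ℝ) (g : ℕ → ℝ × ℝ) :
    netZ c n E₁ E₂ L m g + netZ c n E₁ E₂ L m (shiftAt c w (shiftAt c u g)) =
      netZ c n (fun e => if E₁ e = u then w else E₁ e) (fun e => if E₂ e = u then w else E₂ e) L m
        (Function.update (Function.update g u (1, d)) w (conv c (g w) (g u))) := by
  induction m generalizing g d with
  | zero =>
    simp only [netZ]
    have hu' : u ∈ (Finset.range n).erase w := Finset.mem_erase.2 ⟨hwu.symm, Finset.mem_range.2 hu⟩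
    have key : ∀ f : ℕ → ℝ × ℝ, ∏ v ∈ Finset.range n, (f v).1 =
        (f w).1 * ((f u).1 * ∏ v ∈ ((Finset.range n).erase w).erase u, (f v).1) := by
      intro f
      rw [← Finset.mul_prod_erase _ _ (Finset.mem_range.2 hw), ← Finset.mul_prod_erase _ _ hu']
    have cong : ∀ f : ℕ → ℝ × ℝ, (∀ v, v ≠ w → v ≠ u → f v = g v) →
        ∏ v ∈ ((Finset.range n).erase w).erase u, (f v).1 =
        ∏ v ∈ ((Finset.range n).erase w).erase u, (g v).1 := by
      intro f hf
      refine Finset.prod_congr rfl fun v hv => ?_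
      have h1 := Finset.ne_of_mem_erase hv
      have h2 := Finset.ne_of_mem_erase (Finset.mem_of_mem_erase hv)
      rw [hf v h2 h1]
    rw [key g, key (shiftAt _ _ _), key (Function.update _ _ _), cong (shiftAt _ _ _),
      cong (Function.update _ _ _)]
    · simp [shiftAt, hwu, hwu.symm, shift, conv]; ring
    · intro v h1 h2; simp [h1, h2]
    · intro v h1 h2; simp [shiftAt, h1, h2]
  | succ m ih =>
    -- After the renaming no edge meets u: it contributes only its first term 1, and its second term
    -- is free. A shift at w or at u becomes a shift of the product at w.
    have key : ∀ (x : ℕ) (d : ℝ) (g : ℕ → ℝ × ℝ), ∃ d', 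
        shiftAt c (if x = u then w else x)
          (Function.update (Function.update g u (1, d)) w (conv c (g w) (g u))) =
        Function.update (Function.update (shiftAt c x g) u (1, d')) w
          (conv c (shiftAt c x g w) (shiftAt c x g u)) := by
      intro x d g
      by_cases hx : x = u
      · subst hx
        refine ⟨d, ?_⟩
        rw [if_pos rfl, shiftAt_update_self]
        simp [shiftAt, hwu, shift_conv_right]
      · rw [if_neg hx]
        refine ⟨d, ?_⟩
        by_cases hx' : x = w
        · subst hx'
          rw [shiftAt_update_self]
          simp only [shiftAt, Function.update_self, Function.update_of_ne hwu.symm, shift_conv_left]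
          rw [Function.update_comm hwu, Function.update_idem]
        · rw [shiftAt_update_of_ne hx', shiftAt_update_of_ne hx]
          simp [shiftAt, Ne.symm hx, Ne.symm hx']
    simp only [netZ]
    obtain ⟨d₂, h₂⟩ := key (E₂ m) d g
    rw [h₂]
    obtain ⟨d₁, h₁⟩ := key (E₁ m) d₂ (shiftAt c (E₂ m) g)
    rw [h₁, ← ih, ← ih, shiftAt_comm (E₂ m) w, shiftAt_comm (E₂ m) u, shiftAt_comm (E₁ m) w,
      shiftAt_comm (E₁ m) u]
    ring

/-! ### Positivity of partition functions -/

theorem shiftAt_nonneg (hc : 0 ≤ c) {v : ℕ} {g : ℕ → ℝ × ℝ}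
    (hg : ∀ x < n, 0 ≤ (g x).1 ∧ 0 ≤ (g x).2) :
    ∀ x < n, 0 ≤ (shiftAt c v g x).1 ∧ 0 ≤ (shiftAt c v g x).2 := by
  intro x hx
  obtain ⟨h1, h2⟩ := hg x hx
  by_cases h : x = v
  · subst h; simp only [shiftAt, Function.update_self, shift]; exact ⟨h2, by positivity⟩
  · simp [shiftAt, h, h1, h2]

theorem netZ_nonneg (hc : 0 ≤ c) {E₁ E₂ : ℕ → ℕ} {L : ℕ → ℝ} {m : ℕ} (hL : ∀ e < m, 0 ≤ L e)
    {g : ℕ → ℝ × ℝ} (hg : ∀ v < n, 0 ≤ (g v).1 ∧ 0 ≤ (g v).2) : 0 ≤ netZ c n E₁ E₂ L m g := by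
  induction m generalizing g with
  | zero => exact Finset.prod_nonneg fun v hv => (hg v (Finset.mem_range.1 hv)).1
  | succ m ih =>
    have ih' := fun {g} => @ih (fun e he => hL e (by omega)) g
    exact add_nonneg (ih' hg) (mul_nonneg (hL m (by omega))
      (ih' (shiftAt_nonneg hc (shiftAt_nonneg hc hg))))

/-- Only first terms count in the end, and a shift moves a positive second term into first place. So
an incident edge of positive weight makes up for a first term 0: in the induction the summand with
the last edge present is the positive one. -/
theorem netZ_pos (hc : 0 < c) {E₁ E₂ : ℕ → ℕ} {L : ℕ → ℝ} {m : ℕ} (hL : ∀ e < m, 0 ≤ L e)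
    {g : ℕ → ℝ × ℝ} (hg : ∀ v < n, 0 ≤ (g v).1 ∧ 0 < (g v).2)
    (h : ∀ v < n, 0 < (g v).1 ∨ ∃ e < m, 0 < L e ∧ (E₁ e = v ∨ E₂ e = v)) :
    0 < netZ c n E₁ E₂ L m g := by
  induction m generalizing g with
  | zero =>
    refine Finset.prod_pos fun v hv => ?_
    rcases h v (Finset.mem_range.1 hv) with h | ⟨e, he, _⟩
    · exact h
    · omega
  | succ m ih =>
    have ih' := fun {g} => @ih (fun e he => hL e (by omega)) g
    have hL' : ∀ e < m, 0 ≤ L e := fun e he => hL e (by omega)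
    have hcase : ∀ v < n, 0 < (g v).1 ∨ (∃ e < m, 0 < L e ∧ (E₁ e = v ∨ E₂ e = v)) ∨
        (0 < L m ∧ (E₁ m = v ∨ E₂ m = v)) := by
      intro v hv
      rcases h v hv with h | ⟨e, he, hLe, hh⟩
      · exact Or.inl h
      · rcases Nat.lt_succ_iff_lt_or_eq.1 he with h' | rfl
        · exact Or.inr (Or.inl ⟨e, h', hLe, hh⟩)
        · exact Or.inr (Or.inr ⟨hLe, hh⟩)
    rcases (hL m (by omega)).eq_or_lt with h0 | h0
    · rw [netZ, ← h0, zero_mul, add_zero]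
      refine ih' hg fun v hv => ?_
      rcases hcase v hv with h | h | h
      · exact Or.inl h
      · exact Or.inr h
      · linarith [h.1]
    · rw [netZ]
      have hpos : ∀ (x : ℕ) (g : ℕ → ℝ × ℝ), (∀ v < n, 0 ≤ (g v).1 ∧ 0 < (g v).2) →
          ∀ v < n, (0 ≤ (shiftAt c x g v).1 ∧ 0 < (shiftAt c x g v).2) ∧
            (0 < (g v).1 ∨ x = v → 0 < (shiftAt c x g v).1) := by
        intro x g hg v hv
        obtain ⟨h1, h2⟩ := hg v hv
        by_cases hx : v = x
        · subst hx
          simp only [shiftAt, Function.update_self, shift]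
          exact ⟨⟨h2.le, by positivity⟩, fun _ => h2⟩
        · simp [shiftAt, hx, h1, h2, Ne.symm hx]
      have hg₂ := hpos (E₂ m) g hg
      have hg₁ := hpos (E₁ m) _ fun v hv => (hg₂ v hv).1
      refine add_pos_of_nonneg_of_pos
        (netZ_nonneg hc.le hL' fun v hv => ⟨(hg v hv).1, (hg v hv).2.le⟩) (mul_pos h0 (ih'
          (fun v hv => (hg₁ v hv).1) fun v hv => ?_))
      rcases hcase v hv with h | h | ⟨_, h | h⟩
      · exact Or.inl ((hg₁ v hv).2 (Or.inl ((hg₂ v hv).2 (Or.inl h))))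
      · exact Or.inr h
      · exact Or.inl ((hg₁ v hv).2 (Or.inr h))
      · exact Or.inl ((hg₁ v hv).2 (Or.inl ((hg₂ v hv).2 (Or.inr h))))

/-- If no edge of nonzero weight meets `w`, the second term of the sequence at `w` is irrelevant. -/
theorem netZ_isolated {E₁ E₂ : ℕ → ℕ} {L : ℕ → ℝ} {m w : ℕ} (hw : w < n)
    (h : ∀ e < m, L e = 0 ∨ (E₁ e ≠ w ∧ E₂ e ≠ w)) (g : ℕ → ℝ × ℝ) :
    netZ c n E₁ E₂ L m (Function.update g w (0, 1)) = 0 := by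
  induction m generalizing g with
  | zero => exact Finset.prod_eq_zero (Finset.mem_range.2 hw) (by simp)
  | succ m ih =>
    have ih' := @ih (fun e he => h e (by omega))
    rw [netZ, ih']
    rcases h m (by omega) with h | ⟨h1, h2⟩
    · simp [h]
    · rw [shiftAt_update_of_ne h2, shiftAt_update_of_ne h1, ih']; simp

/-! ### Comparison with the sum over configurations -/

theorem iterate_shift_fst (a : ℝ × ℝ) (k : ℕ) :
    ((shift c)^[k + 2] a).1 = c * ((shift c)^[k + 1] a).1 + ((shift c)^[k] a).1 := by
  simp only [Function.iterate_succ_apply', shift]; ring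

/-- Closed form of `netZ`. -/
theorem netZ_eq_sum (E₁ E₂ : ℕ → ℕ) (L : ℕ → ℝ) (m : ℕ) (g : ℕ → ℝ × ℝ) :
    netZ c n E₁ E₂ L m g = ∑ σ : Fin m → Bool, (∏ e : Fin m, if σ e then L e else 1) *
      ∏ v ∈ Finset.range n, ((shift c)^[∑ e : Fin m, if σ e then
        ((if E₁ e = v then 1 else 0) + (if E₂ e = v then 1 else 0)) else 0] (g v)).1 := by
  induction m generalizing g with
  | zero => simp [netZ]
  | succ m ih =>
    rw [netZ, ih, ih, ← (Fin.snocEquiv fun _ : Fin (m + 1) => Bool).sum_comp,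
      Fintype.sum_prod_type, Fintype.sum_bool, add_comm, Finset.mul_sum]
    congr 1
    · refine Finset.sum_congr rfl fun σ _ => ?_
      simp only [Fin.snocEquiv_apply, Fin.prod_univ_castSucc, Fin.sum_univ_castSucc,
        Fin.snoc_castSucc, Fin.snoc_last, Fin.val_castSucc, Fin.val_last, if_true]
      have : ∀ v, shiftAt c (E₁ m) (shiftAt c (E₂ m) g) v =
          (shift c)^[(if E₁ m = v then 1 else 0) + (if E₂ m = v then 1 else 0)] (g v) := by
        intro v
        by_cases h1 : E₁ m = v <;> by_cases h2 : E₂ m = v <;>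
          simp [shiftAt, h1, h2, Function.update_apply, eq_comm (a := v)]
      simp only [this, ← Function.iterate_add_apply]
      ring
    · refine Finset.sum_congr rfl fun σ _ => ?_
      simp [Fin.snocEquiv_apply, Fin.prod_univ_castSucc, Fin.sum_univ_castSucc]

/-- The partition function of a Holant instance over a family of two-term recurrences. -/
theorem partitionFunction_eq_netZ {p : ℝ} {Λ : Set ℝ} (Ω : HolantInstance)
    (hΩ : Ω.IsOver (fibonacciFamily c p) Λ) (E₁ E₂ : ℕ → ℕ) (L : ℕ → ℝ) (g : ℕ → ℝ × ℝ)
    (h₁ : ∀ e : Fin Ω.m, E₁ e = (Ω.ends e).1) (h₂ : ∀ e : Fin Ω.m, E₂ e = (Ω.ends e).2)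
    (hL : ∀ e : Fin Ω.m, L e = Ω.weight e) (hg₁ : ∀ v : Fin Ω.n, (g v).1 = (Ω.sig v).getD 0 0)
    (hg₂ : ∀ v : Fin Ω.n, 1 < (Ω.sig v).length → (g v).2 = (Ω.sig v).getD 1 0) :
    Ω.partitionFunction = netZ c Ω.n E₁ E₂ L Ω.m g := by
  rw [netZ_eq_sum]
  refine Finset.sum_congr rfl fun σ _ => ?_
  have hcount : ∀ (e : Fin Ω.m) (v : Fin Ω.n),
      ((if E₁ e = v then 1 else 0) + (if E₂ e = v then 1 else 0)) = endCount (Ω.ends e) v := by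
    intro e v
    simp only [endCount, h₁, h₂, Fin.ext_iff]
  -- Two consecutive terms are carried along, as the recurrence needs. The bound k + 1 < length also
  -- keeps away from vertices of degree 0, where the second component of g is unconstrained.
  have hseq : ∀ v : Fin Ω.n, ∀ k, k + 1 < (Ω.sig v).length →
      ((shift c)^[k] (g v)).1 = (Ω.sig v).getD k 0 ∧
      ((shift c)^[k + 1] (g v)).1 = (Ω.sig v).getD (k + 1) 0 := by
    intro v k
    induction k with
    | zero => intro hk; exact ⟨hg₁ v, hg₂ v hk⟩
    | succ k ih =>
      intro hk
      have := ih (by omega)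
      refine ⟨this.2, ?_⟩
      rw [iterate_shift_fst, this.1, this.2, (hΩ.1 v).1 k (by omega)]
  have hseq' : ∀ v : Fin Ω.n, ∀ k, k < (Ω.sig v).length →
      ((shift c)^[k] (g v)).1 = (Ω.sig v).getD k 0 := by
    intro v k hk
    cases k with
    | zero => exact hg₁ v
    | succ k => exact (hseq v k hk).2
  rw [HolantInstance.configWeight, Finset.prod_range]
  congr 1
  · exact Finset.prod_congr rfl fun e _ => by rw [hL]
  · refine Finset.prod_congr rfl fun v _ => ?_
    simp only [hcount]
    rw [HolantInstance.hamming, hseq']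
    rw [Ω.length_sig v, Nat.lt_succ_iff]
    exact Finset.sum_le_sum fun e _ => by split_ifs <;> simp

end FibonacciHolant


namespace FibonacciHolant

variable {c : ℝ} {n m : ℕ}

/-! ### One step of the recursion for the marginal ratios -/

/-- The value on the sequence `a` of the linear functional with value `X` at `(1, 0)` and value `1`
at `(1, 1)`. -/
def pair (a : ℝ × ℝ) (X : ℝ) : ℝ := a.1 * X + a.2 * (1 - X)

/-- The relative weight of the correction term for an edge that leads to the sequence `F`. -/
noncomputable def corr (c : ℝ) (F : ℝ × ℝ) (X₂ X₃ : ℝ) : ℝ :=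
  pair (shift c F) X₃ / (pair F X₃ + pair (shift c F) X₃ * pair (shift c (1, 1)) X₂)

/-- The contribution of one edge to the partition function, with the sequence `a` at its base. -/
noncomputable def edgeFactor (c : ℝ) (F : ℝ × ℝ) (δ X₁ X₂ X₃ : ℝ) (a : ℝ × ℝ) : ℝ :=
  pair (conv c a F) X₁ / pair (conv c (1, 1) F) X₁ + δ * (pair (shift c a) X₂ * corr c F X₂ X₃)

/-- A network of sequences. -/
structure Net where
  fst : ℕ → ℕ
  snd : ℕ → ℕ
  wt : ℕ → ℝ
  gate : ℕ → ℝ × ℝ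

/-- The partition function with the sequence at `w` replaced by `a`. -/
def Net.Z (G : Net) (c : ℝ) (n m w : ℕ) (a : ℝ × ℝ) : ℝ :=
  netZ c n G.fst G.snd G.wt m (Function.update G.gate w a)

/-- The denominator at (1, 1) is positive in every good network, whereas Z(0, 1) vanishes if w is
isolated. -/
noncomputable def Net.ratio (G : Net) (c : ℝ) (n m w : ℕ) : ℝ :=
  G.Z c n m w (1, 0) / G.Z c n m w (1, 1)

/-- The edge `e` is present and meets the vertex `v`. -/
def Net.Meets (G : Net) (e v : ℕ) : Prop := 0 < G.wt e ∧ (G.fst e = v ∨ G.snd e = v)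

/-- Weight 0 stands for a deleted edge. Nothing is asked of the sequence at w, which is the
variable. The last field excludes isolated vertices with first term 0, which would make Z vanish. -/
structure Net.Good (G : Net) (n m : ℕ) (p δ₀ : ℝ) (w : ℕ) : Prop where
  lt : w < n
  fst_lt : ∀ e < m, G.fst e < n
  snd_lt : ∀ e < m, G.snd e < n
  wt : ∀ e < m, G.wt e = 0 ∨ |G.wt e - 1| ≤ δ₀
  gate : ∀ v < n, v ≠ w → 0 ≤ (G.gate v).1 ∧ p * (G.gate v).1 ≤ (G.gate v).2 ∧ 0 < (G.gate v).2
  meets : ∀ v < n, v ≠ w → 0 < (G.gate v).1 ∨ ∃ e < m, G.Meets e v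

variable {p δ₀ : ℝ} {G G₁ G₂ G₃ : Net} {w : ℕ}

/-- The networks agree on the vertices below `n` and the edges below `m`. -/
structure Net.Agree (n m : ℕ) (G G' : Net) : Prop where
  fst : ∀ e < m, G.fst e = G'.fst e
  snd : ∀ e < m, G.snd e = G'.snd e
  wt : ∀ e < m, G.wt e = G'.wt e
  gate : ∀ v < n, G.gate v = G'.gate v

/-- Contraction of the edge `e` between `w` and `u`. -/
def Net.contract (G : Net) (e w u : ℕ) : Net where
  fst x := if G.fst x = u then w else G.fst x
  snd x := if G.snd x = u then w else G.snd x
  wt := Function.update G.wt e 0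
  gate := Function.update G.gate u (1, 1)

/-- Deletion of the edge `e`, the sequence at `v` becoming `a`. -/
def Net.delete (G : Net) (e v : ℕ) (a : ℝ × ℝ) : Net where
  fst := G.fst
  snd := G.snd
  wt := Function.update G.wt e 0
  gate := Function.update G.gate v a

theorem Net.Agree.Z_eq {G G' : Net} (h : Net.Agree n m G G') (w : ℕ) (a : ℝ × ℝ) :
    G.Z c n m w a = G'.Z c n m w a := by
  refine netZ_congr h.fst h.snd h.wt fun v hv => ?_
  by_cases hvw : v = w
  · subst hvw; simp
  · simp [hvw, h.gate v hv]

theorem Net.Agree.ratio_eq {G G' : Net} (h : Net.Agree n m G G') (w : ℕ) :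
    G.ratio c n m w = G'.ratio c n m w := by
  simp only [Net.ratio, h.Z_eq]

theorem Net.Agree.good {G G' : Net} (h : Net.Agree n m G G') (hG : G'.Good n m p δ₀ w) :
    G.Good n m p δ₀ w where
  lt := hG.lt
  fst_lt e he := h.fst e he ▸ hG.fst_lt e he
  snd_lt e he := h.snd e he ▸ hG.snd_lt e he
  wt e he := h.wt e he ▸ hG.wt e he
  gate v hv hvw := h.gate v hv ▸ hG.gate v hv hvw
  meets v hv hvw := by
    rw [h.gate v hv]
    rcases hG.meets v hv hvw with h' | ⟨e, he, h1, h2⟩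
    · exact Or.inl h'
    · exact Or.inr ⟨e, he, by rw [Net.Meets, h.fst e he, h.snd e he, h.wt e he]; exact ⟨h1, h2⟩⟩

/-! ### Good networks, their marginal ratios, and expansion along an edge -/

theorem Net.Good.wt_nonneg (hG : G.Good n m p δ₀ w) (hδ : δ₀ < 1) : ∀ e < m, 0 ≤ G.wt e := by
  intro e he
  rcases hG.wt e he with h | h
  · exact h.ge
  · linarith [(abs_le.1 h).1]

theorem Net.Good.Z_nonneg (hG : G.Good n m p δ₀ w) (hc : 0 < c) (hδ : δ₀ < 1) {a : ℝ × ℝ}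
    (h1 : 0 ≤ a.1) (h2 : 0 ≤ a.2) : 0 ≤ G.Z c n m w a := by
  refine netZ_nonneg hc.le (hG.wt_nonneg hδ) fun v hv => ?_
  by_cases h : v = w
  · subst h; simp [h1, h2]
  · simp [h, (hG.gate v hv h).1, (hG.gate v hv h).2.2.le]

theorem Net.Good.Z_pos (hG : G.Good n m p δ₀ w) (hc : 0 < c) (hδ : δ₀ < 1) {a : ℝ × ℝ}
    (h1 : 0 < a.1) (h2 : 0 < a.2) : 0 < G.Z c n m w a := by
  refine netZ_pos hc (hG.wt_nonneg hδ) (fun v hv => ?_) fun v hv => ?_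
  · by_cases h : v = w
    · subst h; simp [h1.le, h2]
    · simp [h, (hG.gate v hv h).1, (hG.gate v hv h).2.2]
  · by_cases h : v = w
    · subst h; simp [h1]
    · simpa [h, Net.Meets] using hG.meets v hv h

theorem Net.Z_one_one (hw : w < n) :
    G.Z c n m w (1, 1) = G.Z c n m w (1, 0) + G.Z c n m w (0, 1) := by
  simpa [Net.Z] using netZ_update_eq (c := c) (E₁ := G.fst) (E₂ := G.snd) (L := G.wt) (m := m) hw
    G.gate (1, 1)

theorem Net.Z_add (hw : w < n) (a b : ℝ × ℝ) (x : ℝ) :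
    G.Z c n m w (a.1 + x * b.1, a.2 + x * b.2) = G.Z c n m w a + x * G.Z c n m w b := by
  have := netZ_update_linear (c := c) (E₁ := G.fst) (E₂ := G.snd) (L := G.wt) (m := m) hw G.gate
    1 x a b
  simpa [Net.Z] using this

/-- By linearity Z is a combination of Z(1, 0) and Z(0, 1) = Z(1, 1) - Z(1, 0), so one ratio and one
scale determine it. -/
theorem Net.Good.Z_eq_pair (hG : G.Good n m p δ₀ w) (hc : 0 < c) (hδ : δ₀ < 1) (a : ℝ × ℝ) :
    G.Z c n m w a = G.Z c n m w (1, 1) * pair a (G.ratio c n m w) := by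
  have h := hG.Z_pos hc hδ (a := (1, 1)) one_pos one_pos
  have h1 := Net.Z_one_one (G := G) (c := c) (m := m) hG.lt
  have h2 : G.Z c n m w a = a.1 * G.Z c n m w (1, 0) + a.2 * G.Z c n m w (0, 1) :=
    netZ_update_eq hG.lt G.gate a
  rw [h2, pair, Net.ratio]
  field_simp
  rw [h1]; ring

theorem Net.Good.ratio_mem (hG : G.Good n m p δ₀ w) (hc : 0 < c) (hδ : δ₀ < 1) :
    0 ≤ G.ratio c n m w ∧ G.ratio c n m w ≤ 1 := by
  have h := hG.Z_pos hc hδ (a := (1, 1)) one_pos one_pos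
  refine ⟨div_nonneg (hG.Z_nonneg hc hδ zero_le_one le_rfl) h.le, ?_⟩
  rw [Net.ratio, div_le_one h]
  have h1 := Net.Z_one_one (G := G) (c := c) (m := m) hG.lt
  linarith [hG.Z_nonneg hc hδ (a := (0, 1)) le_rfl zero_le_one]

/-- An isolated w contributes only its first term, so Z(1, 0) = Z(1, 1). This is the exact base case
of the recursion. -/
theorem Net.Good.ratio_isolated (hG : G.Good n m p δ₀ w) (hc : 0 < c) (hδ : δ₀ < 1)
    (h : ∀ e < m, ¬ G.Meets e w) : G.ratio c n m w = 1 := by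
  have h0 := hG.Z_pos hc hδ (a := (1, 1)) one_pos one_pos
  have h1 := Net.Z_one_one (G := G) (c := c) (m := m) hG.lt
  have h2 : G.Z c n m w (0, 1) = 0 := by
    refine netZ_isolated hG.lt (fun e he => ?_) _
    rcases hG.wt e he with h' | h'
    · exact Or.inl h'
    · refine Or.inr (not_or.1 fun h3 => h e he ⟨?_, h3⟩)
      linarith [(abs_le.1 h').1]
  rw [h2, add_zero] at h1
  rw [Net.ratio, ← h1, div_self h0.ne']

theorem Net.Good.meets_of_ne (hG : G.Good n m p δ₀ w) {G' : Net} {e u v : ℕ}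
    (hG' : ∀ x, x ≠ e → G.Meets x v → G'.Meets x v) (he : G.fst e = w ∧ G.snd e = u ∨ G.fst e = u ∧ G.snd e = w)
    (hv : v < n) (hvw : v ≠ w) (hvu : v ≠ u) : 0 < (G.gate v).1 ∨ ∃ x < m, G'.Meets x v := by
  rcases hG.meets v hv hvw with h | ⟨x, hx, hh⟩
  · exact Or.inl h
  · refine Or.inr ⟨x, hx, hG' x ?_ hh⟩
    rintro rfl
    rcases hh with ⟨_, h⟩
    omega

/-- The vertex u loses all its edges and gets the harmless sequence (1, 1), admissible because p ≤
1. Every other vertex keeps its edges, up to renaming of their ends. -/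
theorem Net.Good.contract (hG : G.Good n m p δ₀ w) (hp : p ≤ 1) {e u : ℕ}
    (he : G.fst e = w ∧ G.snd e = u ∨ G.fst e = u ∧ G.snd e = w) :
    (G.contract e w u).Good n m p δ₀ w where
  lt := hG.lt
  fst_lt x hx := by
    have := hG.fst_lt x hx
    have := hG.lt
    simp only [Net.contract]; split_ifs <;> assumption
  snd_lt x hx := by
    have := hG.snd_lt x hx
    have := hG.lt
    simp only [Net.contract]; split_ifs <;> assumption
  wt x hx := by
    by_cases h : x = e
    · subst h; simp [Net.contract]
    · simpa [Net.contract, h] using hG.wt x hx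
  gate v hv hvw := by
    by_cases h : v = u
    · subst h; simp [Net.contract, hp]
    · simpa [Net.contract, h] using hG.gate v hv hvw
  meets v hv hvw := by
    by_cases h : v = u
    · subst h; simp [Net.contract]
    · have : ((G.contract e w u).gate v) = G.gate v := by simp [Net.contract, h]
      rw [this]
      refine hG.meets_of_ne (fun x hx hm => ?_) he hv hvw h
      refine ⟨by simpa [Net.contract, hx] using hm.1, hm.2.imp ?_ ?_⟩ <;>
        · rintro rfl; simp [Net.contract, h]

/-- Only the ends of e can lose their last edge. One of them is the new base, and the other gets a
sequence with positive first term; in the applications this is `shift c F`, which starts with F.2 >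
0, or (1, 1). -/
theorem Net.Good.delete (hG : G.Good n m p δ₀ w) {e u : ℕ} {a : ℝ × ℝ} (ha : 0 < a.1)
    (ha' : p * a.1 ≤ a.2) (ha'' : 0 < a.2)
    (he : G.fst e = w ∧ G.snd e = u ∨ G.fst e = u ∧ G.snd e = w) {v v' : ℕ} (hv' : v' < n)
    (h : v = w ∧ v' = u ∨ v = u ∧ v' = w) :
    (G.delete e v a).Good n m p δ₀ v' where
  lt := hv'
  fst_lt := hG.fst_lt
  snd_lt := hG.snd_lt
  wt x hx := by
    by_cases h : x = e
    · subst h; simp [Net.delete]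
    · simpa [Net.delete, h] using hG.wt x hx
  gate x hx hxv := by
    by_cases h' : x = v
    · subst h'; simp [Net.delete, ha.le, ha', ha'']
    · simpa [Net.delete, h'] using hG.gate x hx (by omega)
  meets x hx hxv := by
    by_cases h' : x = v
    · subst h'; simp [Net.delete, ha]
    · have : ((G.delete e v a).gate x) = G.gate x := by simp [Net.delete, h']
      rw [this]
      refine hG.meets_of_ne (fun x hx hm => ?_) he hx (by omega) (by omega)
      exact ⟨by simpa [Net.delete, hx] using hm.1, hm.2⟩

/-- The expansion of the partition function along an edge between `w` and `u ≠ w`. -/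
theorem Net.Good.expand (hG : G.Good n m p δ₀ w) (hc : 0 < c) (hδ : δ₀ < 1)
    (hp1 : p ≤ 1) (hpc : p ≤ c) {e u : ℕ} (hem : e < m) (hu : u < n) (huw : u ≠ w)
    (he : G.fst e = w ∧ G.snd e = u ∨ G.fst e = u ∧ G.snd e = w) (a : ℝ × ℝ) :
    G.Z c n m w a = (G.contract e w u).Z c n m w (conv c (1, 1) (G.gate u)) *
      edgeFactor c (G.gate u) (G.wt e - 1) ((G.contract e w u).ratio c n m w)
        ((G.delete e u (shift c (G.gate u))).ratio c n m w)
        ((G.delete e w (1, 1)).ratio c n m u) a := by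
  set F := G.gate u with hF
  obtain ⟨hF0, hF1, hF2⟩ := hG.gate u hu huw
  rw [← hF] at hF0 hF1 hF2
  have g₁ := hG.contract hp1 he
  have g₂ : (G.delete e u (shift c F)).Good n m p δ₀ w :=
    hG.delete (by exact hF2) (by simp only [shift]; nlinarith) (by simp only [shift]; positivity)
      he hG.lt (Or.inr ⟨rfl, rfl⟩)
  have g₃ : (G.delete e w (1, 1)).Good n m p δ₀ u :=
    hG.delete one_pos (by simpa using hp1) one_pos he hu (Or.inl ⟨rfl, rfl⟩)
  set X₁ := (G.contract e w u).ratio c n m w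
  set X₂ := (G.delete e u (shift c F)).ratio c n m w
  set X₃ := (G.delete e w (1, 1)).ratio c n m u
  have p₁ := g₁.Z_pos hc hδ (a := (1, 1)) one_pos one_pos
  have p₂ := g₂.Z_pos hc hδ (a := (1, 1)) one_pos one_pos
  have p₃ := g₃.Z_pos hc hδ (a := (1, 1)) one_pos one_pos
  have e₁ : ∀ a, (G.contract e w u).Z c n m w a = (G.contract e w u).Z c n m w (1, 1) * pair a X₁ :=
    g₁.Z_eq_pair hc hδ
  have e₂ : ∀ a, (G.delete e u (shift c F)).Z c n m w a = (G.delete e u (shift c F)).Z c n m w (1, 1) * pair a X₂ :=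
    g₂.Z_eq_pair hc hδ
  have e₃ : ∀ a, (G.delete e w (1, 1)).Z c n m u a = (G.delete e w (1, 1)).Z c n m u (1, 1) * pair a X₃ :=
    g₃.Z_eq_pair hc hδ
  set L' := Function.update G.wt e 0 with hL'
  have two : ∀ a b, netZ c n G.fst G.snd L' m (Function.update (Function.update G.gate u b) w a) =
      (G.delete e u b).Z c n m w a := fun a b => rfl
  have two' : ∀ a b, netZ c n G.fst G.snd L' m
      (Function.update (Function.update G.gate u b) w a) = (G.delete e w a).Z c n m u b := by
    intro a b
    rw [Function.update_comm huw]; rfl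
  have hsh : ∀ a, shiftAt c w (shiftAt c u (Function.update G.gate w a)) =
      Function.update (Function.update G.gate u (shift c F)) w (shift c a) := by
    intro a
    rw [shiftAt_update_of_ne huw, shiftAt_update_self]; rfl
  have hself : ∀ a, Function.update G.gate w a =
      Function.update (Function.update G.gate u F) w a := by
    intro a; rw [hF, Function.update_eq_self]
  have hcon : ∀ a, (G.delete e u F).Z c n m w a + (G.delete e u (shift c F)).Z c n m w (shift c a) =
      (G.contract e w u).Z c n m w (conv c a F) := by
    intro a
    rw [← two, ← two, ← hself, ← hsh, netZ_contract hG.lt hu huw.symm 1]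
    have h1 : Function.update G.gate w a w = a := Function.update_self ..
    have h2 : Function.update G.gate w a u = F := Function.update_of_ne huw _ _
    rw [h1, h2, Function.update_comm huw.symm, Function.update_idem]
    rfl
  have hmain : G.Z c n m w a = (G.delete e u F).Z c n m w a +
      G.wt e * (G.delete e u (shift c F)).Z c n m w (shift c a) := by
    rw [Net.Z, netZ_delete hem, ← two, ← two, ← hself, ← hsh]
    rcases he with ⟨h1, h2⟩ | ⟨h1, h2⟩
    · rw [h1, h2]
    · rw [h1, h2, shiftAt_comm u w]
  -- Prescribing the sequences at both ends gives one network, whether seen from w or from u. So the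
  -- contracted value and the value with e set to 1 are both multiples of the same Z at u, expressed
  -- by X₂ and X₃; their quotient is `corr`.
  have hA := hcon (1, 1)
  have hB : (G.delete e u F).Z c n m w (1, 1) = (G.delete e w (1, 1)).Z c n m u F := by
    rw [← two, ← two']
  have hC : (G.delete e u (shift c F)).Z c n m w (1, 1) =
      (G.delete e w (1, 1)).Z c n m u (shift c F) := by
    rw [← two, ← two']
  rw [hB, e₃, e₂ (shift c (1, 1)), hC, e₃ (shift c F)] at hA
  rw [e₃ (shift c F)] at hC
  have hN : 0 < (G.contract e w u).Z c n m w (conv c (1, 1) F) := by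
    refine g₁.Z_pos hc hδ ?_ ?_ <;> simp only [conv] <;> positivity
  -- Comparison with weight 1, where the contraction is exact, leaves δ = wt e - 1 in front of the
  -- term with e set to 1.
  have hmain' : G.Z c n m w a = (G.contract e w u).Z c n m w (conv c a F) +
      (G.wt e - 1) * (G.delete e u (shift c F)).Z c n m w (shift c a) := by
    rw [hmain, ← hcon]; ring
  rw [hmain', e₂, hC, e₁ (conv c a F), edgeFactor, corr, mul_add]
  have hN' := hN
  rw [e₁] at hN'
  congr 1
  · rw [e₁ (conv c (1, 1) F)]
    have : pair (conv c (1, 1) F) X₁ ≠ 0 := by rintro h; rw [h] at hN'; simp at hN'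
    field_simp
  · rw [← hA]
    have : pair F X₃ + pair (shift c F) X₃ * pair (shift c (1, 1)) X₂ ≠ 0 := by
      intro h
      have : (G.delete e w (1, 1)).Z c n m u (1, 1) *
        (pair F X₃ + pair (shift c F) X₃ * pair (shift c (1, 1)) X₂) = 0 := by rw [h, mul_zero]
      linarith
    field_simp
    
/-- The expansion of the partition function along a loop at `w`. -/
theorem Net.Good.expand_loop (hG : G.Good n m p δ₀ w) (hc : 0 < c) (hδ : δ₀ < 1)
    (hp1 : p ≤ 1) {e : ℕ} (hem : e < m) (h1 : G.fst e = w) (h2 : G.snd e = w)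
    (hL : 0 < G.wt e) (a : ℝ × ℝ) (X₂ X₃ : ℝ) :
    G.Z c n m w a = (G.contract e w w).Z c n m w (conv c (1, 1) (1 + G.wt e, c * G.wt e)) *
      edgeFactor c (1 + G.wt e, c * G.wt e) 0 ((G.contract e w w).ratio c n m w) X₂ X₃ a := by
  have g₁ := hG.contract hp1 (Or.inl ⟨h1, h2⟩)
  have e₁ := g₁.Z_eq_pair hc hδ
  have hN : 0 < (G.contract e w w).Z c n m w (conv c (1, 1) (1 + G.wt e, c * G.wt e)) := by
    refine g₁.Z_pos hc hδ ?_ ?_ <;> simp only [conv] <;> positivity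
  have hN' := hN
  rw [e₁] at hN'
  have hZ : ∀ a, (G.contract e w w).Z c n m w a =
      netZ c n G.fst G.snd (Function.update G.wt e 0) m (Function.update G.gate w a) := by
    intro a
    simp only [Net.Z, Net.contract, Function.update_idem]
    refine netZ_congr (fun x _ => ?_) (fun x _ => ?_) (fun _ _ => rfl) (fun _ _ => rfl)
    · split_ifs with h <;> simp [h]
    · split_ifs with h <;> simp [h]
  -- A loop of weight L multiplies the sequence by 1 + Lx² = (1 + L) + cLx. It acts like an edge of
  -- weight 1 to a vertex with the sequence (1 + L, cL), hence with no correction.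
  have key : G.Z c n m w a = (G.contract e w w).Z c n m w (conv c a (1 + G.wt e, c * G.wt e)) := by
    have hlin := Net.Z_add (G := G.contract e w w) (c := c) (n := n) (m := m) hG.lt a
      (shift c (shift c a)) (G.wt e)
    rw [Net.Z, netZ_delete hem, h1, h2, shiftAt_update_self, shiftAt_update_self, ← hZ, ← hZ,
      ← hlin]
    congr 1
    ext <;> (simp only [conv, shift]; ring)
  rw [key, e₁, edgeFactor, e₁ (conv c (1, 1) _)]
  have : pair (conv c (1, 1) (1 + G.wt e, c * G.wt e)) ((G.contract e w w).ratio c n m w) ≠ 0 := by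
    rintro h; rw [h] at hN'; simp at hN'
  rw [zero_mul, add_zero, mul_assoc, mul_div_cancel₀ _ this]

end FibonacciHolant


namespace FibonacciHolant

variable {c p ν r s : ℝ}

/-! ### Contraction of the recursion -/

/-- A nonzero sequence with nonnegative terms and ratio at least `p`. -/
structure Adm (p : ℝ) (F : ℝ × ℝ) : Prop where
  fst_nonneg : 0 ≤ F.1
  le_snd : p * F.1 ≤ F.2
  snd_pos : 0 < F.2

/-- The coordinate in which an unweighted edge acts linearly, where `r` and `s` are the roots of
`x² = c x + 1`. -/
noncomputable def coord (r s X : ℝ) : ℝ := pair (1, s) X / pair (1, r) X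

/-- The product of the roots is -1 and their sum c is positive, so |s| < 1 < r. This gap is the
source of the contraction. -/
theorem exists_roots (hc : 0 < c) : ∃ r s : ℝ, 1 < r ∧ s < 0 ∧ -1 < s ∧ r + s = c ∧ r * s = -1 := by
  have h := Real.sq_sqrt (show 0 ≤ c ^ 2 + 4 by positivity)
  have h0 := Real.sqrt_nonneg (c ^ 2 + 4)
  set q := Real.sqrt (c ^ 2 + 4)
  have h1 : c < q := by nlinarith
  have h2 : 2 < q := by nlinarith
  have h3 : q < c + 2 := by nlinarith
  exact ⟨(c + q) / 2, (c - q) / 2, by linarith, by linarith, by linarith, by ring, by nlinarith⟩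

theorem one_le_pair_root (hr : 1 < r) {X : ℝ} (hX : X ≤ 1) : 1 ≤ pair (1, r) X := by
  simp only [pair]; nlinarith

theorem pair_root_le (hr : 1 < r) {X : ℝ} (hX : -1 ≤ X) : pair (1, r) X ≤ 2 * r := by
  simp only [pair]; nlinarith

theorem abs_pair_root_le (hs : s < 0) (hs1 : -1 < s) {X : ℝ} (hX : -1 ≤ X) (hX1 : X ≤ 1) :
    |pair (1, s) X| ≤ 3 := by
  simp only [pair]; rw [abs_le]; constructor <;> nlinarith

theorem abs_coord_le (hr : 1 < r) (hs : s < 0) (hs1 : -1 < s) {X : ℝ} (hX : -1 ≤ X) (hX1 : X ≤ 1) :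
    |coord r s X| ≤ 3 := by
  have h1 := one_le_pair_root hr hX1
  rw [coord, abs_div, div_le_iff₀ (by positivity), abs_of_pos (by linarith : 0 < pair (1, r) X)]
  linarith [abs_pair_root_le hs hs1 hX hX1]

/-- `coord` is a Möbius function of X with determinant r - s. -/
theorem coord_sub (hr : 1 < r) {X Y : ℝ} (hX1 : X ≤ 1) (hY1 : Y ≤ 1) :
    coord r s X - coord r s Y = (r - s) * (X - Y) / (pair (1, r) X * pair (1, r) Y) := by
  have h1 := one_le_pair_root hr hX1
  have h2 := one_le_pair_root hr hY1
  rw [coord, coord, div_sub_div _ _ (by linarith) (by linarith)]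
  congr 1
  simp only [pair]; ring

/-- The two denominators are at most 2r each and r - s ≥ 1, which gives the constant 4r². -/
theorem abs_sub_le_coord (hr : 1 < r) (hs : s < 0) {X Y : ℝ} (hX : -1 ≤ X) (hX1 : X ≤ 1)
    (hY : -1 ≤ Y) (hY1 : Y ≤ 1) :
    |X - Y| ≤ 4 * r ^ 2 * |coord r s X - coord r s Y| := by
  have h1 := one_le_pair_root hr hX1
  have h2 := one_le_pair_root hr hY1
  have h3 := pair_root_le hr hX
  have h4 := pair_root_le hr hY
  have hpos : 0 < pair (1, r) X * pair (1, r) Y := by nlinarith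
  rw [coord_sub hr hX1 hY1, abs_div, abs_mul, abs_of_pos hpos, abs_of_pos (by linarith : 0 < r - s),
    ← mul_div_assoc, le_div_iff₀ hpos]
  have h5 : pair (1, r) X * pair (1, r) Y ≤ 4 * r ^ 2 := by nlinarith
  have h6 : 4 * r ^ 2 * 1 ≤ 4 * r ^ 2 * (r - s) := by
    apply mul_le_mul_of_nonneg_left _ (by positivity); linarith
  nlinarith [abs_nonneg (X - Y)]

/-- The multiplier of the linear action. -/
noncomputable def mult (r s : ℝ) (F : ℝ × ℝ) : ℝ := (F.1 + s * F.2) / (F.1 + r * F.2)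

/-- As s = -1/r, the numerator lies between -F.2/r and F.1. Against the denominator F.1 + r F.2 the
lower end costs 1/r², and the upper end costs 1/(1 + pr) because F.2 ≥ p F.1. -/
theorem abs_mult_le (hp : 0 < p) (hr : 1 < r) (hs : s < 0) (hrs : r * s = -1) {F : ℝ × ℝ}
    (hF : Adm p F) : |mult r s F| ≤ max (1 / r ^ 2) (1 / (1 + p * r)) := by
  obtain ⟨h0, h1, h2⟩ := hF
  have hpos : 0 < F.1 + r * F.2 := by nlinarith
  have hsr : s = -1 / r := by field_simp; linarith
  rw [mult, abs_div, abs_of_pos hpos, div_le_iff₀ hpos, abs_le']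
  constructor
  · refine le_trans ?_ (mul_le_mul_of_nonneg_right (le_max_right _ _) hpos.le)
    have : 0 < 1 + p * r := by positivity
    rw [div_mul_eq_mul_div, one_mul, le_div_iff₀ this]
    nlinarith [mul_pos hp (by linarith : (0:ℝ) < r), mul_pos h2 (neg_pos.2 hs), mul_nonneg h0 (neg_pos.2 hs).le]
  · refine le_trans ?_ (mul_le_mul_of_nonneg_right (le_max_left _ _) hpos.le)
    rw [hsr]
    have : 0 < r := by linarith
    field_simp
    nlinarith [mul_nonneg h0 (sq_nonneg r)]

/-- The ratios are considered in the interval `[-ν, 1]`. -/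
structure Margin (c p ν : ℝ) : Prop where
  hc : 0 < c
  hp : 0 < p
  hν : 0 < ν
  hν1 : ν ≤ 1
  hνp : ν ≤ p
  hνc : 2 * ν ≤ c

/-- For negative X the loss is at most ν F.1 ≤ p F.1 ≤ F.2; this is the reason for ν ≤ p. -/
theorem pair_nonneg (hm : Margin c p ν) {F : ℝ × ℝ} (hF : Adm p F) {X : ℝ} (hX : -ν ≤ X) (hX1 : X ≤ 1) :
    0 ≤ pair F X ∧ pair F X ≤ (1 / p + 2) * F.2 := by
  obtain ⟨hc, hp, hν, hν1, hνp, hνc⟩ := hm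
  obtain ⟨h0, h1, h2⟩ := hF
  have h3 : F.1 ≤ 1 / p * F.2 := by rw [div_mul_eq_mul_div, one_mul, le_div_iff₀ hp]; linarith
  simp only [pair]
  constructor
  · rcases le_total 0 X with h | h
    · nlinarith [mul_nonneg h0 h]
    · nlinarith [mul_nonneg h0 (by linarith : 0 ≤ ν + X), mul_nonneg h0 (sub_nonneg.2 hνp)]
  · nlinarith [mul_nonneg h0 (sub_nonneg.2 hX1), mul_nonneg h2.le (by linarith : 0 ≤ 1 + X)]

/-- The coefficient of F.2 is c + (1 - c)X, which is at least 1 if c ≥ 1, and at least c - ν ≥ c/2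
otherwise. -/
theorem pair_shift_ge (hm : Margin c p ν) {F : ℝ × ℝ} (hF : Adm p F) {X : ℝ} (hX : -ν ≤ X) (hX1 : X ≤ 1) :
    min 1 (c / 2) * F.2 ≤ pair (shift c F) X := by
  obtain ⟨hc, hp, hν, hν1, hνp, hνc⟩ := hm
  obtain ⟨h0, h1, h2⟩ := hF
  have h3 : min 1 (c / 2) ≤ X + c * (1 - X) := by
    rcases le_total c 1 with h | h
    · refine (min_le_right _ _).trans ?_; nlinarith
    · refine (min_le_left _ _).trans ?_; nlinarith
  have := mul_le_mul_of_nonneg_right h3 h2.le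
  simp only [pair, shift]
  nlinarith [mul_nonneg h0 (sub_nonneg.2 hX1)]

theorem shift_one_one_ge (hm : Margin c p ν) {X : ℝ} (hX1 : X ≤ 1) : 1 ≤ pair (shift c (1, 1)) X := by
  have := hm.hc
  simp only [pair, shift]; nlinarith

/-- The ratio of the two terms of a sequence under the functional given by `X`. -/
theorem pair_div_bounds (hm : Margin c p ν) {F : ℝ × ℝ} (hF : Adm p F) {X : ℝ} (hX : -ν ≤ X) (hX1 : X ≤ 1) :
    0 ≤ pair F X / pair (shift c F) X ∧
      pair F X / pair (shift c F) X ≤ (1 / p + 2) / min 1 (c / 2) := by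
  have hμ : 0 < min 1 (c / 2) := lt_min one_pos (half_pos hm.hc)
  have h1 := pair_nonneg hm hF hX hX1
  have h2 := pair_shift_ge hm hF hX hX1
  have h3 : 0 < min 1 (c / 2) * F.2 := mul_pos hμ hF.snd_pos
  refine ⟨div_nonneg h1.1 (by linarith), ?_⟩
  rw [div_le_div_iff₀ (by linarith) hμ]
  have : 0 < 1 / p + 2 := by have := hm.hp; positivity
  nlinarith

/-- Again a Möbius function of X. Its determinant and the product of the denominators are both
quadratic in F, and F.1 ≤ F.2/p, so the constant does not depend on F. -/
theorem pair_div_lipschitz (hm : Margin c p ν) {F : ℝ × ℝ} (hF : Adm p F) {X Y : ℝ} (hX : -ν ≤ X) (hX1 : X ≤ 1)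
    (hY : -ν ≤ Y) (hY1 : Y ≤ 1) :
    |pair F X / pair (shift c F) X - pair F Y / pair (shift c F) Y| ≤
      ((1 / p) * (1 / p + c) + 1) / (min 1 (c / 2)) ^ 2 * |X - Y| := by
  have hμ : 0 < min 1 (c / 2) := lt_min one_pos (half_pos hm.hc)
  have h2 := pair_shift_ge hm hF hX hX1
  have h3 := pair_shift_ge hm hF hY hY1
  have hpos : 0 < min 1 (c / 2) * F.2 := mul_pos hμ hF.snd_pos
  have key : pair F X / pair (shift c F) X - pair F Y / pair (shift c F) Y =
      (F.1 * (F.1 + c * F.2) - F.2 * F.2) * (X - Y) /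
        (pair (shift c F) X * pair (shift c F) Y) := by
    rw [div_sub_div _ _ (by linarith) (by linarith)]
    congr 1
    simp only [pair, shift]; ring
  obtain ⟨hc, hp, hν, hν1, hνp, hνc⟩ := hm
  obtain ⟨f0, f1, f2⟩ := hF
  have f3 : F.1 ≤ 1 / p * F.2 := by rw [div_mul_eq_mul_div, one_mul, le_div_iff₀ hp]; linarith
  have hp' : 0 < 1 / p := by positivity
  have hnum : |F.1 * (F.1 + c * F.2) - F.2 * F.2| ≤ ((1 / p) * (1 / p + c) + 1) * F.2 ^ 2 := by
    have : F.1 * (F.1 + c * F.2) ≤ (1 / p * F.2) * (1 / p * F.2 + c * F.2) := by gcongr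
    have : 0 ≤ F.1 * (F.1 + c * F.2) := by positivity
    rw [abs_le]; constructor <;> nlinarith [sq_nonneg F.2, mul_pos hp' hp', mul_pos hp' hc, mul_nonneg (mul_pos hp' hc).le (sq_nonneg F.2), mul_nonneg (mul_pos hp' hp').le (sq_nonneg F.2)]
  have hden : (min 1 (c / 2) * F.2) * (min 1 (c / 2) * F.2) ≤
      pair (shift c F) X * pair (shift c F) Y := by gcongr; linarith
  rw [key, abs_div, abs_mul, abs_of_pos (by nlinarith : 0 < pair (shift c F) X * pair (shift c F) Y),
    div_le_iff₀ (by nlinarith)]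
  calc _ ≤ ((1 / p) * (1 / p + c) + 1) * F.2 ^ 2 * |X - Y| := by gcongr
    _ = ((1 / p) * (1 / p + c) + 1) / (min 1 (c / 2)) ^ 2 * |X - Y| *
        ((min 1 (c / 2) * F.2) * (min 1 (c / 2) * F.2)) := by field_simp
    _ ≤ _ := by gcongr

theorem corr_eq (hm : Margin c p ν) {F : ℝ × ℝ} (hF : Adm p F) {X₂ X₃ : ℝ} (hX₃ : -ν ≤ X₃) (hX₃1 : X₃ ≤ 1) :
    corr c F X₂ X₃ = 1 / (pair F X₃ / pair (shift c F) X₃ + pair (shift c (1, 1)) X₂) := by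
  have hμ : 0 < min 1 (c / 2) := lt_min one_pos (half_pos hm.hc)
  have h2 := pair_shift_ge hm hF hX₃ hX₃1
  have hpos : 0 < min 1 (c / 2) * F.2 := mul_pos hμ hF.snd_pos
  have : pair (shift c F) X₃ ≠ 0 := by linarith
  rw [corr, div_add' _ _ _ this, one_div_div, mul_comm (pair (shift c (1, 1)) X₂)]

theorem corr_bounds (hm : Margin c p ν) {F : ℝ × ℝ} (hF : Adm p F) {X₂ X₃ : ℝ} (hX₂1 : X₂ ≤ 1)
    (hX₃ : -ν ≤ X₃) (hX₃1 : X₃ ≤ 1) : 0 < corr c F X₂ X₃ ∧ corr c F X₂ X₃ ≤ 1 ∧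
      pair (shift c (1, 1)) X₂ * corr c F X₂ X₃ ≤ 1 := by
  have h1 := (pair_div_bounds hm hF hX₃ hX₃1).1
  have h2 := shift_one_one_ge hm hX₂1
  rw [corr_eq hm hF hX₃ hX₃1]
  refine ⟨by positivity, ?_, ?_⟩
  · rw [div_le_one (by positivity)]; linarith
  · rw [mul_one_div, div_le_one (by positivity)]; linarith

/-- `corr` has the form 1/(x + u) with x ≥ 0 and u ≥ 1, so it changes by no more than x and u do. -/
theorem corr_lipschitz (hm : Margin c p ν) {F : ℝ × ℝ} (hF : Adm p F) {X₂ X₃ Y₂ Y₃ : ℝ} (hX₂1 : X₂ ≤ 1)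
    (hX₃ : -ν ≤ X₃) (hX₃1 : X₃ ≤ 1) (hY₂1 : Y₂ ≤ 1) (hY₃ : -ν ≤ Y₃) (hY₃1 : Y₃ ≤ 1) :
    |corr c F X₂ X₃ - corr c F Y₂ Y₃| ≤ c * |X₂ - Y₂| +
      ((1 / p) * (1 / p + c) + 1) / (min 1 (c / 2)) ^ 2 * |X₃ - Y₃| := by
  have h1 := (pair_div_bounds hm hF hX₃ hX₃1).1
  have h2 := shift_one_one_ge hm hX₂1
  have h1' := (pair_div_bounds hm hF hY₃ hY₃1).1
  have h2' := shift_one_one_ge hm hY₂1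
  have h3 := pair_div_lipschitz hm hF hX₃ hX₃1 hY₃ hY₃1
  have h4 : pair (shift c (1, 1)) X₂ - pair (shift c (1, 1)) Y₂ = -(c * (X₂ - Y₂)) := by
    simp only [pair, shift]; ring
  have h5 : |pair (shift c (1, 1)) X₂ - pair (shift c (1, 1)) Y₂| = c * |X₂ - Y₂| := by
    rw [h4, abs_neg, abs_mul, abs_of_pos hm.hc]
  rw [corr_eq hm hF hX₃ hX₃1, corr_eq hm hF hY₃ hY₃1]
  set x := pair F X₃ / pair (shift c F) X₃
  set y := pair F Y₃ / pair (shift c F) Y₃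
  set u := pair (shift c (1, 1)) X₂
  set v := pair (shift c (1, 1)) Y₂
  have hxu : 1 ≤ x + u := by linarith
  have hyv : 1 ≤ y + v := by linarith
  rw [div_sub_div _ _ (by linarith) (by linarith), abs_div,
    abs_of_pos (by nlinarith : 0 < (x + u) * (y + v)), div_le_iff₀ (by nlinarith)]
  have h6 : |1 * (y + v) - (x + u) * 1| ≤ |x - y| + |u - v| := by
    rw [show 1 * (y + v) - (x + u) * 1 = -((x - y) + (u - v)) by ring, abs_neg]
    exact abs_add_le _ _
  have h7 : 1 ≤ (x + u) * (y + v) := by nlinarith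
  rw [h5] at h6
  nlinarith [abs_nonneg (x - y), abs_nonneg (X₂ - Y₂), abs_nonneg (1 * (y + v) - (x + u) * 1)]

theorem edgeFactor_linear (F : ℝ × ℝ) (δ X₁ X₂ X₃ : ℝ) (a : ℝ × ℝ) :
    edgeFactor c F δ X₁ X₂ X₃ a = a.1 * edgeFactor c F δ X₁ X₂ X₃ (1, 0) +
      a.2 * edgeFactor c F δ X₁ X₂ X₃ (0, 1) := by
  simp only [edgeFactor, pair, conv, shift]; ring

theorem abs_mul_sub_mul_le {x x' y y' K L e : ℝ} (hx : |x| ≤ K) (hy : |y'| ≤ L)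
    (hxx : |x - x'| ≤ K * e) (hyy : |y - y'| ≤ L * e) :
    |x * y - x' * y'| ≤ 2 * (K * L) * e := by
  have : x * y - x' * y' = x * (y - y') + (x - x') * y' := by ring
  rw [this]
  refine (abs_add_le _ _).trans ?_
  rw [abs_mul, abs_mul]
  nlinarith [mul_le_mul hx hyy (abs_nonneg _) ((abs_nonneg _).trans hx),
    mul_le_mul hxx hy (abs_nonneg _) ((abs_nonneg _).trans hxx)]

/-- A small perturbation of a contraction is a contraction. -/
theorem perturbed_quotient {u u' x x' y y' δ K θ e : ℝ} (hθ : 0 ≤ θ) (hθ1 : θ ≤ 1)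
    (he : 0 ≤ e) (hu : |u - u'| ≤ θ * e) (hu' : |u'| ≤ 3) (hx' : |x'| ≤ K) (hy : |y| ≤ K)
    (hy' : |y'| ≤ K) (hxx : |x - x'| ≤ K * e) (hyy : |y - y'| ≤ K * e) (hδ : |δ| * K ≤ 1 / 2) :
    |(u + δ * x) / (1 + δ * y) - (u' + δ * x') / (1 + δ * y')| ≤ (θ + 21 * (|δ| * K)) * e := by
  have hK : 0 ≤ K := (abs_nonneg _).trans hy
  set k := |δ| * K with hk
  have hk0 : 0 ≤ k := by positivity
  have hb : ∀ z, |z| ≤ K → |δ * z| ≤ k := fun z hz => by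
    rw [abs_mul]; exact mul_le_mul_of_nonneg_left hz (abs_nonneg _)
  have h1 := abs_le.1 (hb y hy)
  have h2 := abs_le.1 (hb y' hy')
  have h3 := hb x' hx'
  have d1 : 0 < 1 + δ * y := by linarith
  have d2 : 0 < 1 + δ * y' := by linarith
  have e1 : |δ * (x - x')| ≤ k * e := by
    rw [abs_mul, hk, mul_assoc]; exact mul_le_mul_of_nonneg_left hxx (abs_nonneg _)
  have e2 : |δ * (y' - y)| ≤ k * e := by
    rw [abs_mul, hk, mul_assoc, abs_sub_comm]; exact mul_le_mul_of_nonneg_left hyy (abs_nonneg _)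
  have key : (u + δ * x) / (1 + δ * y) - (u' + δ * x') / (1 + δ * y') =
      ((u - u') + δ * (x - x')) / (1 + δ * y) +
      (u' + δ * x') * (δ * (y' - y)) / ((1 + δ * y) * (1 + δ * y')) := by
    field_simp; ring
  rw [key]
  refine (abs_add_le _ _).trans ?_
  -- With k = |δ| K the two summands contribute 5k and 16k, whence the constant 21.
  have a1 : |((u - u') + δ * (x - x')) / (1 + δ * y)| ≤ (θ + 5 * k) * e := by
    rw [abs_div, abs_of_pos d1, div_le_iff₀ d1]
    refine ((abs_add_le _ _).trans (add_le_add hu e1)).trans ?_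
    have : (θ + k) ≤ (θ + 5 * k) * (1 + δ * y) := by
      have : (θ + 5 * k) * (1 - k) ≤ (θ + 5 * k) * (1 + δ * y) := by gcongr; linarith
      nlinarith
    nlinarith
  have a2 : |(u' + δ * x') * (δ * (y' - y)) / ((1 + δ * y) * (1 + δ * y'))| ≤ 16 * k * e := by
    have hd : 1 / 4 ≤ (1 + δ * y) * (1 + δ * y') := by nlinarith
    rw [abs_div, abs_mul, abs_of_pos (by linarith : 0 < (1 + δ * y) * (1 + δ * y')),
      div_le_iff₀ (by linarith)]
    have : |u' + δ * x'| ≤ 4 := (abs_add_le _ _).trans (by linarith)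
    have h5 := mul_le_mul this e2 (abs_nonneg _) (by norm_num)
    have h6 : 0 ≤ k * e := by positivity
    nlinarith
  nlinarith

end FibonacciHolant


/-! ### The perturbed recursion and the choice of the constants -/

namespace FibonacciHolant

variable {c p ν r s : ℝ}

/-- The constants and the metric coordinate for which one step of the recursion contracts. -/
structure Contracts (c p δ₀ ν θ K : ℝ) (ψ : ℝ → ℝ) : Prop where
  ν_pos : 0 < ν
  abs_le : ∀ X, -ν ≤ X → X ≤ 1 → |ψ X| ≤ 3
  mem : ∀ F, Adm p F → ∀ δ, |δ| ≤ δ₀ → ∀ X₁ X₂ X₃, -ν ≤ X₁ → X₁ ≤ 1 → -ν ≤ X₂ → X₂ ≤ 1 → -ν ≤ X₃ →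
    X₃ ≤ 1 → -ν ≤ edgeFactor c F δ X₁ X₂ X₃ (1, 0) / edgeFactor c F δ X₁ X₂ X₃ (1, 1) ∧
      edgeFactor c F δ X₁ X₂ X₃ (1, 0) / edgeFactor c F δ X₁ X₂ X₃ (1, 1) ≤ 1
  contract : ∀ F, Adm p F → ∀ δ, |δ| ≤ δ₀ → ∀ X₁ X₂ X₃, -ν ≤ X₁ → X₁ ≤ 1 → -ν ≤ X₂ → X₂ ≤ 1 →
    -ν ≤ X₃ → X₃ ≤ 1 → ∀ Y₁ Y₂ Y₃, -ν ≤ Y₁ → Y₁ ≤ 1 → -ν ≤ Y₂ → Y₂ ≤ 1 → -ν ≤ Y₃ → Y₃ ≤ 1 → ∀ e,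
    |ψ X₁ - ψ Y₁| ≤ e → |ψ X₂ - ψ Y₂| ≤ e → |ψ X₃ - ψ Y₃| ≤ e →
    |ψ (edgeFactor c F δ X₁ X₂ X₃ (1, 0) / edgeFactor c F δ X₁ X₂ X₃ (1, 1)) -
      ψ (edgeFactor c F δ Y₁ Y₂ Y₃ (1, 0) / edgeFactor c F δ Y₁ Y₂ Y₃ (1, 1))| ≤ θ * e
  approx : ∀ F, Adm p F → ∀ δ, |δ| ≤ δ₀ → ∀ X₁ X₂ X₃, -ν ≤ X₁ → X₁ ≤ 1 → -ν ≤ X₂ → X₂ ≤ 1 →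
    -ν ≤ X₃ → X₃ ≤ 1 → ∀ Y₁ Y₂ Y₃, -ν ≤ Y₁ → Y₁ ≤ 1 → -ν ≤ Y₂ → Y₂ ≤ 1 → -ν ≤ Y₃ → Y₃ ≤ 1 → ∀ e,
    |ψ X₁ - ψ Y₁| ≤ e → |ψ X₂ - ψ Y₂| ≤ e → |ψ X₃ - ψ Y₃| ≤ e → ∀ a, Adm p a →
    0 ≤ edgeFactor c F δ X₁ X₂ X₃ (1, 0) →
    0 < edgeFactor c F δ X₁ X₂ X₃ a ∧
    |edgeFactor c F δ Y₁ Y₂ Y₃ a - edgeFactor c F δ X₁ X₂ X₃ a| ≤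
      K * e * edgeFactor c F δ X₁ X₂ X₃ a

theorem edgeFactor_zero (F : ℝ × ℝ) (X₁ X₂ X₃ : ℝ) (a : ℝ × ℝ) :
    edgeFactor c F 0 X₁ X₂ X₃ a = edgeFactor c F 0 X₁ 1 1 a := by
  simp [edgeFactor]

theorem pair_conv_one_one (F : ℝ × ℝ) (X : ℝ) :
    pair (conv c (1, 1) F) X = pair F X + pair (shift c F) X := by
  simp only [pair, conv, shift]; ring

theorem pair_shift_pos (hm : Margin c p ν) {F : ℝ × ℝ} (hF : Adm p F) {X : ℝ} (hX : -ν ≤ X)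
    (hX1 : X ≤ 1) : 0 < pair (shift c F) X :=
  (mul_pos (lt_min one_pos (half_pos hm.hc)) hF.snd_pos).trans_le (pair_shift_ge hm hF hX hX1)

/-- Everything at δ = 0 is written through the one quotient t = pair F X₁ / pair (shift c F) X₁,
whose bounds and Lipschitz constant are known. -/
theorem edgeFactor_one_zero (hm : Margin c p ν) {F : ℝ × ℝ} (hF : Adm p F) {X₁ : ℝ} (hX : -ν ≤ X₁)
    (hX1 : X₁ ≤ 1) (δ X₂ X₃ : ℝ) : edgeFactor c F δ X₁ X₂ X₃ (1, 0) =
      1 - 1 / (1 + pair F X₁ / pair (shift c F) X₁) + δ * ((1 - X₂) * corr c F X₂ X₃) := by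
  have h1 := pair_shift_pos hm hF hX hX1
  have h2 := (pair_nonneg hm hF hX hX1).1
  rw [edgeFactor, pair_conv_one_one]
  have : conv c (1, 0) F = F := by ext <;> simp [conv]
  rw [this]
  congr 1
  · field_simp; ring
  · simp [pair, shift]

theorem edgeFactor_zero_one (hm : Margin c p ν) {F : ℝ × ℝ} (hF : Adm p F) {X₁ : ℝ} (hX : -ν ≤ X₁)
    (hX1 : X₁ ≤ 1) (δ X₂ X₃ : ℝ) : edgeFactor c F δ X₁ X₂ X₃ (0, 1) =
      1 / (1 + pair F X₁ / pair (shift c F) X₁) +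
        δ * ((X₂ + c * (1 - X₂)) * corr c F X₂ X₃) := by
  have h1 := pair_shift_pos hm hF hX hX1
  have h2 := (pair_nonneg hm hF hX hX1).1
  rw [edgeFactor, pair_conv_one_one]
  have : conv c (0, 1) F = shift c F := by ext <;> simp [conv, shift]
  rw [this]
  congr 1
  · field_simp; ring
  · simp [pair, shift]

theorem edgeFactor_one_one (c : ℝ) (F : ℝ × ℝ) (δ X₁ X₂ X₃ : ℝ) : edgeFactor c F δ X₁ X₂ X₃ (1, 1) =
    edgeFactor c F δ X₁ X₂ X₃ (1, 0) + edgeFactor c F δ X₁ X₂ X₃ (0, 1) := by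
  rw [edgeFactor_linear]; simp

/-- A lower bound for the probability that an unweighted edge has value `1`. -/
noncomputable def edgeMin (c p : ℝ) : ℝ := 1 / (1 + (1 / p + 2) / min 1 (c / 2))

theorem edgeMin_pos (hm : Margin c p ν) : 0 < edgeMin c p := by
  have := hm.hp
  have : 0 < min 1 (c / 2) := lt_min one_pos (half_pos hm.hc)
  unfold edgeMin; positivity

/-- For δ = 0 the values at (1, 0) and (0, 1) are nonnegative with sum 1, and the second is at least
`edgeMin`. The corrections at (1, 0), (0, 1), (1, 1) are at least -δ₁ times 2, 1 + 2c and 1. The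
value at (1, 0) may thus become slightly negative, but its quotient by the value at (1, 1) stays
above -4δ₁ ≥ -ν: this is why ratios are allowed in [-ν, 1]. -/
theorem edgeFactor_bounds (hm : Margin c p ν) {F : ℝ × ℝ} (hF : Adm p F) {X₁ X₂ X₃ : ℝ}
    (hX₁ : -ν ≤ X₁) (hX₁1 : X₁ ≤ 1) (hX₂ : -ν ≤ X₂) (hX₂1 : X₂ ≤ 1) (hX₃ : -ν ≤ X₃) (hX₃1 : X₃ ≤ 1)
    {δ δ₁ : ℝ} (hδ : |δ| ≤ δ₁) (h₁ : 4 * δ₁ ≤ ν) (h₂ : 2 * (1 + 2 * c) * δ₁ ≤ edgeMin c p) :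
    -(2 * δ₁) ≤ edgeFactor c F δ X₁ X₂ X₃ (1, 0) ∧
    edgeMin c p / 2 ≤ edgeFactor c F δ X₁ X₂ X₃ (0, 1) ∧
    1 / 2 ≤ edgeFactor c F δ X₁ X₂ X₃ (1, 1) := by
  obtain ⟨t0, t1⟩ := pair_div_bounds hm hF hX₁ hX₁1
  obtain ⟨c0, c1, c2⟩ := corr_bounds hm hF hX₂1 hX₃ hX₃1
  have hν1 := hm.hν1
  have hc := hm.hc
  have hδ' := abs_le.1 hδ
  have hδ0 : 0 ≤ δ₁ := (abs_nonneg _).trans hδ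
  set t := pair F X₁ / pair (shift c F) X₁ with ht
  set H := corr c F X₂ X₃
  have key : ∀ z M, 0 ≤ z → z ≤ M → -(δ₁ * M) ≤ δ * z := by
    intro z M hz hM
    nlinarith [mul_le_mul_of_nonneg_left hM hδ0]
  have b1 : 0 ≤ 1 - 1 / (1 + t) := by
    rw [sub_nonneg, div_le_one (by linarith)]; linarith
  have b2 : edgeMin c p ≤ 1 / (1 + t) := by
    unfold edgeMin; gcongr
  have g1 := key ((1 - X₂) * H) 2 (mul_nonneg (by linarith) c0.le) (by nlinarith)
  have g2 := key ((X₂ + c * (1 - X₂)) * H) (1 + 2 * c) (mul_nonneg (by nlinarith [hm.hνc]) c0.le) (by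
    have : X₂ + c * (1 - X₂) ≤ 1 + 2 * c := by nlinarith
    nlinarith [hm.hνc])
  have g3 := key (pair (shift c (1, 1)) X₂ * H) 1
    (mul_nonneg (by linarith [shift_one_one_ge hm hX₂1]) c0.le) c2
  rw [edgeFactor_one_one, edgeFactor_one_zero hm hF hX₁ hX₁1, edgeFactor_zero_one hm hF hX₁ hX₁1,
    ← ht]
  refine ⟨by linarith, by linarith, ?_⟩
  have : pair (shift c (1, 1)) X₂ = (1 - X₂) + (X₂ + c * (1 - X₂)) := by
    simp only [pair, shift]; ring
  rw [this] at g3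
  nlinarith

/-- For a root x, the sequence (1, x) is an eigenvector: `conv` with F multiplies it by F.1 + x F.2,
and `shift` multiplies it by x. So the unperturbed map is linear in `coord`, and the rest is put in
the shape (u + δx)/(1 + δy) of `perturbed_quotient`. -/
theorem edgeFactor_coord (hm : Margin c p ν) (hr : 1 < r) (hs : s < 0) (hrs : r + s = c)
    (hrs' : r * s = -1) {F : ℝ × ℝ} (hF : Adm p F)
    {X₁ X₂ X₃ : ℝ} (hX₁ : -ν ≤ X₁) (hX₁1 : X₁ ≤ 1) {δ : ℝ}
    (hpos : edgeFactor c F δ X₁ X₂ X₃ (1, 1) ≠ 0) :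
    coord r s (edgeFactor c F δ X₁ X₂ X₃ (1, 0) / edgeFactor c F δ X₁ X₂ X₃ (1, 1)) =
      (mult r s F * coord r s X₁ + δ * (((1 - s) / (r - s) + (r - 1) / (r - s) *
        (mult r s F * coord r s X₁)) * ((s * pair (1, s) X₂) * corr c F X₂ X₃))) /
      (1 + δ * (((1 - s) / (r - s) + (r - 1) / (r - s) * (mult r s F * coord r s X₁)) *
        ((r * pair (1, r) X₂) * corr c F X₂ X₃))) := by
  have hR := one_le_pair_root hr hX₁1
  have hFr : 0 < F.1 + r * F.2 := by nlinarith [hF.fst_nonneg, hF.snd_pos]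
  have h1 := pair_shift_pos hm hF hX₁ hX₁1
  have h2 := (pair_nonneg hm hF hX₁ hX₁1).1
  have hP : 0 < pair (conv c (1, 1) F) X₁ := by rw [pair_conv_one_one]; linarith
  have hrs0 : 0 < r - s := by linarith
  set P := pair (conv c (1, 1) F) X₁ with hPdef
  -- From (1, 1) = (1-s)/(r-s) · (1, r) + (r-1)/(r-s) · (1, s): after normalisation the denominator
  -- of `edgeFactor` is affine in the contracted coordinate, so it is bounded and Lipschitz without
  -- further estimates.
  have hQ : (1 - s) / (r - s) + (r - 1) / (r - s) * (mult r s F * coord r s X₁) =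
      P / ((F.1 + r * F.2) * pair (1, r) X₁) := by
    rw [mult, coord, hPdef]
    field_simp
    rw [← hrs]
    simp only [pair, conv]
    linear_combination (F.2 * (r - s) * (X₁ - 1)) * hrs'
  have hcr : ∀ x, x = r ∨ x = s → pair (conv c (1, x) F) X₁ = (F.1 + x * F.2) * pair (1, x) X₁ := by
    intro x hx
    have hx2 : x ^ 2 = c * x + 1 := by rcases hx with rfl | rfl <;> nlinarith
    simp only [pair, conv]
    linear_combination -(F.2 * (1 - X₁)) * hx2
  have hsx : ∀ x, x = r ∨ x = s → pair (shift c (1, x)) X₂ = x * pair (1, x) X₂ := by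
    intro x hx
    have hx2 : x ^ 2 = c * x + 1 := by rcases hx with rfl | rfl <;> nlinarith
    simp only [pair, shift]
    linear_combination -(1 - X₂) * hx2
  have hnum : ∀ x, pair (1, x) (edgeFactor c F δ X₁ X₂ X₃ (1, 0) / edgeFactor c F δ X₁ X₂ X₃ (1, 1))
      = edgeFactor c F δ X₁ X₂ X₃ (1, x) / edgeFactor c F δ X₁ X₂ X₃ (1, 1) := by
    intro x
    rw [edgeFactor_linear _ _ _ _ _ (1, x)]
    have h3 := edgeFactor_one_one c F δ X₁ X₂ X₃
    have h4 : edgeFactor c F δ X₁ X₂ X₃ (0, 1) =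
      edgeFactor c F δ X₁ X₂ X₃ (1, 1) - edgeFactor c F δ X₁ X₂ X₃ (1, 0) := by linarith
    rw [h4]
    simp only [pair]
    field_simp
  have hQ0 : P / ((F.1 + r * F.2) * pair (1, r) X₁) ≠ 0 := by positivity
  have hE : ∀ x, x = r ∨ x = s → P / ((F.1 + r * F.2) * pair (1, r) X₁) * edgeFactor c F δ X₁ X₂ X₃ (1, x) =
      (F.1 + x * F.2) * pair (1, x) X₁ / ((F.1 + r * F.2) * pair (1, r) X₁) +
      δ * (P / ((F.1 + r * F.2) * pair (1, r) X₁) * ((x * pair (1, x) X₂) * corr c F X₂ X₃)) := by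
    intro x hx
    rw [edgeFactor, hcr x hx, hsx x hx, ← hPdef]
    field_simp
  rw [coord, hnum, hnum, div_div_div_cancel_right₀ hpos, hQ, ← mul_div_mul_left _ _ hQ0,
    hE s (Or.inr rfl), hE r (Or.inl rfl), div_self (by positivity), mult, coord, mul_div_mul_comm]

theorem abs_one_div_sub_le {t t' : ℝ} (ht : 0 ≤ t) (ht' : 0 ≤ t') :
    |1 / (1 + t) - 1 / (1 + t')| ≤ |t - t'| := by
  rw [div_sub_div _ _ (by linarith) (by linarith), abs_div,
    abs_of_pos (by positivity : 0 < (1 + t) * (1 + t')), div_le_iff₀ (by positivity),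
    show 1 * (1 + t') - (1 + t) * 1 = -(t - t') by ring, abs_neg]
  have : 1 ≤ (1 + t) * (1 + t') := by nlinarith [mul_nonneg ht ht']
  nlinarith [abs_nonneg (t - t')]

theorem sub_le_of_coord (hm : Margin c p ν) (hr : 1 < r) (hs : s < 0) {X Y e : ℝ} (h1 : -ν ≤ X)
    (h2 : X ≤ 1) (h3 : -ν ≤ Y) (h4 : Y ≤ 1) (h5 : |coord r s X - coord r s Y| ≤ e) :
    |X - Y| ≤ 4 * r ^ 2 * e := by
  have hν1 := hm.hν1
  refine (abs_sub_le_coord hr hs (by linarith) h2 (by linarith) h4).trans ?_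
  gcongr

theorem abs_mul_pair_le {x X : ℝ} (hx : |x| ≤ r) (hX : -1 ≤ X) (hX1 : X ≤ 1) :
    |x * pair (1, x) X| ≤ r * (2 * r + 1) := by
  have hr : 0 ≤ r := (abs_nonneg _).trans hx
  have h1 : |X| ≤ 1 := abs_le.2 ⟨hX, hX1⟩
  have h2 : |1 - X| ≤ 2 := by rw [abs_of_nonneg (by linarith)]; linarith
  have h3 : |pair (1, x) X| ≤ 2 * r + 1 := by
    have := mul_le_mul hx h2 (abs_nonneg _) hr
    rw [pair, one_mul]
    refine (abs_add_le _ _).trans ?_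
    rw [abs_mul]; linarith
  rw [abs_mul]
  exact mul_le_mul hx h3 (abs_nonneg _) hr

theorem mult_bound_lt_one (hp : 0 < p) (hr : 1 < r) :
    0 < max (1 / r ^ 2) (1 / (1 + p * r)) ∧ max (1 / r ^ 2) (1 / (1 + p * r)) < 1 := by
  refine ⟨lt_max_of_lt_left (by positivity), max_lt ?_ ?_⟩
  · rw [div_lt_one (by positivity)]; nlinarith
  · rw [div_lt_one (by positivity)]; nlinarith

-- The unperturbed part contracts by the bound on `mult`, and each perturbation is a product of
-- three bounded Lipschitz factors: the normaliser, an eigenvalue term and `corr`. It matters that B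
-- is fixed before δ₀, so that δ₀ can be made small against it.
set_option maxHeartbeats 400000 in
theorem exists_contract_bound (hm : Margin c p ν)
    (hr : 1 < r) (hs : s < 0) (hs1 : -1 < s)
    (hrs : r + s = c) (hrs' : r * s = -1) : ∃ B, 0 < B ∧ ∀ δ₀, 4 * δ₀ ≤ ν →
    2 * (1 + 2 * c) * δ₀ ≤ edgeMin c p → δ₀ * B ≤ 1 / 2 →
    ∀ F, Adm p F → ∀ δ, |δ| ≤ δ₀ → ∀ X₁ X₂ X₃, -ν ≤ X₁ → X₁ ≤ 1 → -ν ≤ X₂ → X₂ ≤ 1 →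
    -ν ≤ X₃ → X₃ ≤ 1 → ∀ Y₁ Y₂ Y₃, -ν ≤ Y₁ → Y₁ ≤ 1 → -ν ≤ Y₂ → Y₂ ≤ 1 → -ν ≤ Y₃ → Y₃ ≤ 1 → ∀ e,
    |coord r s X₁ - coord r s Y₁| ≤ e → |coord r s X₂ - coord r s Y₂| ≤ e →
    |coord r s X₃ - coord r s Y₃| ≤ e →
    |coord r s (edgeFactor c F δ X₁ X₂ X₃ (1, 0) / edgeFactor c F δ X₁ X₂ X₃ (1, 1)) -
      coord r s (edgeFactor c F δ Y₁ Y₂ Y₃ (1, 0) / edgeFactor c F δ Y₁ Y₂ Y₃ (1, 1))| ≤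
      (max (1 / r ^ 2) (1 / (1 + p * r)) + 21 * (δ₀ * B)) * e := by
  have hc := hm.hc
  have hp := hm.hp
  have hν1 := hm.hν1
  have hν0 := hm.hν
  obtain ⟨hθ0, hθ1⟩ := mult_bound_lt_one hp hr
  set θ₀ := max (1 / r ^ 2) (1 / (1 + p * r)) with hθ₀
  set T := ((1 / p) * (1 / p + c) + 1) / (min 1 (c / 2)) ^ 2 with hT
  have hT0 : 0 < T := by
    have : 0 < min 1 (c / 2) := lt_min one_pos (half_pos hc)
    positivity
  set R := 4 * r ^ 2 with hR
  have hR1 : 4 ≤ R := by nlinarith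
  have hR0 : 0 < R := by linarith
  -- `M` bounds the factors of the perturbation and their Lipschitz constants
  set M := 4 + r * (2 * r + 1) + r * (r + 1) * R + (c + T) * R with hM
  have m1 : 0 ≤ r * (2 * r + 1) := by positivity
  have m2 : 0 ≤ r * (r + 1) * R := by positivity
  have m3 : 0 ≤ (c + T) * R := by positivity
  have hM4 : 4 ≤ M := by linarith
  have hM0 : 0 < M := by linarith
  -- Two applications of `abs_mul_sub_mul_le`: the inner product of two factors has constant 2M²,
  -- the product with the normaliser twice M times that.
  set B := 2 * (M * (2 * (M * M))) with hB
  have hB0 : 0 < B := by positivity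
  have hBM : M * (M * M) ≤ B := by
    have := mul_pos hM0 (mul_pos hM0 hM0)
    rw [hB]; linarith
  refine ⟨B, hB0, ?_⟩
  intro δ₀ d1 d2 d3 F hF δ hδ X₁ X₂ X₃ a1 b1 a2 b2 a3 b3 Y₁ Y₂ Y₃ a1' b1' a2' b2' a3' b3' e e1 e2 e3
  have he : 0 ≤ e := (abs_nonneg _).trans e1
  obtain ⟨-, -, u3⟩ := edgeFactor_bounds hm hF a1 b1 a2 b2 a3 b3 hδ d1 d2
  obtain ⟨-, -, v3⟩ := edgeFactor_bounds hm hF a1' b1' a2' b2' a3' b3' hδ d1 d2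
  rw [edgeFactor_coord hm hr hs hrs hrs' hF a1 b1 (by linarith),
    edgeFactor_coord hm hr hs hrs hrs' hF a1' b1' (by linarith)]
  have hz := abs_mult_le hp hr hs hrs' hF
  rw [← hθ₀] at hz
  have c1 := abs_coord_le hr hs hs1 (by linarith) b1
  have c1' := abs_coord_le hr hs hs1 (by linarith) b1'
  have hu : |mult r s F * coord r s X₁ - mult r s F * coord r s Y₁| ≤ θ₀ * e := by
    rw [← mul_sub, abs_mul]
    exact mul_le_mul hz e1 (abs_nonneg _) hθ0.le
  have hw : ∀ x, |x| ≤ 3 → |mult r s F * x| ≤ 3 := by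
    intro x hx
    rw [abs_mul]
    calc |mult r s F| * |x| ≤ 1 * 3 :=
          mul_le_mul (hz.trans hθ1.le) hx (abs_nonneg _) zero_le_one
      _ = 3 := by norm_num
  -- the normalising factor
  have hA0 : 0 ≤ (1 - s) / (r - s) := div_nonneg (by linarith) (by linarith)
  have hA1 : (1 - s) / (r - s) ≤ 1 := by rw [div_le_one (by linarith)]; linarith
  have hB0' : 0 ≤ (r - 1) / (r - s) := div_nonneg (by linarith) (by linarith)
  have hB1 : (r - 1) / (r - s) ≤ 1 := by rw [div_le_one (by linarith)]; linarith
  have hQb : ∀ x, |x| ≤ 3 → |(1 - s) / (r - s) + (r - 1) / (r - s) * x| ≤ M := by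
    intro x hx
    refine (abs_add_le _ _).trans ?_
    rw [abs_mul, abs_of_nonneg hA0, abs_of_nonneg hB0']
    have := mul_le_mul hB1 hx (abs_nonneg _) zero_le_one
    linarith
  have hQl : |((1 - s) / (r - s) + (r - 1) / (r - s) * (mult r s F * coord r s X₁)) -
      ((1 - s) / (r - s) + (r - 1) / (r - s) * (mult r s F * coord r s Y₁))| ≤ M * e := by
    rw [add_sub_add_left_eq_sub, ← mul_sub, abs_mul, abs_of_nonneg hB0']
    have h7 := mul_le_mul hB1 hu (abs_nonneg _) zero_le_one
    have h8 : θ₀ * e ≤ M * e := mul_le_mul_of_nonneg_right (by linarith) he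
    linarith
  -- the correction factor
  obtain ⟨k0, k1, -⟩ := corr_bounds hm hF b2 a3 b3
  obtain ⟨k0', k1', -⟩ := corr_bounds hm hF b2' a3' b3'
  have hd2 := sub_le_of_coord hm hr hs a2 b2 a2' b2' e2
  have hd3 := sub_le_of_coord hm hr hs a3 b3 a3' b3' e3
  have hHl : |corr c F X₂ X₃ - corr c F Y₂ Y₃| ≤ M * e := by
    refine (corr_lipschitz hm hF b2 a3 b3 b2' a3' b3').trans ?_
    rw [← hT]
    calc c * |X₂ - Y₂| + T * |X₃ - Y₃| ≤ c * (R * e) + T * (R * e) := by gcongr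
      _ = (c + T) * R * e := by ring
      _ ≤ M * e := mul_le_mul_of_nonneg_right (by linarith) he
  have hHb : ∀ x : ℝ, 0 < x → x ≤ 1 → |x| ≤ M := fun x h h' => by
    rw [abs_of_pos h]; linarith
  have hsr : |s| ≤ r := by rw [abs_of_neg hs]; linarith
  have hpb : ∀ x, |x| ≤ r → ∀ X, -ν ≤ X → X ≤ 1 → |x * pair (1, x) X| ≤ M := by
    intro x hx X h1 h2
    exact (abs_mul_pair_le hx (by linarith) h2).trans (by linarith)
  have hpl : ∀ x, |x| ≤ r → |x * pair (1, x) X₂ - x * pair (1, x) Y₂| ≤ M * e := by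
    intro x hx
    have : x * pair (1, x) X₂ - x * pair (1, x) Y₂ = x * (1 - x) * (X₂ - Y₂) := by
      simp only [pair]; ring
    rw [this, abs_mul, abs_mul]
    have h4 : |1 - x| ≤ r + 1 := (abs_sub _ _).trans (by simp; linarith)
    calc |x| * |1 - x| * |X₂ - Y₂| ≤ r * (r + 1) * (R * e) := by gcongr
      _ = r * (r + 1) * R * e := by ring
      _ ≤ M * e := mul_le_mul_of_nonneg_right (by linarith) he
  have hWl : ∀ x, |x| ≤ r → |(x * pair (1, x) X₂) * corr c F X₂ X₃ -
      (x * pair (1, x) Y₂) * corr c F Y₂ Y₃| ≤ 2 * (M * M) * e := fun x hx =>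
    abs_mul_sub_mul_le (hpb x hx X₂ a2 b2) (hHb _ k0' k1') (hpl x hx) hHl
  have hWb : ∀ x, |x| ≤ r → ∀ X h, -ν ≤ X → X ≤ 1 → 0 < h → h ≤ 1 →
      |(x * pair (1, x) X) * h| ≤ M * M := by
    intro x hx X h h1 h2 h3 h4
    rw [abs_mul]
    exact mul_le_mul (hpb x hx X h1 h2) (hHb h h3 h4) (abs_nonneg _) hM0.le
  have hMM : M * M ≤ 2 * (M * M) := by linarith [mul_pos hM0 hM0]
  have hPl : ∀ x, |x| ≤ r → _ := fun x hx =>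
    abs_mul_sub_mul_le (hQb _ (hw _ c1)) ((hWb x hx Y₂ _ a2' b2' k0' k1').trans hMM) hQl (hWl x hx)
  have hPb : ∀ x, |x| ≤ r → ∀ q X h, |q| ≤ M → -ν ≤ X → X ≤ 1 → 0 < h → h ≤ 1 →
      |q * ((x * pair (1, x) X) * h)| ≤ B := by
    intro x hx q X h h0 h1 h2 h3 h4
    rw [abs_mul]
    exact (mul_le_mul h0 (hWb x hx X h h1 h2 h3 h4) (abs_nonneg _) hM0.le).trans hBM
  have hrr : |r| ≤ r := by rw [abs_of_pos (by linarith)]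
  have hδB : |δ| * B ≤ δ₀ * B := by gcongr
  refine (perturbed_quotient (K := B) hθ0.le hθ1.le he hu (hw _ c1') ?_ ?_ ?_ (hPl s hsr)
    (hPl r hrr) (by linarith)).trans ?_
  · exact hPb s hsr _ _ _ (hQb _ (hw _ c1')) a2' b2' k0' k1'
  · exact hPb r hrr _ _ _ (hQb _ (hw _ c1)) a2 b2 k0 k1
  · exact hPb r hrr _ _ _ (hQb _ (hw _ c1')) a2' b2' k0' k1'
  · gcongr

-- Additive errors of order e turn into relative ones because the exact value at a is at least a.2 ·
-- edgeMin/2, while a.1 ≤ a.2/p. The lower bound needs a nonnegative value at (1, 0), which exact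
-- ratios provide.
set_option maxHeartbeats 400000 in
theorem exists_approx_bound (hm : Margin c p ν) (hr : 1 < r) (hs : s < 0) :
    ∃ K, 0 < K ∧ ∀ δ₀, 4 * δ₀ ≤ ν → 2 * (1 + 2 * c) * δ₀ ≤ edgeMin c p →
    ∀ F, Adm p F → ∀ δ, |δ| ≤ δ₀ → ∀ X₁ X₂ X₃, -ν ≤ X₁ → X₁ ≤ 1 → -ν ≤ X₂ → X₂ ≤ 1 →
    -ν ≤ X₃ → X₃ ≤ 1 → ∀ Y₁ Y₂ Y₃, -ν ≤ Y₁ → Y₁ ≤ 1 → -ν ≤ Y₂ → Y₂ ≤ 1 → -ν ≤ Y₃ → Y₃ ≤ 1 → ∀ e,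
    |coord r s X₁ - coord r s Y₁| ≤ e → |coord r s X₂ - coord r s Y₂| ≤ e →
    |coord r s X₃ - coord r s Y₃| ≤ e →
    ∀ a, Adm p a → 0 ≤ edgeFactor c F δ X₁ X₂ X₃ (1, 0) →
    0 < edgeFactor c F δ X₁ X₂ X₃ a ∧
    |edgeFactor c F δ Y₁ Y₂ Y₃ a - edgeFactor c F δ X₁ X₂ X₃ a| ≤
      K * e * edgeFactor c F δ X₁ X₂ X₃ a := by
  have hc := hm.hc
  have hp := hm.hp
  have hν1 := hm.hν1
  have hν0 := hm.hν
  have hmin := edgeMin_pos hm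
  set T := ((1 / p) * (1 / p + c) + 1) / (min 1 (c / 2)) ^ 2 with hT
  have hT0 : 0 < T := by
    have : 0 < min 1 (c / 2) := lt_min one_pos (half_pos hc)
    positivity
  set R := 4 * r ^ 2 with hR
  have hR1 : 4 ≤ R := by nlinarith
  have hR0 : 0 < R := by linarith
  -- The bracket dominates the Lipschitz constants T + 2(c+T) + 1 and T + (1+2c)(c+T) + 1 + c of the
  -- values at (1, 0) and (0, 1); R passes from `coord` to X.
  refine ⟨(1 / p + 1) * ((T + (2 * (c + T) + 1 + 2 * c) + (1 + 2 * c) * (c + T)) * R) *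
    (2 / edgeMin c p), by positivity, ?_⟩
  intro δ₀ d1 d2 F hF δ hδ X₁ X₂ X₃ a1 b1 a2 b2 a3 b3 Y₁ Y₂ Y₃ a1' b1' a2' b2' a3' b3' e e1 e2 e3 a ha h0
  have he : 0 ≤ e := (abs_nonneg _).trans e1
  obtain ⟨-, u2, -⟩ := edgeFactor_bounds hm hF a1 b1 a2 b2 a3 b3 hδ d1 d2
  obtain ⟨k0, k1, -⟩ := corr_bounds hm hF b2 a3 b3
  obtain ⟨k0', k1', -⟩ := corr_bounds hm hF b2' a3' b3'
  have hd1 := sub_le_of_coord hm hr hs a1 b1 a1' b1' e1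
  have hd2 := sub_le_of_coord hm hr hs a2 b2 a2' b2' e2
  have hd3 := sub_le_of_coord hm hr hs a3 b3 a3' b3' e3
  have hHl : |corr c F X₂ X₃ - corr c F Y₂ Y₃| ≤ (c + T) * (R * e) := by
    refine (corr_lipschitz hm hF b2 a3 b3 b2' a3' b3').trans ?_
    rw [← hT]
    calc c * |X₂ - Y₂| + T * |X₃ - Y₃| ≤ c * (R * e) + T * (R * e) := by gcongr
      _ = (c + T) * (R * e) := by ring
  have hδ1 : |δ| ≤ 1 := hδ.trans (by linarith)
  set L := (T + (2 * (c + T) + 1 + 2 * c) + (1 + 2 * c) * (c + T)) * R * e with hL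
  have ht : |1 / (1 + pair F X₁ / pair (shift c F) X₁) -
      1 / (1 + pair F Y₁ / pair (shift c F) Y₁)| ≤ T * (R * e) := by
    refine (abs_one_div_sub_le (pair_div_bounds hm hF a1 b1).1
      (pair_div_bounds hm hF a1' b1').1).trans ?_
    refine (pair_div_lipschitz hm hF a1 b1 a1' b1').trans ?_
    rw [← hT]; gcongr
  have hcorr : ∀ x x' A l : ℝ, 0 ≤ l → |x| ≤ A → |x - x'| ≤ l * |X₂ - Y₂| →
      |δ * (x * corr c F X₂ X₃) - δ * (x' * corr c F Y₂ Y₃)| ≤ (A * (c + T) + l) * (R * e) := by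
    intro x x' A l hl hx hxx
    have hA : 0 ≤ A := (abs_nonneg _).trans hx
    have h1 : x * corr c F X₂ X₃ - x' * corr c F Y₂ Y₃ =
      x * (corr c F X₂ X₃ - corr c F Y₂ Y₃) + (x - x') * corr c F Y₂ Y₃ := by ring
    rw [← mul_sub, abs_mul, h1]
    calc _ ≤ 1 * |x * (corr c F X₂ X₃ - corr c F Y₂ Y₃) + (x - x') * corr c F Y₂ Y₃| := by gcongr
      _ ≤ |x| * |corr c F X₂ X₃ - corr c F Y₂ Y₃| + |x - x'| * |corr c F Y₂ Y₃| := by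
        rw [one_mul, ← abs_mul, ← abs_mul]; exact abs_add_le _ _
      _ ≤ A * ((c + T) * (R * e)) + l * (R * e) * 1 := by
        have : |x - x'| ≤ l * (R * e) := hxx.trans (by gcongr)
        have h2 : |corr c F Y₂ Y₃| ≤ 1 := by rw [abs_of_pos k0']; exact k1'
        gcongr
      _ = _ := by ring
  have l1 : |edgeFactor c F δ Y₁ Y₂ Y₃ (1, 0) - edgeFactor c F δ X₁ X₂ X₃ (1, 0)| ≤ L := by
    rw [edgeFactor_one_zero hm hF a1 b1, edgeFactor_one_zero hm hF a1' b1', abs_sub_comm]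
    have h1 := hcorr (1 - X₂) (1 - Y₂) 2 1 zero_le_one (by rw [abs_le]; constructor <;> linarith)
      (by rw [one_mul, abs_sub_comm X₂]; apply le_of_eq; congr 1; ring)
    have h2 := abs_sub (1 / (1 + pair F X₁ / pair (shift c F) X₁) -
      1 / (1 + pair F Y₁ / pair (shift c F) Y₁)) (δ * ((1 - X₂) * corr c F X₂ X₃) -
        δ * ((1 - Y₂) * corr c F Y₂ Y₃))
    rw [abs_sub_comm] at h2
    refine (le_of_eq (by congr 1; ring)).trans (h2.trans ?_)
    have : 0 ≤ ((1 + 2 * c) * (c + T) + 2 * c) * (R * e) := by positivity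
    rw [hL]; linarith
  have l2 : |edgeFactor c F δ Y₁ Y₂ Y₃ (0, 1) - edgeFactor c F δ X₁ X₂ X₃ (0, 1)| ≤ L := by
    rw [edgeFactor_zero_one hm hF a1 b1, edgeFactor_zero_one hm hF a1' b1', abs_sub_comm]
    have hconv : -(1 + 2 * c) ≤ X₂ + c * (1 - X₂) ∧ X₂ + c * (1 - X₂) ≤ 1 + 2 * c := by
      have h3 := mul_nonneg hc.le (by linarith : 0 ≤ 1 - X₂)
      have h4 := mul_le_mul_of_nonneg_left (by linarith : 1 - X₂ ≤ 2) hc.le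
      constructor <;> linarith
    have h1 := hcorr (X₂ + c * (1 - X₂)) (Y₂ + c * (1 - Y₂)) (1 + 2 * c) (1 + c) (by positivity)
      (abs_le.2 ⟨hconv.1, hconv.2⟩)
      (by
        rw [show X₂ + c * (1 - X₂) - (Y₂ + c * (1 - Y₂)) = (1 - c) * (X₂ - Y₂) by ring, abs_mul]
        gcongr
        exact (abs_sub _ _).trans (by rw [abs_one, abs_of_pos hc]))
    have h2 := abs_add_le (1 / (1 + pair F X₁ / pair (shift c F) X₁) -
      1 / (1 + pair F Y₁ / pair (shift c F) Y₁)) (δ * ((X₂ + c * (1 - X₂)) * corr c F X₂ X₃) -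
        δ * ((Y₂ + c * (1 - Y₂)) * corr c F Y₂ Y₃))
    refine (le_of_eq (by congr 1; ring)).trans (h2.trans ?_)
    have : 0 ≤ (2 * (c + T) + c) * (R * e) := by positivity
    rw [hL]; linarith
  obtain ⟨f0, f1, f2⟩ := ha
  have f3 : a.1 ≤ 1 / p * a.2 := by rw [div_mul_eq_mul_div, one_mul, le_div_iff₀ hp]; linarith
  have hL0 : 0 ≤ L := (abs_nonneg _).trans l1
  rw [edgeFactor_linear _ _ X₁ _ _ a, edgeFactor_linear _ _ Y₁ _ _ a]
  have lower : a.2 * (edgeMin c p / 2) ≤ a.1 * edgeFactor c F δ X₁ X₂ X₃ (1, 0) +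
      a.2 * edgeFactor c F δ X₁ X₂ X₃ (0, 1) := by
    have := mul_le_mul_of_nonneg_left u2 f2.le
    have := mul_nonneg f0 h0
    linarith
  refine ⟨(mul_pos f2 (half_pos hmin)).trans_le lower, ?_⟩
  calc _ = |a.1 * (edgeFactor c F δ Y₁ Y₂ Y₃ (1, 0) - edgeFactor c F δ X₁ X₂ X₃ (1, 0)) +
        a.2 * (edgeFactor c F δ Y₁ Y₂ Y₃ (0, 1) - edgeFactor c F δ X₁ X₂ X₃ (0, 1))| := by
        congr 1; ring
    _ ≤ a.1 * L + a.2 * L := by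
        refine (abs_add_le _ _).trans ?_
        rw [abs_mul, abs_mul, abs_of_nonneg f0, abs_of_pos f2]; gcongr
    _ ≤ (1 / p * a.2) * L + a.2 * L := by gcongr
    _ = (1 / p + 1) * L * (2 / edgeMin c p) * (a.2 * (edgeMin c p / 2)) := by field_simp
    _ ≤ (1 / p + 1) * L * (2 / edgeMin c p) * _ :=
        mul_le_mul_of_nonneg_left lower (by positivity)
    _ = _ := by rw [hL]; ring

/-- All bounds are available before δ₀ is chosen. The number 42 = 2 · 21 spends half of the gap 1 -
θ₀ on the perturbation, which leaves the rate (1 + θ₀)/2. -/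
theorem exists_contracts (hc : 0 < c) (hp : 0 < p) (hp1 : p ≤ 1) :
    ∃ δ₀ ν θ K ψ, 0 < δ₀ ∧ δ₀ ≤ 1 / 2 ∧ 0 < θ ∧ θ < 1 ∧ 0 < K ∧ Contracts c p δ₀ ν θ K ψ := by
  obtain ⟨r, s, hr, hs, hs1, hrs, hrs'⟩ := exists_roots hc
  obtain ⟨ν, hν⟩ : ∃ ν, ν = min p (c / 2) := ⟨_, rfl⟩
  have hm : Margin c p ν := by
    have h1 : ν ≤ p := hν ▸ min_le_left _ _
    have h2 : ν ≤ c / 2 := hν ▸ min_le_right _ _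
    exact ⟨hc, hp, hν ▸ lt_min hp (half_pos hc), h1.trans hp1, h1, by linarith⟩
  have hν1 := hm.hν1
  have hν0 := hm.hν
  have hmin := edgeMin_pos hm
  obtain ⟨hθ0, hθ1⟩ := mult_bound_lt_one hp hr
  obtain ⟨B, hB0, hcon⟩ := exists_contract_bound hm hr hs hs1 hrs hrs'
  obtain ⟨K, hK0, happ⟩ := exists_approx_bound hm hr hs
  set θ₀ := max (1 / r ^ 2) (1 / (1 + p * r)) with hθ₀
  obtain ⟨δ₀, hδ₀⟩ : ∃ δ₀, δ₀ = min (ν / 4) (min (edgeMin c p / (2 * (1 + 2 * c)))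
      ((1 - θ₀) / (42 * B))) := ⟨_, rfl⟩
  have d1 : 4 * δ₀ ≤ ν := by
    have : δ₀ ≤ ν / 4 := hδ₀ ▸ min_le_left _ _
    linarith
  have d2 : 2 * (1 + 2 * c) * δ₀ ≤ edgeMin c p := by
    have : δ₀ ≤ edgeMin c p / (2 * (1 + 2 * c)) :=
      hδ₀ ▸ (min_le_right _ _).trans (min_le_left _ _)
    rw [le_div_iff₀ (by positivity)] at this
    linarith
  have d3 : 42 * (δ₀ * B) ≤ 1 - θ₀ := by
    have : δ₀ ≤ (1 - θ₀) / (42 * B) := hδ₀ ▸ (min_le_right _ _).trans (min_le_right _ _)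
    rw [le_div_iff₀ (by positivity)] at this
    linarith
  have hδpos : 0 < δ₀ := by
    rw [hδ₀]
    exact lt_min (by positivity) (lt_min (by positivity) (div_pos (by linarith) (by positivity)))
  refine ⟨δ₀, ν, (1 + θ₀) / 2, K, coord r s, hδpos, by linarith, by linarith, by linarith, hK0, hν0,
    ?_, ?_, ?_, happ δ₀ d1 d2⟩
  · intro X h1 h2
    exact abs_coord_le hr hs hs1 (by linarith) h2
  · intro F hF δ hδ X₁ X₂ X₃ a1 b1 a2 b2 a3 b3
    obtain ⟨u1, u2, u3⟩ := edgeFactor_bounds hm hF a1 b1 a2 b2 a3 b3 hδ d1 d2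
    constructor
    · rw [le_div_iff₀ (by linarith)]
      have := mul_le_mul_of_nonneg_left u3 hν0.le
      linarith
    · rw [div_le_one (by linarith), edgeFactor_one_one]; linarith
  · intro F hF δ hδ X₁ X₂ X₃ a1 b1 a2 b2 a3 b3 Y₁ Y₂ Y₃ a1' b1' a2' b2' a3' b3' e e1 e2 e3
    refine (hcon δ₀ d1 d2 (by linarith) F hF δ hδ X₁ X₂ X₃ a1 b1 a2 b2 a3 b3 Y₁ Y₂ Y₃ a1' b1' a2' b2'
      a3' b3' e e1 e2 e3).trans ?_
    exact mul_le_mul_of_nonneg_right (by linarith) ((abs_nonneg _).trans e1)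

end FibonacciHolant


namespace FibonacciHolant

variable {c p δ₀ ν θ K : ℝ} {n m : ℕ} {ψ : ℝ → ℝ}

/-! ### The recursion tree -/

/-- The other end of the edge `e` at `w`. -/
def Net.other (G : Net) (e w : ℕ) : ℕ := G.fst e + G.snd e - w

/-- How a node of the recursion tree, the network `G` with base vertex `w`, is related to its
children: `sel` is `0` if no edge meets `w`, and otherwise `e + 1` for the last edge `e` at `w`. -/
structure NodeSpec (c : ℝ) (n m : ℕ) (G : Net) (w sel : ℕ) (F : ℝ × ℝ) (δ : ℝ)
    (G₁ G₂ G₃ : Net) (w₁ w₂ w₃ : ℕ) : Prop where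
  none : sel = 0 → ∀ e < m, ¬ G.Meets e w
  some : ∀ e, sel = e + 1 → e < m ∧ G.Meets e w ∧ ∀ x < m, e < x → ¬ G.Meets x w
  seq : ∀ e, sel = e + 1 →
    F = if G.other e w = w then (1 + G.wt e, c * G.wt e) else G.gate (G.other e w)
  dev : ∀ e, sel = e + 1 → δ = if G.other e w = w then 0 else G.wt e - 1
  child₁ : ∀ e, sel = e + 1 → Net.Agree n m G₁ (G.contract e w (G.other e w)) ∧ w₁ = w
  child₂ : ∀ e, sel = e + 1 →
    Net.Agree n m G₂ (G.delete e (G.other e w) (shift c (G.gate (G.other e w)))) ∧ w₂ = w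
  child₃ : ∀ e, sel = e + 1 → Net.Agree n m G₃ (G.delete e w (1, 1)) ∧ w₃ = G.other e w

/-- Standing assumptions on the parameters. -/
structure Params (c p δ₀ : ℝ) : Prop where
  hc : 0 < c
  hp : 0 < p
  hp1 : p ≤ 1
  hpc : 3 * p ≤ c
  hδ : δ₀ ≤ 1 / 2

/-- Unites the expansions along a proper edge and along a loop. For a loop δ = 0, the second and
third child need not be good, and X₂, X₃ are mere placeholders. -/
theorem NodeSpec.step (hP : Params c p δ₀) {G G₁ G₂ G₃ : Net} {w sel w₁ w₂ w₃ : ℕ} {F : ℝ × ℝ}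
    {δ : ℝ} (h : NodeSpec c n m G w sel F δ G₁ G₂ G₃ w₁ w₂ w₃) (hG : G.Good n m p δ₀ w) {e : ℕ}
    (he : sel = e + 1) : Adm p F ∧ |δ| ≤ δ₀ ∧ G₁.Good n m p δ₀ w₁ ∧ ∃ X₂ X₃, 0 ≤ X₂ ∧ X₂ ≤ 1 ∧
      0 ≤ X₃ ∧ X₃ ≤ 1 ∧ (δ = 0 ∨ (X₂ = G₂.ratio c n m w₂ ∧ X₃ = G₃.ratio c n m w₃ ∧
        G₂.Good n m p δ₀ w₂ ∧ G₃.Good n m p δ₀ w₃)) ∧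
      ∀ a, G.Z c n m w a = G₁.Z c n m w₁ (conv c (1, 1) F) *
        edgeFactor c F δ (G₁.ratio c n m w₁) X₂ X₃ a := by
  obtain ⟨hem, hmeet, -⟩ := h.some e he
  have hF := h.seq e he
  have hd := h.dev e he
  obtain ⟨a₁, rfl⟩ := h.child₁ e he
  obtain ⟨a₂, rfl⟩ := h.child₂ e he
  obtain ⟨a₃, b₃⟩ := h.child₃ e he
  have hδ1 : δ₀ < 1 := by linarith [hP.hδ]
  have hends : G.fst e = w₂ ∧ G.snd e = G.other e w₂ ∨
      G.fst e = G.other e w₂ ∧ G.snd e = w₂ := by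
    simp only [Net.other]
    rcases hmeet.2 with h | h
    · left; omega
    · right; omega
  have hu : G.other e w₂ < n := by
    have := hG.fst_lt e hem
    have := hG.snd_lt e hem
    omega
  have hL : |G.wt e - 1| ≤ δ₀ := (hG.wt e hem).resolve_left hmeet.1.ne'
  have g₁ := a₁.good (hG.contract hP.hp1 hends)
  have hδ0 : 0 ≤ δ₀ := (abs_nonneg _).trans hL
  by_cases huw : G.other e w₂ = w₂
  · rw [if_pos huw] at hF hd
    subst hF hd
    have hc := hP.hc
    -- Weight at least 1/2 gives 1 + wt ≤ 3 wt, and then 3p ≤ c makes the sequence of the loop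
    -- admissible.
    have hhalf : 1 / 2 ≤ G.wt e := by linarith [(abs_le.1 hL).1, hP.hδ]
    refine ⟨⟨?_, ?_, ?_⟩, by simpa using hδ0, g₁, 1, 1, zero_le_one, le_rfl, zero_le_one, le_rfl,
      Or.inl rfl, fun a => ?_⟩
    · simp only; linarith
    · simp only
      have h1 := mul_le_mul_of_nonneg_right hP.hpc (by linarith : 0 ≤ G.wt e)
      have h2 := mul_le_mul_of_nonneg_left (by linarith : 1 + G.wt e ≤ 3 * G.wt e) hP.hp.le
      linarith
    · exact mul_pos hc hmeet.1
    · rw [huw] at hends a₁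
      rw [a₁.Z_eq, a₁.ratio_eq]
      exact hG.expand_loop hc hδ1 hP.hp1 hem (by omega) (by omega) hmeet.1 a 1 1
  · rw [if_neg huw] at hF hd
    subst hF hd b₃
    obtain ⟨f0, f1, f2⟩ := hG.gate _ hu huw
    have hc := hP.hc
    have hp := hP.hp
    have g₂ : G₂.Good n m p δ₀ w₂ := a₂.good (hG.delete (by exact f2)
      (by
        simp only [shift]
        have := mul_le_mul_of_nonneg_right (by linarith [hP.hpc] : p ≤ c) f2.le
        linarith) (by simp only [shift]; positivity) hends hG.lt (Or.inr ⟨rfl, rfl⟩))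
    have g₃ : G₃.Good n m p δ₀ (G.other e w₂) := a₃.good (hG.delete one_pos
      (by simpa using hP.hp1) one_pos hends hu (Or.inl ⟨rfl, rfl⟩))
    obtain ⟨r0, r1⟩ := g₂.ratio_mem hc hδ1
    obtain ⟨s0, s1⟩ := g₃.ratio_mem hc hδ1
    refine ⟨⟨f0, f1, f2⟩, hL, g₁, G₂.ratio c n m w₂, G₃.ratio c n m (G.other e w₂), r0, r1, s0, s1,
      Or.inr ⟨rfl, rfl, g₂, g₃⟩, fun a => ?_⟩
    rw [a₁.Z_eq, a₁.ratio_eq, a₂.ratio_eq, a₃.ratio_eq]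
    exact hG.expand hc hδ1 hP.hp1 (by linarith [hP.hpc]) hem hu huw hends a

/-- The recursion tree in heap layout, truncated at the node `N`. -/
structure TreeSpec (c : ℝ) (n m N : ℕ) (node : ℕ → Net) (act sel : ℕ → ℕ) (F : ℕ → ℝ × ℝ)
    (δ val : ℕ → ℝ) : Prop where
  step : ∀ j < N, NodeSpec c n m (node j) (act j) (sel j) (F j) (δ j)
    (node (3 * j + 1)) (node (3 * j + 2)) (node (3 * j + 3))
    (act (3 * j + 1)) (act (3 * j + 2)) (act (3 * j + 3))
  leaf : ∀ j, N ≤ j → j ≤ 3 * N → val j = 1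
  val_none : ∀ j < N, sel j = 0 → val j = 1
  val_some : ∀ j < N, sel j ≠ 0 → val j =
    edgeFactor c (F j) (δ j) (val (3 * j + 1)) (val (3 * j + 2)) (val (3 * j + 3)) (1, 0) /
    edgeFactor c (F j) (δ j) (val (3 * j + 1)) (val (3 * j + 2)) (val (3 * j + 3)) (1, 1)

variable {N : ℕ} {node : ℕ → Net} {act sel : ℕ → ℕ} {F : ℕ → ℝ × ℝ} {δ val : ℕ → ℝ}

/-- The maximum of the three errors serves as e, so no q-th root of B is needed. -/
theorem exists_common_bound {q : ℕ} {B x y z : ℝ} (hx : |x| ^ q * N ≤ B) (hy : |y| ^ q * N ≤ B)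
    (hz : |z| ^ q * N ≤ B) : ∃ e, 0 ≤ e ∧ |x| ≤ e ∧ |y| ≤ e ∧ |z| ≤ e ∧ e ^ q * N ≤ B := by
  refine ⟨max |x| (max |y| |z|), (abs_nonneg x).trans (le_max_left _ _), le_max_left _ _,
    (le_max_left _ _).trans (le_max_right _ _), (le_max_right _ _).trans (le_max_right _ _), ?_⟩
  rcases max_choice |x| (max |y| |z|) with h | h <;> rw [h]
  · exact hx
  · rcases max_choice |y| |z| with h | h <;> rw [h]
    · exact hy
    · exact hz

/-- At the cut j + 1 ≥ N, and two values of ψ differ by at most 6, so the bound is trivial there.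
From the children to the parent it improves: their indices are at most 3j + 3, which costs the
factor (3j + 4)/(j + 1) ≤ 4, and the contraction gains θ^q ≤ 1/4. -/
theorem TreeSpec.error (hP : Params c p δ₀) (hψ : Contracts c p δ₀ ν θ K ψ) (hθ : 0 < θ)
    {q : ℕ} (hq : 4 * θ ^ q ≤ 1) (hT : TreeSpec c n m N node act sel F δ val) :
    ∀ j ≤ 3 * N, (node j).Good n m p δ₀ (act j) → (-ν ≤ val j ∧ val j ≤ 1) ∧
      |ψ ((node j).ratio c n m (act j)) - ψ (val j)| ^ q * N ≤ 6 ^ q * (j + 1) := by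
  have hδ1 : δ₀ < 1 := by linarith [hP.hδ]
  have hν := hψ.ν_pos
  have leaf : ∀ j, N ≤ j → j ≤ 3 * N → (node j).Good n m p δ₀ (act j) →
      (-ν ≤ val j ∧ val j ≤ 1) ∧
      |ψ ((node j).ratio c n m (act j)) - ψ (val j)| ^ q * N ≤ 6 ^ q * (j + 1) := by
    intro j h1 h2 hG
    rw [hT.leaf j h1 h2]
    refine ⟨⟨by linarith, le_rfl⟩, ?_⟩
    obtain ⟨r0, r1⟩ := hG.ratio_mem hP.hc hδ1
    have : |ψ ((node j).ratio c n m (act j)) - ψ 1| ≤ 6 := by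
      refine (abs_sub _ _).trans ?_
      linarith [hψ.abs_le _ (by linarith) r1, hψ.abs_le 1 (by linarith) le_rfl]
    have h3 : (N : ℝ) ≤ j + 1 := by exact_mod_cast (by omega : N ≤ j + 1)
    gcongr
  suffices h : ∀ k j, N ≤ j + k → j ≤ 3 * N → (node j).Good n m p δ₀ (act j) →
      (-ν ≤ val j ∧ val j ≤ 1) ∧
      |ψ ((node j).ratio c n m (act j)) - ψ (val j)| ^ q * N ≤ 6 ^ q * (j + 1) from
    fun j => h N j (by omega)
  intro k
  induction k with
  | zero => intro j hj; exact leaf j (by omega)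
  | succ k ih =>
    intro j hj hj3 hG
    by_cases hjN : N ≤ j
    · exact leaf j hjN hj3 hG
    have hjN : j < N := by omega
    rcases Nat.eq_zero_or_eq_succ_pred (sel j) with h0 | h0
    · rw [hT.val_none j hjN h0, hG.ratio_isolated hP.hc hδ1 ((hT.step j hjN).none h0)]
      refine ⟨⟨by linarith, le_rfl⟩, ?_⟩
      rcases Nat.eq_zero_or_pos q with rfl | hq0
      · norm_num at hq
      · rw [sub_self, abs_zero, zero_pow hq0.ne', zero_mul]; positivity
    · have hs0 : sel j ≠ 0 := by omega
      obtain ⟨hF, hδ, g₁, X₂, X₃, x2, x2', x3, x3', hor, hZ⟩ := (hT.step j hjN).step hP hG h0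
      obtain ⟨r0, r1⟩ := g₁.ratio_mem hP.hc hδ1
      obtain ⟨⟨v0, v1⟩, verr⟩ := ih (3 * j + 1) (by omega) (by omega) g₁
      have hrat : (node j).ratio c n m (act j) =
          edgeFactor c (F j) (δ j) ((node (3 * j + 1)).ratio c n m (act (3 * j + 1))) X₂ X₃ (1, 0) /
          edgeFactor c (F j) (δ j) ((node (3 * j + 1)).ratio c n m (act (3 * j + 1))) X₂ X₃
            (1, 1) := by
        have hpos := hG.Z_pos hP.hc hδ1 (a := (1, 1)) one_pos one_pos
        rw [hZ] at hpos
        rw [Net.ratio, hZ, hZ, mul_div_mul_left]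
        exact left_ne_zero_of_mul hpos.ne'
      -- the values at the second and third child may be replaced by admissible ones
      obtain ⟨Y₂, Y₃, y2, y2', y3, y3', e2, e3, hval⟩ : ∃ Y₂ Y₃, -ν ≤ Y₂ ∧ Y₂ ≤ 1 ∧ -ν ≤ Y₃ ∧ Y₃ ≤ 1 ∧
          |ψ X₂ - ψ Y₂| ^ q * N ≤ 6 ^ q * (3 * j + 4) ∧
          |ψ X₃ - ψ Y₃| ^ q * N ≤ 6 ^ q * (3 * j + 4) ∧
          val j = edgeFactor c (F j) (δ j) (val (3 * j + 1)) Y₂ Y₃ (1, 0) /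
            edgeFactor c (F j) (δ j) (val (3 * j + 1)) Y₂ Y₃ (1, 1) := by
        rcases hor with h | ⟨rfl, rfl, g₂, g₃⟩
        · have hz : ∀ x : ℝ, |ψ x - ψ x| ^ q * N ≤ 6 ^ q * (3 * j + 4) := by
            intro x
            rcases Nat.eq_zero_or_pos q with rfl | hq0
            · norm_num at hq
            · rw [sub_self, abs_zero, zero_pow hq0.ne', zero_mul]; positivity
          refine ⟨X₂, X₃, by linarith, x2', by linarith, x3', hz _, hz _, ?_⟩
          rw [hT.val_some j hjN hs0, h, edgeFactor_zero, edgeFactor_zero _ _ X₂,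
            edgeFactor_zero _ _ _ _ (1, 1), edgeFactor_zero _ _ X₂ _ (1, 1)]
        · obtain ⟨⟨a0, a1⟩, aerr⟩ := ih (3 * j + 2) (by omega) (by omega) g₂
          obtain ⟨⟨b0, b1⟩, berr⟩ := ih (3 * j + 3) (by omega) (by omega) g₃
          refine ⟨_, _, a0, a1, b0, b1, aerr.trans ?_, berr.trans ?_, hT.val_some j hjN hs0⟩
          · push_cast; gcongr 6 ^ q * ?_; linarith
          · push_cast; gcongr 6 ^ q * ?_; linarith
      have e1 : |ψ ((node (3 * j + 1)).ratio c n m (act (3 * j + 1))) - ψ (val (3 * j + 1))| ^ q * N ≤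
          6 ^ q * (3 * j + 4) := by
        refine verr.trans ?_
        push_cast; gcongr 6 ^ q * ?_; linarith
      obtain ⟨e, he0, h1, h2, h3, he⟩ := exists_common_bound e1 e2 e3
      rw [hval, hrat]
      refine ⟨hψ.mem _ hF _ hδ _ _ _ v0 v1 y2 y2' y3 y3', ?_⟩
      have := hψ.contract _ hF _ hδ _ _ _ (by linarith) r1 (by linarith) x2' (by linarith) x3'
        _ _ _ v0 v1 y2 y2' y3 y3' e h1 h2 h3
      calc _ ≤ (θ * e) ^ q * N := by gcongr
        _ = θ ^ q * (e ^ q * N) := by ring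
        _ ≤ θ ^ q * (6 ^ q * (3 * j + 4)) := by gcongr
        _ ≤ θ ^ q * (6 ^ q * (4 * (j + 1))) := by
          have : (3 * (j : ℝ) + 4) ≤ 4 * (j + 1) := by
            have : (0 : ℝ) ≤ j := Nat.cast_nonneg _
            linarith
          gcongr
        _ = (4 * θ ^ q) * (6 ^ q * (j + 1)) := by ring
        _ ≤ 1 * (6 ^ q * (j + 1)) := by gcongr
        _ = _ := one_mul _

/-- The factor by which the partition function changes when an edge at the root is contracted. -/
theorem TreeSpec.root (hP : Params c p δ₀) (hψ : Contracts c p δ₀ ν θ K ψ) (hθ : 0 < θ)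
    {q : ℕ} (hq : 4 * θ ^ q ≤ 1) (hT : TreeSpec c n m N node act sel F δ val)
    (hN : 0 < N) (hG : (node 0).Good n m p δ₀ (act 0)) (hs : sel 0 ≠ 0) {a : ℝ × ℝ} (ha : Adm p a)
    {ε : ℝ} (hε : 0 ≤ ε) (hNε : 6 ^ q * 4 ≤ ε ^ q * N) :
    ∃ x, 0 < x ∧ (node 0).Z c n m (act 0) a =
        (node 1).Z c n m (act 1) (conv c (1, 1) (F 0)) * x ∧
      |edgeFactor c (F 0) (δ 0) (val 1) (val 2) (val 3) a - x| ≤ K * ε * x ∧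
      (node 1).Good n m p δ₀ (act 1) ∧ Adm p (F 0) := by
  have hδ1 : δ₀ < 1 := by linarith [hP.hδ]
  have hν := hψ.ν_pos
  have herr := hT.error hP hψ hθ hq
  obtain ⟨hF, hδ, g₁, X₂, X₃, x2, x2', x3, x3', hor, hZ⟩ :=
    (hT.step 0 hN).step hP hG (Nat.succ_pred_eq_of_ne_zero hs).symm
  simp only [Nat.mul_zero, Nat.zero_add] at g₁ hor hZ
  obtain ⟨r0, r1⟩ := g₁.ratio_mem hP.hc hδ1
  -- The children of the root have index at most 3, so the error bound of the tree reads 6^q · 4 ≤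
  -- ε^q N there.
  have hsmall : ∀ (j : ℕ) (x : ℝ), j ≤ 3 → |x| ^ q * (N : ℝ) ≤ 6 ^ q * ((j : ℝ) + 1) → |x| ≤ ε := by
    intro j x hj hx
    by_contra hlt
    push Not at hlt
    have hq0 : q ≠ 0 := by rintro rfl; norm_num at hq
    have h1 : ε ^ q * N < |x| ^ q * N := by
      have := pow_lt_pow_left₀ hlt hε hq0
      gcongr
    have h2 : (6 : ℝ) ^ q * (j + 1) ≤ 6 ^ q * 4 := by
      have : (j : ℝ) ≤ 3 := by exact_mod_cast hj
      gcongr; linarith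
    linarith
  obtain ⟨⟨v0, v1⟩, verr⟩ := herr 1 (by omega) g₁
  have e1 := hsmall 1 _ (by omega) verr
  obtain ⟨Y₂, Y₃, y2, y2', y3, y3', e2, e3, hval⟩ : ∃ Y₂ Y₃, -ν ≤ Y₂ ∧ Y₂ ≤ 1 ∧ -ν ≤ Y₃ ∧ Y₃ ≤ 1 ∧
      |ψ X₂ - ψ Y₂| ≤ ε ∧ |ψ X₃ - ψ Y₃| ≤ ε ∧
      edgeFactor c (F 0) (δ 0) (val 1) (val 2) (val 3) a =
        edgeFactor c (F 0) (δ 0) (val 1) Y₂ Y₃ a := by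
    rcases hor with h | ⟨rfl, rfl, g₂, g₃⟩
    · refine ⟨X₂, X₃, by linarith, x2', by linarith, x3', by simpa using hε, by simpa using hε, ?_⟩
      rw [h, edgeFactor_zero, edgeFactor_zero _ _ X₂]
    · obtain ⟨⟨a0, a1⟩, aerr⟩ := herr 2 (by omega) g₂
      obtain ⟨⟨b0, b1⟩, berr⟩ := herr 3 (by omega) g₃
      exact ⟨_, _, a0, a1, b0, b1, hsmall 2 _ (by omega) aerr, hsmall 3 _ (by omega) berr, rfl⟩
  -- With the exact ratios the value at (1, 0) is a nonnegative Z divided by a positive one; this is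
  -- the sign condition of `Contracts.approx`.
  have hnn : 0 ≤ edgeFactor c (F 0) (δ 0) ((node 1).ratio c n m (act 1)) X₂ X₃ (1, 0) := by
    have h1 := hG.Z_nonneg hP.hc hδ1 (a := (1, 0)) zero_le_one le_rfl
    rw [hZ] at h1
    refine nonneg_of_mul_nonneg_right h1 (g₁.Z_pos hP.hc hδ1 ?_ ?_)
    · have := hF.fst_nonneg
      have := hF.snd_pos
      simp only [conv]; linarith
    · have := hF.fst_nonneg
      have := hF.snd_pos
      have := mul_pos hP.hc hF.snd_pos
      simp only [conv]; linarith
  have := hψ.approx _ hF _ hδ _ _ _ (by linarith) r1 (by linarith) x2' (by linarith) x3'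
        _ _ _ v0 v1 y2 y2' y3 y3' ε e1 e2 e3 a ha hnn
  exact ⟨_, this.1, hZ a, by rw [hval]; exact this.2, g₁, hF⟩

end FibonacciHolant


namespace FibonacciHolant

variable {c p δ₀ ν θ K : ℝ} {n m : ℕ} {ψ : ℝ → ℝ}

/-! ### Contracting the edges one after the other -/

/-- The partition function of a network. -/
def Net.total (G : Net) (c : ℝ) (n m : ℕ) : ℝ := netZ c n G.fst G.snd G.wt m G.gate

/-- The ends of all edges are vertices, and exactly the edges below `k` are present. -/
structure Net.Shape (G : Net) (n m : ℕ) (δ₀ : ℝ) (k : ℕ) : Prop where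
  fst_lt : ∀ e < m, G.fst e < n
  snd_lt : ∀ e < m, G.snd e < n
  live : ∀ e < k, |G.wt e - 1| ≤ δ₀
  dead : ∀ e < m, k ≤ e → G.wt e = 0

/-- All sequences are admissible, and isolated vertices have a positive first term. -/
def Net.AllAdm (G : Net) (n m : ℕ) (p : ℝ) : Prop :=
  ∀ v < n, Adm p (G.gate v) ∧ (0 < (G.gate v).1 ∨ ∃ e < m, G.Meets e v)

/-- The base vertex `w` gets the sequence `a`. -/
def Net.setGate (G : Net) (w : ℕ) (a : ℝ × ℝ) : Net :=
  { G with gate := Function.update G.gate w a }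

variable {G G' : Net} {k w : ℕ}

theorem Net.Agree.total_eq (h : Net.Agree n m G G') : G.total c n m = G'.total c n m :=
  netZ_congr h.fst h.snd h.wt h.gate

theorem Net.Agree.shape (h : Net.Agree n m G G') (hk : k ≤ m) (hG : G'.Shape n m δ₀ k) :
    G.Shape n m δ₀ k where
  fst_lt e he := h.fst e he ▸ hG.fst_lt e he
  snd_lt e he := h.snd e he ▸ hG.snd_lt e he
  live e he := h.wt e (by omega) ▸ hG.live e he
  dead e he hke := h.wt e he ▸ hG.dead e he hke

theorem Net.Agree.allAdm (h : Net.Agree n m G G') (hG : G'.AllAdm n m p) : G.AllAdm n m p := by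
  intro v hv
  rw [h.gate v hv]
  refine ⟨(hG v hv).1, (hG v hv).2.imp_right ?_⟩
  rintro ⟨e, he, h1, h2⟩
  exact ⟨e, he, by rw [Net.Meets, h.fst e he, h.snd e he, h.wt e he]; exact ⟨h1, h2⟩⟩

theorem Net.Shape.good (hS : G.Shape n m δ₀ k) (hA : G.AllAdm n m p) (hw : w < n) :
    G.Good n m p δ₀ w where
  lt := hw
  fst_lt := hS.fst_lt
  snd_lt := hS.snd_lt
  wt e he := by
    by_cases h : e < k
    · exact Or.inr (hS.live e h)
    · exact Or.inl (hS.dead e he (by omega))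
  gate v hv _ := ⟨(hA v hv).1.fst_nonneg, (hA v hv).1.le_snd, (hA v hv).1.snd_pos⟩
  meets v hv _ := (hA v hv).2

theorem Net.Good.allAdm_setGate (hG : G.Good n m p δ₀ w) {a : ℝ × ℝ} (ha : Adm p a)
    (ha1 : 0 < a.1) : (G.setGate w a).AllAdm n m p := by
  intro v hv
  by_cases h : v = w
  · subst h; simp [Net.setGate, ha, ha1]
  · simp only [Net.setGate, Function.update_of_ne h]
    obtain ⟨h1, h2, h3⟩ := hG.gate v hv h
    exact ⟨⟨h1, h2, h3⟩, hG.meets v hv h⟩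

theorem Net.total_eq_Z (G : Net) (w : ℕ) : G.total c n m = G.Z c n m w (G.gate w) := by
  rw [Net.Z, Function.update_eq_self]; rfl

theorem Net.Z_eq_total (G : Net) (w : ℕ) (a : ℝ × ℝ) :
    G.Z c n m w a = (G.setGate w a).total c n m := rfl

theorem Net.Shape.total_eq_prod (hS : G.Shape n m δ₀ 0) :
    G.total c n m = ∏ v ∈ Finset.range n, (G.gate v).1 := by
  have hd : ∀ e < m, G.wt e = 0 := fun e he => hS.dead e he (Nat.zero_le _)
  clear hS
  unfold Net.total
  generalize G.gate = g
  induction m generalizing g with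
  | zero => rfl
  | succ m ih => rw [netZ, ih (fun e he => hd e (by omega)), hd m (by omega)]; simp

/-- The product is (F.1 + F.2, F.1 + F.2 + c F.2). Its first term is positive, so placing it at w
keeps the next network admissible even if w has become isolated. -/
theorem adm_conv_one_one (hP : Params c p δ₀) {F : ℝ × ℝ} (hF : Adm p F) :
    Adm p (conv c (1, 1) F) ∧ 0 < (conv c (1, 1) F).1 := by
  obtain ⟨h0, h1, h2⟩ := hF
  have hc := hP.hc
  have h3 := mul_pos hc h2
  have h4 := mul_le_mul_of_nonneg_right (by linarith [hP.hpc, hP.hp] : p ≤ c) h2.le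
  have h5 := mul_le_mul_of_nonneg_right hP.hp1 h0
  have h6 := mul_le_mul_of_nonneg_right hP.hp1 h2.le
  refine ⟨⟨?_, ?_, ?_⟩, ?_⟩ <;> simp only [conv] <;> linarith

variable {sel : ℕ} {F : ℝ × ℝ} {δ : ℝ} {G₁ G₂ G₃ : Net} {w₁ w₂ w₃ : ℕ}

/-- All edges above k are dead and k meets its own first end. Because a node expands along the last
edge at its base, the root of the tree expands along k. -/
theorem Net.Shape.sel_eq (hδ : δ₀ < 1) (hS : G.Shape n m δ₀ (k + 1)) (hk : k < m)
    (h : NodeSpec c n m G (G.fst k) sel F δ G₁ G₂ G₃ w₁ w₂ w₃) : sel = k + 1 := by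
  have hlive : 0 < G.wt k := by linarith [(abs_le.1 (hS.live k (by omega))).1]
  rcases Nat.eq_zero_or_eq_succ_pred sel with h0 | h0
  · exact absurd ⟨hlive, Or.inl rfl⟩ (h.none h0 k hk)
  · obtain ⟨h1, h2, h3⟩ := h.some _ h0
    have h4 : ¬ sel.pred < k := fun hlt => h3 k hk hlt ⟨hlive, Or.inl rfl⟩
    have h5 : ¬ k < sel.pred := fun hlt => by
      have := h2.1
      rw [hS.dead _ h1 (by omega)] at this
      exact lt_irrefl _ this
    omega

theorem Net.Shape.next (hS : G.Shape n m δ₀ (k + 1)) (hk : k < m)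
    (h : NodeSpec c n m G (G.fst k) (k + 1) F δ G₁ G₂ G₃ w₁ w₂ w₃) (a : ℝ × ℝ) :
    (G₁.setGate (G.fst k) a).Shape n m δ₀ k := by
  obtain ⟨hA, -⟩ := h.child₁ k rfl
  refine ⟨fun e he => ?_, fun e he => ?_, fun e he => ?_, fun e he hke => ?_⟩
  · have := hA.fst e he
    have h1 := hS.fst_lt e he
    have h2 := hS.fst_lt k hk
    simp only [Net.contract] at this
    simp only [Net.setGate, this]; split_ifs <;> assumption
  · have := hA.snd e he
    have h1 := hS.snd_lt e he
    have h2 := hS.fst_lt k hk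
    simp only [Net.contract] at this
    simp only [Net.setGate, this]; split_ifs <;> assumption
  · simp only [Net.setGate]
    rw [hA.wt e (by omega)]
    simpa [Net.contract, show e ≠ k by omega] using hS.live e (by omega)
  · simp only [Net.setGate]
    rw [hA.wt e he]
    by_cases hek : e = k
    · subst hek; simp [Net.contract]
    · simpa [Net.contract, hek] using hS.dead e he (by omega)

/-- A vertex with the zero sequence leads to a vanishing product. -/
theorem NodeSpec.zero_gate (hS : G.Shape n m δ₀ (k + 1)) (hk : k < m)
    (h : NodeSpec c n m G (G.fst k) (k + 1) F δ G₁ G₂ G₃ w₁ w₂ w₃)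
    (h0 : ∃ v < n, G.gate v = 0) (X₁ X₂ X₃ : ℝ) :
    edgeFactor c F δ X₁ X₂ X₃ (G.gate (G.fst k)) = 0 ∨
    ∃ v < n, (G₁.setGate (G.fst k) (conv c (1, 1) F)).gate v = 0 := by
  obtain ⟨v, hv, hv0⟩ := h0
  have hw := hS.fst_lt k hk
  by_cases hvw : v = G.fst k
  · left
    rw [edgeFactor_linear, ← hvw, hv0]; simp
  · right
    by_cases hvu : v = G.other k (G.fst k)
    · refine ⟨G.fst k, hw, ?_⟩
      have hF := h.seq k rfl
      rw [← hvu, if_neg hvw, hv0] at hF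
      rw [hF]; simp [Net.setGate, conv]
    · refine ⟨v, hv, ?_⟩
      obtain ⟨hA, -⟩ := h.child₁ k rfl
      simp only [Net.setGate, Function.update_of_ne hvw, hA.gate v hv, Net.contract,
        Function.update_of_ne hvu, hv0]

/-- What is known after the edges from `k` on have been contracted: the network `G` and the factor
`acc` split off so far approximate the original value `Z₀`, with relative error `κ` per step. -/
structure Progress (c p δ₀ κ Z₀ : ℝ) (n m : ℕ) (G : Net) (acc : ℝ) (k : ℕ) : Prop where
  shape : G.Shape n m δ₀ k
  approx : Z₀ ≠ 0 → G.AllAdm n m p ∧ ∃ y, Z₀ = G.total c n m * y ∧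
    (1 - κ) ^ (m - k) * y ≤ acc ∧ acc ≤ (1 + κ) ^ (m - k) * y ∧ 0 ≤ y
  zero : Z₀ = 0 → acc = 0 ∨ ∃ v < n, G.gate v = 0

variable {N : ℕ} {node : ℕ → Net} {act sl : ℕ → ℕ} {Fs : ℕ → ℝ × ℝ} {δs val : ℕ → ℝ}

/-- Exactly, Z splits into the next network and a factor x; the accumulator receives an
approximation of x with relative error Kε. The next network carries `conv c (1, 1) F` at w: the
sequence that w had before enters only through the edge factor. -/
theorem Progress.step (hP : Params c p δ₀) (hψ : Contracts c p δ₀ ν θ K ψ) (hθ : 0 < θ)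
    (hK : 0 < K) {q : ℕ} (hq : 4 * θ ^ q ≤ 1) (hT : TreeSpec c n m N node act sl Fs δs val)
    (hN : 0 < N) {ε Z₀ acc : ℝ} (hε : 0 ≤ ε) (hNε : 6 ^ q * 4 ≤ ε ^ q * N) (hKε : K * ε ≤ 1)
    (hk : k < m) (hact : act 0 = (node 0).fst k)
    (h : Progress c p δ₀ (K * ε) Z₀ n m (node 0) acc (k + 1)) {G' : Net}
    (hG' : Net.Agree n m G' ((node 1).setGate (act 0) (conv c (1, 1) (Fs 0)))) :
    Progress c p δ₀ (K * ε) Z₀ n m G' (acc * edgeFactor c (Fs 0) (δs 0) (val 1) (val 2) (val 3)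
      ((node 0).gate (act 0))) k := by
  have hδ1 : δ₀ < 1 := by linarith [hP.hδ]
  have hspec := hT.step 0 hN
  simp only [Nat.mul_zero, Nat.zero_add] at hspec
  rw [hact] at hspec
  have hsel := h.shape.sel_eq hδ1 hk hspec
  rw [hsel] at hspec
  have hw : act 0 < n := hact ▸ h.shape.fst_lt k hk
  refine ⟨hG'.shape hk.le (hact ▸ h.shape.next hk hspec _), fun hZ => ?_, fun hZ => ?_⟩
  · obtain ⟨hA, y, hy, hlo, hhi, hy0⟩ := h.approx hZ
    obtain ⟨x, hx, hxZ, hxe, hg₁, hF⟩ := hT.root hP hψ hθ hq hN (h.shape.good hA hw)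
      (by omega) (hA _ hw).1 hε hNε
    have hact1 : act 1 = act 0 := by rw [(hspec.child₁ k rfl).2, hact]
    obtain ⟨c1, c2⟩ := adm_conv_one_one hP hF
    rw [hact1] at hg₁ hxZ
    refine ⟨hG'.allAdm (hg₁.allAdm_setGate c1 c2), x * y, ?_, ?_, ?_, by positivity⟩
    · rw [hy, hG'.total_eq, Net.total_eq_Z (node 0) (act 0), hxZ, Net.Z_eq_total]; ring
    all_goals
      set E := edgeFactor c (Fs 0) (δs 0) (val 1) (val 2) (val 3) ((node 0).gate (act 0))
      have h1 := abs_le.1 hxe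
      have hmk : m - k = (m - (k + 1)) + 1 := by omega
      have hκ : 0 ≤ K * ε := by positivity
      have hE : 0 ≤ E := by nlinarith
      rw [hmk, pow_succ]
    · calc _ = ((1 - K * ε) ^ (m - (k + 1)) * y) * ((1 - K * ε) * x) := by ring
        _ ≤ acc * E := by
          have : 0 ≤ 1 - K * ε := by linarith
          have h5 : 0 ≤ (1 - K * ε) ^ (m - (k + 1)) * y := by positivity
          exact mul_le_mul hlo (by linarith) (by positivity) (h5.trans hlo)
    · calc acc * E ≤ ((1 + K * ε) ^ (m - (k + 1)) * y) * ((1 + K * ε) * x) :=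
          mul_le_mul hhi (by linarith) hE (by positivity)
        _ = _ := by ring
  · rcases h.zero hZ with h0 | h0
    · left; rw [h0, zero_mul]
    · rcases hspec.zero_gate h.shape hk h0 (val 1) (val 2) (val 3) with h1 | ⟨v, hv, h1⟩
      · left; rw [hact, h1, mul_zero]
      · right; exact ⟨v, hv, by rw [hG'.gate v hv, hact, h1]⟩

theorem Progress.finish {κ Z₀ acc : ℝ} (h : Progress c p δ₀ κ Z₀ n m G acc 0) (hκ : 0 ≤ κ)
    {ε : ℝ} (hκε : 2 * (m * κ) < ε) (hκ1 : 2 * (m * κ) ≤ 1) (hZ₀ : 0 ≤ Z₀) :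
    (Z₀ ≠ 0 → (1 - ε) * Z₀ < acc * (∏ v ∈ Finset.range n, (G.gate v).1) ∧
      acc * (∏ v ∈ Finset.range n, (G.gate v).1) < (1 + ε) * Z₀) ∧
    (Z₀ = 0 → acc * (∏ v ∈ Finset.range n, (G.gate v).1) = 0) := by
  constructor
  · intro hZ
    obtain ⟨hA, y, hy, hlo, hhi, hy0⟩ := h.approx hZ
    have hpos : 0 < Z₀ := lt_of_le_of_ne hZ₀ (Ne.symm hZ)
    rw [h.shape.total_eq_prod] at hy
    set P := ∏ v ∈ Finset.range n, (G.gate v).1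
    have hP0 : 0 ≤ P := Finset.prod_nonneg fun v hv => (hA v (Finset.mem_range.1 hv)).1.fst_nonneg
    rw [Nat.sub_zero] at hlo hhi
    have hmκ : 0 ≤ m * κ := by positivity
    -- Without edges the hypotheses do not bound κ, but the accumulator is then exact.
    rcases Nat.eq_zero_or_pos m with rfl | hm
    · simp only [pow_zero, one_mul] at hlo hhi
      have : acc = y := le_antisymm hhi hlo
      subst this
      have : acc * P = Z₀ := by rw [hy]; ring
      rw [this]
      simp only [Nat.cast_zero, zero_mul, mul_zero] at hκε
      constructor <;> nlinarith
    have hm1 : (1 : ℝ) ≤ m := by exact_mod_cast hm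
    have hκhalf : κ ≤ 1 / 2 := by nlinarith
    have b1 : 1 - m * κ ≤ (1 - κ) ^ m := by
      have := one_add_mul_le_pow (a := -κ) (by linarith) m
      linarith [this, show (1 + -κ) ^ m = (1 - κ) ^ m by ring]
    -- From (1 - κ²)^m ≤ 1 and the Bernoulli bound for (1 - κ)^m.
    have b2 : (1 + κ) ^ m ≤ 1 + 2 * (m * κ) := by
      have h1 : (1 + κ) ^ m * (1 - κ) ^ m ≤ 1 := by
        rw [← mul_pow]
        exact pow_le_one₀ (by nlinarith) (by nlinarith)
      have h2 : 0 ≤ (1 + κ) ^ m := by positivity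
      have h3 : (1 + κ) ^ m * (1 - m * κ) ≤ 1 := (mul_le_mul_of_nonneg_left b1 h2).trans h1
      have h4 : 1 ≤ (1 + 2 * (m * κ)) * (1 - m * κ) := by nlinarith
      by_contra hlt
      push Not at hlt
      have h5 : 0 < 1 - m * κ := by linarith
      have := mul_lt_mul_of_pos_right hlt h5
      linarith
    have e1 := mul_le_mul_of_nonneg_right hlo hP0
    have e2 := mul_le_mul_of_nonneg_right hhi hP0
    have e3 := mul_le_mul_of_nonneg_right b1 hZ₀
    have e4 := mul_le_mul_of_nonneg_right b2 hZ₀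
    have e5 : (1 - κ) ^ m * y * P = (1 - κ) ^ m * Z₀ := by rw [hy]; ring
    have e6 : (1 + κ) ^ m * y * P = (1 + κ) ^ m * Z₀ := by rw [hy]; ring
    have e7 := mul_lt_mul_of_pos_right hκε hpos
    have e8 : 0 ≤ m * κ * Z₀ := by positivity
    constructor <;> linarith
  · intro hZ
    rcases h.zero hZ with h0 | ⟨v, hv, h0⟩
    · rw [h0, zero_mul]
    · rw [Finset.prod_eq_zero (Finset.mem_range.2 hv) (by simp [h0]), mul_zero]

end FibonacciHolant


namespace FibonacciHolant

/-! ### Programs with named arrays -/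

/-- Names of arrays of natural numbers. -/
inductive NArr where
  | inp | x | fst | snd | act | sel | deg | rn | rm | rs | pos | src | dst | j | o | e | u | w | cnt | i

/-- Names of arrays of real numbers. -/
inductive RArr where
  | inp | wt | g₀ | g₁ | f₀ | f₁ | dev | val | c | acc | mr | bnd | r

def NArr.code (a : NArr) : ℕ := a.ctorIdx
def RArr.code (a : RArr) : ℕ := a.ctorIdx

theorem NArr.code_inj {a b : NArr} (h : a.code = b.code) : a = b := by
  cases a <;> cases b <;> first | rfl | (simp [NArr.code, NArr.ctorIdx] at h)

theorem RArr.code_inj {a b : RArr} (h : a.code = b.code) : a = b := by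
  cases a <;> cases b <;> first | rfl | (simp [RArr.code, RArr.ctorIdx] at h)

theorem NArr.code_lt (a : NArr) : a.code < 20 := by cases a <;> decide

theorem RArr.code_lt (a : RArr) : a.code < 20 := by cases a <;> decide

inductive NExp where
  | lit (k : ℕ)
  | get (a : NArr) (i : NExp)
  | add (a b : NExp)
  | sub (a b : NExp)

inductive RExp where
  | lit (k : ℕ)
  | get (a : RArr) (i : NExp)
  | add (x y : RExp)
  | sub (x y : RExp)
  | mul (x y : RExp)
  | div (x y : RExp)

inductive HTest where
  | natLe (a b : NExp)
  | realLe (x y : RExp)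
  | neg (b : HTest)

inductive HProg where
  | skip
  | setN (a : NArr) (i v : NExp)
  | setR (a : RArr) (i : NExp) (v : RExp)
  | seq (P Q : HProg)
  | cond (b : HTest) (P Q : HProg)
  | loop (b : HTest) (P : HProg)

structure HState where
  N : NArr → ℕ → ℕ
  R : RArr → ℕ → ℝ

open Classical in
noncomputable def HState.setN (s : HState) (a : NArr) (i v : ℕ) : HState where
  N a' i' := if a' = a ∧ i' = i then v else s.N a' i'
  R := s.R

open Classical in
noncomputable def HState.setR (s : HState) (a : RArr) (i : ℕ) (v : ℝ) : HState where
  N := s.N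
  R a' i' := if a' = a ∧ i' = i then v else s.R a' i'

open Classical in
@[simp] theorem HState.setN_N (s : HState) (a a' : NArr) (i i' v : ℕ) :
    (s.setN a i v).N a' i' = if a' = a ∧ i' = i then v else s.N a' i' := rfl

@[simp] theorem HState.setN_R (s : HState) (a : NArr) (i v : ℕ) : (s.setN a i v).R = s.R := rfl

open Classical in
@[simp] theorem HState.setR_R (s : HState) (a a' : RArr) (i i' : ℕ) (v : ℝ) :
    (s.setR a i v).R a' i' = if a' = a ∧ i' = i then v else s.R a' i' := rfl

@[simp] theorem HState.setR_N (s : HState) (a : RArr) (i : ℕ) (v : ℝ) : (s.setR a i v).N = s.N := rfl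

@[simp] def NExp.eval (s : HState) : NExp → ℕ
  | lit k => k
  | get a i => s.N a (i.eval s)
  | add a b => a.eval s + b.eval s
  | sub a b => a.eval s - b.eval s

@[simp] noncomputable def RExp.eval (s : HState) : RExp → ℝ
  | lit k => k
  | get a i => s.R a (i.eval s)
  | add x y => x.eval s + y.eval s
  | sub x y => x.eval s - y.eval s
  | mul x y => x.eval s * y.eval s
  | div x y => x.eval s / y.eval s

@[simp] def HTest.Holds (s : HState) : HTest → Prop
  | natLe a b => a.eval s ≤ b.eval s
  | realLe x y => x.eval s ≤ y.eval s
  | neg b => ¬ b.Holds s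

inductive Exec : HProg → HState → ℕ → HState → Prop
  | skip (s : HState) : Exec .skip s 1 s
  | setN (s : HState) (a : NArr) (i v : NExp) :
      Exec (.setN a i v) s 1 (s.setN a (i.eval s) (v.eval s))
  | setR (s : HState) (a : RArr) (i : NExp) (v : RExp) :
      Exec (.setR a i v) s 1 (s.setR a (i.eval s) (v.eval s))
  | seq {P Q : HProg} {s₁ s₂ s₃ : HState} {t u : ℕ} :
      Exec P s₁ t s₂ → Exec Q s₂ u s₃ → Exec (.seq P Q) s₁ (t + u) s₃
  | condTrue {b : HTest} {P Q : HProg} {s₁ s₂ : HState} {t : ℕ} :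
      b.Holds s₁ → Exec P s₁ t s₂ → Exec (.cond b P Q) s₁ (t + 1) s₂
  | condFalse {b : HTest} {P Q : HProg} {s₁ s₂ : HState} {t : ℕ} :
      ¬ b.Holds s₁ → Exec Q s₁ t s₂ → Exec (.cond b P Q) s₁ (t + 1) s₂
  | loopStop {b : HTest} {P : HProg} {s : HState} : ¬ b.Holds s → Exec (.loop b P) s 1 s
  | loopStep {b : HTest} {P : HProg} {s₁ s₂ s₃ : HState} {t u : ℕ} :
      b.Holds s₁ → Exec P s₁ t s₂ → Exec (.loop b P) s₂ u s₃ → Exec (.loop b P) s₁ (t + u + 1) s₃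

/-! ### Compilation -/

/-- Natural numbers can only be added and subtracted on the machine, so multiples by fixed numbers
are repeated sums. -/
def timesExp : ℕ → NatExp → NatExp
  | 0, _ => .lit 0
  | k + 1, e => .add (timesExp k e) e

/-- The first address after the input, in terms of the cells `0` and `1`. -/
def baseExp : NatExp := .add (.read (.lit 0)) (.add (timesExp 4 (.read (.lit 1))) (.lit 2))

/-- The arrays are interleaved above the input with stride 20, which exceeds every code, so all of
them are unbounded and disjoint. -/
def addrExp (code : ℕ) (i : NatExp) : NatExp := .add baseExp (.add (timesExp 20 i) (.lit code))

def NExp.compile : NExp → NatExp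
  | lit k => .lit k
  | get a i => .read (addrExp a.code i.compile)
  | add a b => .add a.compile b.compile
  | sub a b => .sub a.compile b.compile

def RExp.compile : RExp → RealExp
  | lit k => .lit k
  | get a i => .read (addrExp a.code i.compile)
  | add x y => .add x.compile y.compile
  | sub x y => .sub x.compile y.compile
  | mul x y => .mul x.compile y.compile
  | div x y => .div x.compile y.compile

def HTest.compile : HTest → Test
  | natLe a b => .natLe a.compile b.compile
  | realLe x y => .realLe x.compile y.compile
  | neg b => .neg b.compile

def HProg.compile : HProg → Program
  | skip => .skip
  | setN a i v => .writeNat (addrExp a.code i.compile) v.compile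
  | setR a i v => .writeReal (addrExp a.code i.compile) v.compile
  | seq P Q => .seq P.compile Q.compile
  | cond b P Q => .cond b.compile P.compile Q.compile
  | loop b P => .loop b.compile P.compile

/-- The memory `M` holds the arrays of `s` above the input. -/
structure Rep (n m : ℕ) (M : Memory) (s : HState) : Prop where
  cell_zero : M.nats 0 = n
  cell_one : M.nats 1 = m
  nats : ∀ (a : NArr) (i : ℕ), M.nats (n + (4 * m + 2) + (20 * i + a.code)) = s.N a i
  reals : ∀ (a : RArr) (i : ℕ), M.reals (n + (4 * m + 2) + (20 * i + a.code)) = s.R a i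

variable {n m : ℕ} {M : Memory} {s : HState}

theorem eval_timesExp (k : ℕ) (e : NatExp) : (timesExp k e).eval M = k * e.eval M := by
  induction k with
  | zero => simp [timesExp, NatExp.eval]
  | succ k ih => simp only [timesExp, NatExp.eval, ih]; ring

theorem Rep.eval_base (h : Rep n m M s) : baseExp.eval M = n + (4 * m + 2) := by
  simp [baseExp, NatExp.eval, eval_timesExp, h.cell_zero, h.cell_one]

theorem Rep.eval_addr (h : Rep n m M s) (code : ℕ) (i : NatExp) :
    (addrExp code i).eval M = n + (4 * m + 2) + (20 * i.eval M + code) := by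
  simp [addrExp, NatExp.eval, eval_timesExp, h.eval_base]

theorem Rep.eval_nexp (h : Rep n m M s) (e : NExp) : e.compile.eval M = e.eval s := by
  induction e with
  | lit k => rfl
  | get a i ih => rw [NExp.compile, NatExp.eval, h.eval_addr, h.nats, ih]; rfl
  | add a b iha ihb => rw [NExp.compile, NatExp.eval, iha, ihb]; rfl
  | sub a b iha ihb => rw [NExp.compile, NatExp.eval, iha, ihb]; rfl

theorem Rep.eval_rexp (h : Rep n m M s) (e : RExp) : e.compile.eval M = e.eval s := by
  induction e with
  | lit k => rfl
  | get a i => rw [RExp.compile, RealExp.eval, h.eval_addr, h.reals, h.eval_nexp]; rfl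
  | add a b iha ihb => rw [RExp.compile, RealExp.eval, iha, ihb]; rfl
  | sub a b iha ihb => rw [RExp.compile, RealExp.eval, iha, ihb]; rfl
  | mul a b iha ihb => rw [RExp.compile, RealExp.eval, iha, ihb]; rfl
  | div a b iha ihb => rw [RExp.compile, RealExp.eval, iha, ihb]; rfl

theorem Rep.holds_iff (h : Rep n m M s) (b : HTest) : b.compile.Holds M ↔ b.Holds s := by
  induction b with
  | natLe a b => rw [HTest.compile, Test.Holds, h.eval_nexp, h.eval_nexp]; rfl
  | realLe a b => rw [HTest.compile, Test.Holds, h.eval_rexp, h.eval_rexp]; rfl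
  | neg b ih => rw [HTest.compile, Test.Holds, ih]; rfl

/-- The pair (i, code) is recovered from 20i + code as codes are below 20, and the cells 0 and 1,
from which addresses are computed, lie below the arrays. -/
theorem Rep.setN (h : Rep n m M s) (a : NArr) (i v : ℕ) :
    Rep n m { M with nats := Function.update M.nats (n + (4 * m + 2) + (20 * i + a.code)) v }
      (s.setN a i v) where
  cell_zero := (Function.update_of_ne (by omega) _ _).trans h.cell_zero
  cell_one := (Function.update_of_ne (by omega) _ _).trans h.cell_one
  nats a' i' := by
    rw [HState.setN_N]
    change Function.update _ _ _ _ = _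
    by_cases hh : a' = a ∧ i' = i
    · rw [if_pos hh, hh.1, hh.2, Function.update_self]
    · rw [if_neg hh, Function.update_of_ne, h.nats]
      intro heq
      have h1 := a.code_lt
      have h2 := a'.code_lt
      exact hh ⟨NArr.code_inj (by omega), by omega⟩
  reals := h.reals

theorem Rep.setR (h : Rep n m M s) (a : RArr) (i : ℕ) (v : ℝ) :
    Rep n m { M with reals := Function.update M.reals (n + (4 * m + 2) + (20 * i + a.code)) v }
      (s.setR a i v) where
  cell_zero := h.cell_zero
  cell_one := h.cell_one
  nats := h.nats
  reals a' i' := by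
    rw [HState.setR_R]
    change Function.update _ _ _ _ = _
    by_cases hh : a' = a ∧ i' = i
    · rw [if_pos hh, hh.1, hh.2, Function.update_self]
    · rw [if_neg hh, Function.update_of_ne, h.reals]
      intro heq
      have h1 := a.code_lt
      have h2 := a'.code_lt
      exact hh ⟨RArr.code_inj (by omega), by omega⟩

/-- Every statement becomes one machine statement whose address arithmetic sits inside the
expressions, so the number of steps is unchanged. -/
theorem Exec.runs {P : HProg} {t : ℕ} {s' : HState} (h : Exec P s t s') (hM : Rep n m M s) :
    ∃ M', Runs P.compile M t M' ∧ Rep n m M' s' := by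
  induction h generalizing M with
  | skip s => exact ⟨M, .skip M, hM⟩
  | setN s a i v =>
    refine ⟨_, .writeNat M _ _, ?_⟩
    rw [hM.eval_addr, hM.eval_nexp, hM.eval_nexp]
    exact hM.setN _ _ _
  | setR s a i v =>
    refine ⟨_, .writeReal M _ _, ?_⟩
    rw [hM.eval_addr, hM.eval_nexp, hM.eval_rexp]
    exact hM.setR _ _ _
  | seq _ _ ih₁ ih₂ =>
    obtain ⟨M₁, r₁, h₁⟩ := ih₁ hM
    obtain ⟨M₂, r₂, h₂⟩ := ih₂ h₁
    exact ⟨M₂, .seq r₁ r₂, h₂⟩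
  | condTrue hb _ ih =>
    obtain ⟨M₁, r₁, h₁⟩ := ih hM
    exact ⟨M₁, .condTrue ((hM.holds_iff _).2 hb) r₁, h₁⟩
  | condFalse hb _ ih =>
    obtain ⟨M₁, r₁, h₁⟩ := ih hM
    exact ⟨M₁, .condFalse (mt (hM.holds_iff _).1 hb) r₁, h₁⟩
  | loopStop hb => exact ⟨M, .loopStop (mt (hM.holds_iff _).1 hb), hM⟩
  | loopStep hb _ _ ih₁ ih₂ =>
    obtain ⟨M₁, r₁, h₁⟩ := ih₁ hM
    obtain ⟨M₂, r₂, h₂⟩ := ih₂ h₁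
    exact ⟨M₂, .loopStep ((hM.holds_iff _).2 hb) r₁ r₂, h₂⟩

/-! ### Total correctness with time bounds -/

/-- Started in `s`, the program `P` halts after at most `T` steps in a state that satisfies `Q`. -/
def HT (P : HProg) (s : HState) (T : ℕ) (Q : HState → Prop) : Prop :=
  ∃ t s', t ≤ T ∧ Exec P s t s' ∧ Q s'

variable {P P' : HProg} {T T' : ℕ} {Q Q' : HState → Prop} {b : HTest}

theorem HT.mono (h : HT P s T Q) (hT : T ≤ T') : HT P s T' Q := by
  obtain ⟨t, s', h1, h2, h3⟩ := h
  exact ⟨t, s', h1.trans hT, h2, h3⟩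

theorem HT.post (h : HT P s T Q) (hQ : ∀ s', Q s' → Q' s') : HT P s T Q' := by
  obtain ⟨t, s', h1, h2, h3⟩ := h
  exact ⟨t, s', h1, h2, hQ s' h3⟩

theorem HT.skip (h : Q s) : HT .skip s 1 Q := ⟨1, s, le_rfl, .skip s, h⟩

theorem HT.setN {a : NArr} {i v : NExp} (h : Q (s.setN a (i.eval s) (v.eval s))) :
    HT (.setN a i v) s 1 Q := ⟨1, _, le_rfl, .setN s a i v, h⟩

theorem HT.setR {a : RArr} {i : NExp} {v : RExp} (h : Q (s.setR a (i.eval s) (v.eval s))) :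
    HT (.setR a i v) s 1 Q := ⟨1, _, le_rfl, .setR s a i v, h⟩

theorem HT.seq (h : HT P s T fun s' => HT P' s' T' Q) : HT (.seq P P') s (T + T') Q := by
  obtain ⟨t, s', h1, h2, t', s'', h3, h4, h5⟩ := h
  exact ⟨t + t', s'', by omega, .seq h2 h4, h5⟩

theorem HT.cond (h₁ : b.Holds s → HT P s T Q) (h₂ : ¬ b.Holds s → HT P' s T Q) :
    HT (.cond b P P') s (T + 1) Q := by
  by_cases hb : b.Holds s
  · obtain ⟨t, s', h1, h2, h3⟩ := h₁ hb
    exact ⟨t + 1, s', by omega, .condTrue hb h2, h3⟩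
  · obtain ⟨t, s', h1, h2, h3⟩ := h₂ hb
    exact ⟨t + 1, s', by omega, .condFalse hb h2, h3⟩

/-- A loop that is left after exactly `k` rounds. -/
theorem HT.loop {Inv : ℕ → HState → Prop} {k : ℕ} (h0 : Inv 0 s)
    (htest : ∀ i ≤ k, ∀ s, Inv i s → (b.Holds s ↔ i < k))
    (hstep : ∀ i < k, ∀ s, Inv i s → HT P s T (Inv (i + 1))) :
    HT (.loop b P) s (k * (T + 1) + 1) (Inv k) := by
  suffices h : ∀ d i, i + d = k → ∀ s, Inv i s → HT (.loop b P) s (d * (T + 1) + 1) (Inv k) from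
    h k 0 (by omega) s h0
  intro d
  induction d with
  | zero =>
    intro i hi s hs
    obtain rfl : i = k := by omega
    exact ⟨1, s, by omega, .loopStop fun hb => lt_irrefl _ ((htest i le_rfl s hs).1 hb), hs⟩
  | succ d ih =>
    intro i hi s hs
    obtain ⟨t, s', h1, h2, h3⟩ := hstep i (by omega) s hs
    obtain ⟨t', s'', h1', h2', h3'⟩ := ih (i + 1) (by omega) s' h3
    refine ⟨t + t' + 1, s'', ?_, .loopStep ((htest i (by omega) s hs).2 (by omega)) h2 h2', h3'⟩
    rw [Nat.succ_mul]; omega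

infixr:30 " ;; " => HProg.seq

instance (k : ℕ) : OfNat NExp k := ⟨.lit k⟩
instance (k : ℕ) : OfNat RExp k := ⟨.lit k⟩
instance : Add NExp := ⟨.add⟩
instance : Sub NExp := ⟨.sub⟩
instance : Add RExp := ⟨.add⟩
instance : Sub RExp := ⟨.sub⟩
instance : Mul RExp := ⟨.mul⟩
instance : Div RExp := ⟨.div⟩

@[simp] theorem NExp.eval_ofNat (k : ℕ) : NExp.eval s (no_index (OfNat.ofNat k)) = k := rfl
@[simp] theorem NExp.eval_add (a b : NExp) : (a + b).eval s = a.eval s + b.eval s := rfl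
@[simp] theorem NExp.eval_sub (a b : NExp) : (a - b).eval s = a.eval s - b.eval s := rfl
@[simp] theorem RExp.eval_ofNat (k : ℕ) : RExp.eval s (no_index (OfNat.ofNat k)) = k := rfl
@[simp] theorem RExp.eval_add (a b : RExp) : (a + b).eval s = a.eval s + b.eval s := rfl
@[simp] theorem RExp.eval_sub (a b : RExp) : (a - b).eval s = a.eval s - b.eval s := rfl
@[simp] theorem RExp.eval_mul (a b : RExp) : (a * b).eval s = a.eval s * b.eval s := rfl
@[simp] theorem RExp.eval_div (a b : RExp) : (a / b).eval s = a.eval s / b.eval s := rfl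

/-- The value of the register `a`. -/
abbrev NArr.reg (a : NArr) : NExp := .get a 0
abbrev RArr.reg (a : RArr) : RExp := .get a 0

/-- The loop in which the register `a` runs from `0` to the value of `k`. -/
def forLoop (a : NArr) (k : NExp) (P : HProg) : HProg :=
  .setN a 0 0 ;; .loop (.natLe (a.reg + 1) k) (P ;; .setN a 0 (a.reg + 1))

/-- The body must give the counter back unchanged, and the next invariant is required after the
increment. Each round costs the body, the increment and one test. -/
theorem HT.forLoop {a : NArr} {K : NExp} {Inv : ℕ → HState → Prop} {k : ℕ}
    (h0 : Inv 0 (s.setN a 0 0)) (hK : ∀ i s, Inv i s → K.eval s = k)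
    (hstep : ∀ i < k, ∀ s, s.N a 0 = i → Inv i s →
      HT P s T fun s' => s'.N a 0 = i ∧ Inv (i + 1) (s'.setN a 0 (i + 1))) :
    HT (forLoop a K P) s (k * (T + 2) + 2) (Inv k) := by
  have := HT.loop (b := .natLe (a.reg + 1) K) (P := P ;; .setN a 0 (a.reg + 1)) (k := k)
    (Inv := fun i s => s.N a 0 = i ∧ Inv i s) (s := s.setN a 0 0) (T := T + 1)
    ⟨by simp, h0⟩ (fun i _ s hs => by simp [hs.1, hK i s hs.2])
    (fun i hi s hs => HT.seq ((hstep i hi s hs.1 hs.2).post fun s' hs' => HT.setN (by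
      simp only [NExp.eval, hs'.1]
      exact ⟨by simp, hs'.2⟩)))
  refine HT.mono (HT.seq (HT.setN ?_)) (T := 1 + (k * (T + 1 + 1) + 1)) (by ring_nf; omega)
  exact this.post fun s' h => h.2

theorem HT.setN_seq {a : NArr} {i v : NExp} (h : HT P (s.setN a (i.eval s) (v.eval s)) T Q) :
    HT (.setN a i v ;; P) s (1 + T) Q := .seq (.setN h)

theorem HT.setR_seq {a : RArr} {i : NExp} {v : RExp}
    (h : HT P (s.setR a (i.eval s) (v.eval s)) T Q) :
    HT (.setR a i v ;; P) s (1 + T) Q := .seq (.setR h)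

/-! ### Copying the input -/

/-- The cell of the register `x`. -/
def ctrExp : NatExp := addrExp NArr.x.code (.lit 0)

def copyInput : Program :=
  .loop (.natLe (.add (.read ctrExp) (.lit 1)) baseExp)
    (.seq (.writeNat (addrExp NArr.inp.code (.read ctrExp)) (.read (.read ctrExp)))
      (.seq (.writeReal (addrExp RArr.inp.code (.read ctrExp)) (.read (.read ctrExp)))
        (.writeNat ctrExp (.add (.read ctrExp) (.lit 1)))))

/-- The arrays after the first `k` cells have been copied. -/
noncomputable def copiedState (M₀ : Memory) (k : ℕ) : HState where
  N a i := match a with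
    | .inp => if i < k then M₀.nats i else 0
    | .x => if i = 0 then k else 0
    | _ => 0
  R a i := match a with
    | .inp => if i < k then M₀.reals i else 0
    | _ => 0

/-- The arrays start at the address n + 4m + 2, beyond the input, so no source cell is overwritten
before it is read. A round is three writes and a test. -/
theorem copyInput_runs {M₀ : Memory} (h0 : M₀.nats 0 = n) (h1 : M₀.nats 1 = m)
    (hN : ∀ i, n + (4 * m + 2) ≤ i → M₀.nats i = 0)
    (hR : ∀ i, n + (4 * m + 2) ≤ i → M₀.reals i = 0) :
    ∃ M', Runs copyInput M₀ ((n + (4 * m + 2)) * 4 + 1) M' ∧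
      Rep n m M' (copiedState M₀ (n + (4 * m + 2))) := by
  set B := n + (4 * m + 2) with hB
  suffices h : ∀ d k M, k + d = B → Rep n m M (copiedState M₀ k) →
      (∀ i < B, M.nats i = M₀.nats i) → (∀ i < B, M.reals i = M₀.reals i) →
      ∃ M', Runs copyInput M (d * 4 + 1) M' ∧ Rep n m M' (copiedState M₀ B) by
    refine h B 0 M₀ (by omega) ⟨h0, h1, fun a i => ?_, fun a i => ?_⟩ (fun _ _ => rfl)
      (fun _ _ => rfl)
    · rw [hN _ (by omega)]; cases a <;> simp [copiedState]
    · rw [hR _ (by omega)]; cases a <;> simp [copiedState]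
  have hctr : ∀ {k M}, Rep n m M (copiedState M₀ k) → (NatExp.read ctrExp).eval M = k := by
    intro k M hM
    rw [ctrExp, NatExp.eval, hM.eval_addr, NatExp.eval, hM.nats]; simp [copiedState]
  intro d
  induction d with
  | zero =>
    intro k M hk hM _ _
    obtain rfl : k = B := by omega
    refine ⟨M, .loopStop ?_, hM⟩
    rw [Test.Holds, NatExp.eval, hctr hM, hM.eval_base, NatExp.eval]; omega
  | succ d ih =>
    intro k M hk hM hMn hMr
    have a1 := hM.setN .inp k (M.nats k)
    have c1 : (NatExp.read ctrExp).eval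
        { M with nats := Function.update M.nats (B + (20 * k + NArr.inp.code)) (M.nats k) } = k := by
      rw [ctrExp, NatExp.eval, a1.eval_addr, NatExp.eval, a1.nats]; simp [copiedState]
    have a2 := a1.setR .inp k (M.reals k)
    have c2 : (NatExp.read ctrExp).eval
        { nats := Function.update M.nats (B + (20 * k + NArr.inp.code)) (M.nats k),
          reals := Function.update M.reals (B + (20 * k + RArr.inp.code)) (M.reals k) } = k := by
      rw [ctrExp, NatExp.eval, a2.eval_addr, NatExp.eval, a2.nats]; simp [copiedState]
    have a3 := a2.setN .x 0 (k + 1)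
    have hst : (((copiedState M₀ k).setN .inp k (M.nats k)).setR .inp k (M.reals k)).setN .x 0
        (k + 1) = copiedState M₀ (k + 1) := by
      have : ∀ {f g : HState}, f.N = g.N → f.R = g.R → f = g := by
        rintro ⟨_, _⟩ ⟨_, _⟩ h h'; simp only at h h'; rw [h, h']
      apply this
      · funext a i
        cases a <;> simp [copiedState]
        · by_cases hik : i = k
          · subst hik; simp [hMn i (by omega)]
          · simp [hik, show i ≤ k ↔ i < k by omega]
        · split_ifs <;> rfl
      · funext a i
        cases a <;> simp [copiedState]
        by_cases hik : i = k
        · subst hik; simp [hMr i (by omega)]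
        · simp [hik, show i ≤ k ↔ i < k by omega]
    rw [hst] at a3
    obtain ⟨M', r, hM'⟩ := ih (k + 1) _ (by omega) a3
      (fun i hi => by
        simp only
        rw [Function.update_of_ne (by omega), Function.update_of_ne (by omega), hMn i hi])
      (fun i hi => by
        simp only
        rw [Function.update_of_ne (by omega), hMr i hi])
    have r1 := Runs.writeNat M (addrExp NArr.inp.code (.read ctrExp)) (.read (.read ctrExp))
    rw [hM.eval_addr, show NatExp.eval M (.read (.read ctrExp)) =
      M.nats (NatExp.eval M (.read ctrExp)) from rfl, hctr hM] at r1
    have r2 := Runs.writeReal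
      { M with nats := Function.update M.nats (B + (20 * k + NArr.inp.code)) (M.nats k) }
      (addrExp RArr.inp.code (.read ctrExp)) (.read (.read ctrExp))
    rw [a1.eval_addr, RealExp.eval, c1] at r2
    have r3 := Runs.writeNat
      { nats := Function.update M.nats (B + (20 * k + NArr.inp.code)) (M.nats k),
        reals := Function.update M.reals (B + (20 * k + RArr.inp.code)) (M.reals k) }
      ctrExp (.add (.read ctrExp) (.lit 1))
    rw [NatExp.eval, c2] at r3
    rw [show ∀ M, NatExp.eval M ctrExp = NatExp.eval M (addrExp NArr.x.code (.lit 0)) from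
      fun _ => rfl, a2.eval_addr] at r3
    refine ⟨M', ?_, hM'⟩
    rw [show (d + 1) * 4 + 1 = (1 + (1 + 1)) + (d * 4 + 1) + 1 by ring]
    refine .loopStep ?_ (.seq r1 (.seq r2 r3)) r
    rw [Test.Holds, NatExp.eval, hctr hM, hM.eval_base, NatExp.eval]; omega

end FibonacciHolant


namespace FibonacciHolant

variable {n m : ℕ} {s : HState}

/-! ### Copying a network -/

/-- The network stored from the index `k` on. -/
noncomputable def slot (n m : ℕ) (s : HState) (k : ℕ) : Net where
  fst e := if e < m then s.N .fst (k + e) else 0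
  snd e := if e < m then s.N .snd (k + e) else 0
  wt e := if e < m then s.R .wt (k + e) else 0
  gate v := if v < n then (s.R .g₀ (k + v), s.R .g₁ (k + v)) else 0

def copySlot : HProg :=
  forLoop .x (NArr.reg .rs)
    (.setN .fst (NArr.reg .dst + NArr.reg .x) (.get .fst (NArr.reg .src + NArr.reg .x)) ;;
     .setN .snd (NArr.reg .dst + NArr.reg .x) (.get .snd (NArr.reg .src + NArr.reg .x)) ;;
     .setR .wt (NArr.reg .dst + NArr.reg .x) (.get .wt (NArr.reg .src + NArr.reg .x)) ;;
     .setR .g₀ (NArr.reg .dst + NArr.reg .x) (.get .g₀ (NArr.reg .src + NArr.reg .x)) ;;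
     .setR .g₁ (NArr.reg .dst + NArr.reg .x) (.get .g₁ (NArr.reg .src + NArr.reg .x)))

/-- The effect of copying `S` entries of the networks from the index `k` to the index `k'`. -/
structure Copied (s s' : HState) (k k' S : ℕ) : Prop where
  frameN : ∀ a, a ≠ .x → a ≠ .fst → a ≠ .snd → s'.N a = s.N a
  frameR : ∀ a, a ≠ .wt → a ≠ .g₀ → a ≠ .g₁ → s'.R a = s.R a
  fst : ∀ i, s'.N .fst i = if k' ≤ i ∧ i < k' + S then s.N .fst (k + (i - k')) else s.N .fst i
  snd : ∀ i, s'.N .snd i = if k' ≤ i ∧ i < k' + S then s.N .snd (k + (i - k')) else s.N .snd i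
  wt : ∀ i, s'.R .wt i = if k' ≤ i ∧ i < k' + S then s.R .wt (k + (i - k')) else s.R .wt i
  g₀ : ∀ i, s'.R .g₀ i = if k' ≤ i ∧ i < k' + S then s.R .g₀ (k + (i - k')) else s.R .g₀ i
  g₁ : ∀ i, s'.R .g₁ i = if k' ≤ i ∧ i < k' + S then s.R .g₁ (k + (i - k')) else s.R .g₁ i

/-- Since source and target are disjoint, the source entry k + i still has its original value. -/
theorem copy_step {α : Type*} {f f' : ℕ → α} {k k' i S : ℕ} (hi : i < S)
    (hd : k + S ≤ k' ∨ k' + S ≤ k)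
    (h : ∀ x, f' x = if k' ≤ x ∧ x < k' + i then f (k + (x - k')) else f x) (x : ℕ) :
    (if x = k' + i then f' (k + i) else f' x) =
      if k' ≤ x ∧ x < k' + (i + 1) then f (k + (x - k')) else f x := by
  by_cases hx : x = k' + i
  · subst hx
    rw [if_pos rfl, if_pos (by omega), h, if_neg (by omega)]
    congr 2; omega
  · rw [if_neg hx, h]
    refine if_congr (by omega) rfl rfl

theorem copySlot_spec {k k' S : ℕ} (hS : s.N .rs 0 = S) (hk : s.N .src 0 = k)
    (hk' : s.N .dst 0 = k') (hd : k + S ≤ k' ∨ k' + S ≤ k) :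
    HT copySlot s (S * 7 + 2) fun s' => Copied s s' k k' S := by
  refine HT.mono (HT.forLoop (k := S) (Inv := fun i s' => Copied s s' k k' i) ?_ ?_ ?_) (le_refl _)
  · constructor
    · intro a h1 h2 h3; funext i; simp [h1]
    · intro a h1 h2 h3; rfl
    all_goals intro i; simp
  · intro i s' h
    simp [h.frameN .rs, hS]
  · intro i hi s' hx h
    have e1 : s'.N .src 0 = k := by rw [h.frameN .src (by simp) (by simp) (by simp), hk]
    have e2 : s'.N .dst 0 = k' := by rw [h.frameN .dst (by simp) (by simp) (by simp), hk']
    refine HT.setN_seq (HT.setN_seq (HT.setR_seq (HT.setR_seq (HT.setR ?_))))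
    simp only [NExp.eval, RExp.eval, HState.setN_N, HState.setR_N,
      HState.setR_R, HState.setN_R, reduceCtorEq, false_and, if_false, true_and, hx, e1, e2]
    constructor
    · intro a h1 h2 h3; funext i; simp [h1, h2, h3, h.frameN a h1 h2 h3]
    · intro a h1 h2 h3; funext i; simp [h1, h2, h3, h.frameR a h1 h2 h3]
    all_goals intro y
    · simpa [h.fst (k + i), show ¬ (k' ≤ k + i ∧ k + i < k' + i) by omega] using copy_step hi hd h.fst y
    · simpa [h.snd (k + i), show ¬ (k' ≤ k + i ∧ k + i < k' + i) by omega] using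
        copy_step hi hd h.snd y
    · simpa [h.wt (k + i), show ¬ (k' ≤ k + i ∧ k + i < k' + i) by omega] using
        copy_step hi hd h.wt y
    · simpa [h.g₀ (k + i), show ¬ (k' ≤ k + i ∧ k + i < k' + i) by omega] using
        copy_step hi hd h.g₀ y
    · simpa [h.g₁ (k + i), show ¬ (k' ≤ k + i ∧ k + i < k' + i) by omega] using
        copy_step hi hd h.g₁ y

theorem Copied.slot_eq {s' : HState} {k k' : ℕ} (h : Copied s s' k k' (n + m)) :
    slot n m s' k' = slot n m s k := by
  simp only [slot, Net.mk.injEq]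
  refine ⟨?_, ?_, ?_, ?_⟩ <;> funext x <;> split_ifs with hx <;>
    first | rfl | simp [h.fst, h.snd, h.wt, h.g₀, h.g₁, show x < n + m by omega]

/-! ### A child of a node -/

/-- Below the index `k`, the stored networks are the same. -/
structure SameBelow (s s' : HState) (k : ℕ) : Prop where
  fst : ∀ i < k, s'.N .fst i = s.N .fst i
  snd : ∀ i < k, s'.N .snd i = s.N .snd i
  wt : ∀ i < k, s'.R .wt i = s.R .wt i
  g₀ : ∀ i < k, s'.R .g₀ i = s.R .g₀ i
  g₁ : ∀ i < k, s'.R .g₁ i = s.R .g₁ i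

theorem SameBelow.trans {s₁ s₂ s₃ : HState} {k : ℕ} (h : SameBelow s₁ s₂ k)
    (h' : SameBelow s₂ s₃ k) : SameBelow s₁ s₃ k where
  fst i hi := (h'.fst i hi).trans (h.fst i hi)
  snd i hi := (h'.snd i hi).trans (h.snd i hi)
  wt i hi := (h'.wt i hi).trans (h.wt i hi)
  g₀ i hi := (h'.g₀ i hi).trans (h.g₀ i hi)
  g₁ i hi := (h'.g₁ i hi).trans (h.g₁ i hi)

theorem SameBelow.mono {s' : HState} {k k' : ℕ} (h : SameBelow s s' k) (hk : k' ≤ k) :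
    SameBelow s s' k' where
  fst i hi := h.fst i (by omega)
  snd i hi := h.snd i (by omega)
  wt i hi := h.wt i (by omega)
  g₀ i hi := h.g₀ i (by omega)
  g₁ i hi := h.g₁ i (by omega)

theorem SameBelow.slot_eq {s' : HState} {k k' : ℕ} (h : SameBelow s s' k)
    (hk : k' + (n + m) ≤ k) : slot n m s' k' = slot n m s k' := by
  simp only [slot, Net.mk.injEq]
  refine ⟨?_, ?_, ?_, ?_⟩ <;> funext x <;> split_ifs with hx <;>
    first
      | rfl
      | simp only [h.fst (k' + x) (by omega), h.snd (k' + x) (by omega), h.wt (k' + x) (by omega),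
          h.g₀ (k' + x) (by omega), h.g₁ (k' + x) (by omega)]

/-- Appends a copy of the source network with the edge `e` deleted and the sequence `y` at `t`;
the base vertex is `a`. -/
def childProg (k : ℕ) (t : NExp) (y₀ y₁ : RExp) (a : NExp) : HProg :=
  .setN .dst 0 (NArr.reg .dst + NArr.reg .rs) ;;
  copySlot ;;
  .setR .wt (NArr.reg .dst + NArr.reg .e) 0 ;;
  .setR .g₀ (NArr.reg .dst + t) y₀ ;;
  .setR .g₁ (NArr.reg .dst + t) y₁ ;;
  .setN .act (NArr.reg .j + NArr.reg .j + NArr.reg .j + .lit k) a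

/-- The registers and arrays that remain unchanged while a child is made. -/
structure ChildFrame (s s' : HState) : Prop where
  N : ∀ a, a ≠ .x → a ≠ .fst → a ≠ .snd → a ≠ .dst → a ≠ .act → s'.N a = s.N a
  R : ∀ a, a ≠ .wt → a ≠ .g₀ → a ≠ .g₁ → s'.R a = s.R a

/-- The expressions are evaluated in intermediate states, hence they are required to have one value
throughout the `ChildFrame`. No bound on t' or a' is needed: every array cell of the network that is
written lies in the new slot or above it. -/
theorem childProg_spec {k o d e j : ℕ} {t a : NExp} {y₀ y₁ : RExp} {t' a' : ℕ} {y : ℝ × ℝ}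
    (hS : s.N .rs 0 = n + m) (ho : s.N .src 0 = o) (hd : s.N .dst 0 = d) (he : s.N .e 0 = e)
    (hj : s.N .j 0 = j) (hod : o ≤ d)
    (hy₀ : ∀ s', ChildFrame s s' → y₀.eval s' = y.1)
    (hy₁ : ∀ s', ChildFrame s s' → y₁.eval s' = y.2)
    (ht : ∀ s', ChildFrame s s' → t.eval s' = t')
    (ha : ∀ s', ChildFrame s s' → a.eval s' = a') :
    HT (childProg k t y₀ y₁ a) s ((n + m) * 7 + 7) fun s' => ChildFrame s s' ∧
      SameBelow s s' (d + (n + m)) ∧ s'.N .dst 0 = d + (n + m) ∧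
      (∀ i, s'.N .act i = if i = 3 * j + k then a' else s.N .act i) ∧
      Net.Agree n m (slot n m s' (d + (n + m))) ((slot n m s o).delete e t' y) := by
  refine HT.mono (HT.setN_seq (HT.seq ((copySlot_spec (k := o) (k' := d + (n + m)) (S := n + m)
    ?_ ?_ ?_ ?_).post fun s₁ h => ?_))) (T := 1 + ((n + m) * 7 + 2 + 4)) (by omega)
  · simp [hS]
  · simp [ho]
  · simp [hd, hS]
  · omega
  have hfr : ∀ s', (∀ a, a ≠ .act → s'.N a = s₁.N a) →
      (∀ a, a ≠ .wt → a ≠ .g₀ → a ≠ .g₁ → s'.R a = s₁.R a) → ChildFrame s s' := by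
    intro s' h1 h2
    constructor
    · intro a b1 b2 b3 b4 b5
      rw [h1 a b5, h.frameN a b1 b2 b3]; funext i; simp [b4]
    · intro a b1 b2 b3
      rw [h2 a b1 b2 b3, h.frameR a b1 b2 b3]; rfl
  have e1 : s₁.N .dst 0 = d + (n + m) := by simp [h.frameN .dst, hd, hS]
  have e2 : s₁.N .e 0 = e := by simp [h.frameN .e, he]
  have e3 : s₁.N .j 0 = j := by simp [h.frameN .j, hj]
  have hbase : slot n m s₁ (d + (n + m)) = slot n m s o := h.slot_eq.trans (by simp [slot])
  have f0 : ∀ i < d + (n + m), s₁.N .fst i = s.N .fst i ∧ s₁.N .snd i = s.N .snd i ∧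
      s₁.R .wt i = s.R .wt i ∧ s₁.R .g₀ i = s.R .g₀ i ∧ s₁.R .g₁ i = s.R .g₁ i := by
    intro i hi
    simp [h.fst, h.snd, h.wt, h.g₀, h.g₁, show ¬ d + (n + m) ≤ i by omega]
  have f1 : s₁.N .act = s.N .act := by rw [h.frameN .act]; funext i; simp; all_goals simp
  clear h
  refine HT.setR_seq (HT.setR_seq (HT.setR_seq (HT.setN ?_)))
  rw [show (NArr.reg .dst + NArr.reg .e).eval s₁ = d + (n + m) + e by simp [e1, e2]]
  rw [RExp.eval_ofNat]
  set s₂ := s₁.setR .wt (d + (n + m) + e) (0 : ℕ) with hs₂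
  have c2 : ChildFrame s s₂ := hfr _ (fun a _ => rfl) fun a h1 h2 h3 => by funext i; simp [hs₂, h1]
  rw [hy₀ _ c2, show (NArr.reg .dst + t).eval s₂ = d + (n + m) + t' by
    rw [NExp.eval_add, ht _ c2]; simp [hs₂, e1]]
  set s₃ := s₂.setR .g₀ (d + (n + m) + t') y.1 with hs₃
  have c3 : ChildFrame s s₃ := hfr _ (fun a _ => rfl) fun a h1 h2 h3 => by
    funext i; simp [hs₃, hs₂, h1, h2]
  rw [hy₁ _ c3, show (NArr.reg .dst + t).eval s₃ = d + (n + m) + t' by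
    rw [NExp.eval_add, ht _ c3]; simp [hs₃, hs₂, e1]]
  set s₄ := s₃.setR .g₁ (d + (n + m) + t') y.2 with hs₄
  have c4 : ChildFrame s s₄ := hfr _ (fun a _ => rfl) fun a h1 h2 h3 => by
    funext i; simp [hs₄, hs₃, hs₂, h1, h2, h3]
  rw [ha _ c4, show (NArr.reg .j + NArr.reg .j + NArr.reg .j + NExp.lit k).eval s₄ = 3 * j + k by
    simp [hs₄, hs₃, hs₂, e3]; ring]
  refine ⟨?_, ?_, ?_, ?_, ?_⟩
  · exact ⟨fun a h1 h2 h3 h4 h5 => by rw [← c4.N a h1 h2 h3 h4 h5]; funext i; simp [h5],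
      fun a h1 h2 h3 => by rw [← c4.R a h1 h2 h3]; rfl⟩
  · constructor <;> intro i hi <;> have := f0 i hi <;> 
      simp [hs₄, hs₃, hs₂, this] <;> omega
  · simp [hs₄, hs₃, hs₂, e1]
  · intro i; simp [hs₄, hs₃, hs₂, f1]
  · rw [← hbase]
    constructor <;> intro x hx
    · simp [slot, Net.delete, hx, hs₄, hs₃, hs₂]
    · simp [slot, Net.delete, hx, hs₄, hs₃, hs₂]
    · simp [slot, Net.delete, hx, hs₄, hs₃, hs₂, Function.update_apply]
    · simp only [slot, Net.delete, hx, hs₄, hs₃, hs₂, Function.update_apply]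
      by_cases hxt : x = t' <;> simp [hxt]

/-- The test for equality. -/
def eqTest (a b : NExp) : HTest := .natLe ((a - b) + (b - a)) 0

@[simp] theorem eqTest_holds {a b : NExp} : (eqTest a b).Holds s ↔ a.eval s = b.eval s := by
  simp [eqTest]; omega

/-- Renames the vertex `u` to `w` in the last network. -/
def renameProg : HProg :=
  forLoop .x (NArr.reg .rm)
    (.cond (eqTest (.get .fst (NArr.reg .dst + NArr.reg .x)) (NArr.reg .u))
      (.setN .fst (NArr.reg .dst + NArr.reg .x) (NArr.reg .w)) .skip ;;
     .cond (eqTest (.get .snd (NArr.reg .dst + NArr.reg .x)) (NArr.reg .u))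
      (.setN .snd (NArr.reg .dst + NArr.reg .x) (NArr.reg .w)) .skip)

structure Renamed (s s' : HState) (d m u w : ℕ) : Prop where
  frameN : ∀ a, a ≠ .x → a ≠ .fst → a ≠ .snd → s'.N a = s.N a
  frameR : s'.R = s.R
  fst : ∀ i, s'.N .fst i = if d ≤ i ∧ i < d + m ∧ s.N .fst i = u then w else s.N .fst i
  snd : ∀ i, s'.N .snd i = if d ≤ i ∧ i < d + m ∧ s.N .snd i = u then w else s.N .snd i

theorem rename_step {f f' : ℕ → ℕ} {d i u w : ℕ}
    (h : ∀ x, f' x = if d ≤ x ∧ x < d + i ∧ f x = u then w else f x) (x : ℕ) :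
    (if x = d + i then (if f' (d + i) = u then w else f' (d + i)) else f' x) =
      if d ≤ x ∧ x < d + (i + 1) ∧ f x = u then w else f x := by
  by_cases hx : x = d + i
  · subst hx
    have h0 : f' (d + i) = f (d + i) := by rw [h, if_neg (by omega)]
    rw [if_pos rfl, h0]
    exact if_congr (by omega) rfl rfl
  · rw [if_neg hx, h]
    exact if_congr (by omega) rfl rfl

theorem HT.setN_if {a : NArr} {b : HTest} {i v : NExp} {Q : HState → Prop}
    (h : ∀ s', (∀ a', a' ≠ a → s'.N a' = s.N a') → s'.R = s.R → (∀ y, s'.N a y =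
      if y = i.eval s then (open Classical in if b.Holds s then v.eval s else s.N a (i.eval s))
      else s.N a y) → Q s') :
    HT (.cond b (.setN a i v) .skip) s 2 Q := by
  refine HT.cond (fun hb => HT.setN (h _ ?_ rfl ?_)) (fun hb => HT.skip (h _ ?_ rfl ?_))
  · intro a' ha; funext y; simp [ha]
  · intro y; simp [hb]
  · intro a' ha; rfl
  · intro y; by_cases hy : y = i.eval s <;> simp [hb, hy]

theorem renameProg_spec {d u w : ℕ} (hm : s.N .rm 0 = m) (hd : s.N .dst 0 = d) (hu : s.N .u 0 = u)
    (hw : s.N .w 0 = w) :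
    HT renameProg s (m * 6 + 2) fun s' => Renamed s s' d m u w := by
  refine HT.mono (HT.forLoop (k := m) (Inv := fun i s' => Renamed s s' d i u w) ?_ ?_ ?_) (le_refl _)
  · constructor
    · intro a h1 h2 h3; funext i; simp [h1]
    · rfl
    all_goals intro i; rw [if_neg (by omega)]; simp
  · intro i s' h
    simp [h.frameN .rm, hm]
  · intro i hi s' hx h
    have e1 : s'.N .dst 0 = d := by simp [h.frameN .dst, hd]
    have e2 : s'.N .u 0 = u := by simp [h.frameN .u, hu]
    have e3 : s'.N .w 0 = w := by simp [h.frameN .w, hw]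
    refine HT.seq (HT.setN_if fun s₁ a1 b1 c1 => HT.setN_if fun s₂ a2 b2 c2 => ?_)
    simp only [NExp.eval, e1, e2, e3, hx, eqTest_holds] at c1
    have g1 : s₁.N .dst 0 = d := by rw [a1 _ (by simp), e1]
    have g2 : s₁.N .u 0 = u := by rw [a1 _ (by simp), e2]
    have g3 : s₁.N .w 0 = w := by rw [a1 _ (by simp), e3]
    have g4 : s₁.N .x 0 = i := by rw [a1 _ (by simp), hx]
    simp only [NExp.eval, g1, g2, g3, g4, eqTest_holds] at c2
    refine ⟨by rw [a2 _ (by simp), g4], ?_, ?_, ?_, ?_⟩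
    · intro a h1 h2 h3; rw [← h.frameN a h1 h2 h3, ← a1 a h2, ← a2 a h3]; funext y; simp [h1]
    · rw [← h.frameR, ← b1, ← b2]; rfl
    · intro y
      rw [← rename_step h.fst y, ← c1 y, ← a2 _ (by simp)]; simp
    · intro y
      rw [← rename_step h.snd y, HState.setN_N, if_neg (by simp), c2 y, a1 .snd (by simp)]

/-- Contraction is deletion of e with (1, 1) placed at u, followed by renaming u to w. -/
theorem Renamed.slot_agree {s' : HState} {d u w e : ℕ} {G : Net} (h : Renamed s s' d m u w)
    (hG : Net.Agree n m (slot n m s d) (G.delete e u (1, 1))) :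
    Net.Agree n m (slot n m s' d) (G.contract e w u) := by
  constructor <;> intro x hx
  · have := hG.fst x hx
    simp [slot, Net.delete, hx] at this
    simp [slot, Net.contract, hx, h.fst, this]
  · have := hG.snd x hx
    simp [slot, Net.delete, hx] at this
    simp [slot, Net.contract, hx, h.snd, this]
  · have := hG.wt x hx
    simp only [slot, Net.delete] at this
    simp only [slot, Net.contract, h.frameR, this]
  · have := hG.gate x hx
    simp only [slot, Net.delete] at this
    simp only [slot, Net.contract, h.frameR, this]

/-! ### The last edge at the base vertex -/

def scanProg : HProg :=
  .setN .e 0 0 ;;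
  forLoop .x (NArr.reg .rm)
    (.cond (.realLe (.get .wt (NArr.reg .o + NArr.reg .x)) 0) .skip
      (.cond (eqTest (.get .fst (NArr.reg .o + NArr.reg .x)) (NArr.reg .w))
        (.setN .e 0 (NArr.reg .x + 1))
        (.cond (eqTest (.get .snd (NArr.reg .o + NArr.reg .x)) (NArr.reg .w))
          (.setN .e 0 (NArr.reg .x + 1)) .skip)))

/-- `l` is `0` if no edge of `G` below `i` meets `w`, and `e + 1` if `e` is the last one. -/
def IsLast (G : Net) (w i l : ℕ) : Prop :=
  (l = 0 ∧ ∀ x < i, ¬ G.Meets x w) ∨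
  ∃ e, l = e + 1 ∧ e < i ∧ G.Meets e w ∧ ∀ x < i, e < x → ¬ G.Meets x w

theorem IsLast.succ {G : Net} {w i l : ℕ} (h : IsLast G w i l) (hi : ¬ G.Meets i w) :
    IsLast G w (i + 1) l := by
  rcases h with ⟨h1, h2⟩ | ⟨e, h1, h2, h3, h4⟩
  · refine Or.inl ⟨h1, fun x hx => ?_⟩
    rcases Nat.lt_succ_iff_lt_or_eq.1 hx with h | rfl
    exacts [h2 x h, hi]
  · refine Or.inr ⟨e, h1, by omega, h3, fun x hx hex => ?_⟩
    rcases Nat.lt_succ_iff_lt_or_eq.1 hx with h | rfl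
    exacts [h4 x h hex, hi]

theorem IsLast.here {G : Net} {w i : ℕ} (hi : G.Meets i w) : IsLast G w (i + 1) (i + 1) :=
  Or.inr ⟨i, rfl, by omega, hi, fun x h1 h2 => by omega⟩

theorem scanProg_spec {o w : ℕ} (hm : s.N .rm 0 = m) (ho : s.N .o 0 = o) (hw : s.N .w 0 = w) :
    HT scanProg s (m * 6 + 3) fun s' => (∀ a, a ≠ .x → a ≠ .e → s'.N a = s.N a) ∧ s'.R = s.R ∧
      IsLast (slot n m s o) w m (s'.N .e 0) := by
  refine HT.mono (HT.setN_seq (HT.forLoop (k := m) (T := 4) (Inv := fun i s' =>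
    (∀ a, a ≠ .x → a ≠ .e → s'.N a = s.N a) ∧ s'.R = s.R ∧
      IsLast (slot n m s o) w i (s'.N .e 0)) ?_ ?_ ?_)) (by omega)
  · refine ⟨fun a h1 h2 => ?_, rfl, Or.inl ⟨by simp, by simp⟩⟩
    funext i; simp [h1, h2]
  · intro i s' h
    simp [h.1 .rm, hm]
  · rintro i hi s' hx ⟨h1, h2, h3⟩
    have e1 : s'.N .o 0 = o := by simp [h1 .o, ho]
    have e2 : s'.N .w 0 = w := by simp [h1 .w, hw]
    have e3 : s'.N .fst = s.N .fst := by simp [h1 .fst]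
    have e4 : s'.N .snd = s.N .snd := by simp [h1 .snd]
    have hskip : ¬ (slot n m s o).Meets i w → s'.N .x 0 = i ∧
        (∀ a, a ≠ .x → a ≠ .e → (s'.setN .x 0 (i + 1)).N a = s.N a) ∧
        (s'.setN .x 0 (i + 1)).R = s.R ∧
        IsLast (slot n m s o) w (i + 1) ((s'.setN .x 0 (i + 1)).N .e 0) := by
      refine fun hM => ⟨hx, fun a h4 h5 => ?_, h2, by simpa using h3.succ hM⟩
      rw [← h1 a h4 h5]; funext y; simp [h4]
    have hset : (slot n m s o).Meets i w → (s'.setN .e 0 (i + 1)).N .x 0 = i ∧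
        (∀ a, a ≠ .x → a ≠ .e → ((s'.setN .e 0 (i + 1)).setN .x 0 (i + 1)).N a = s.N a) ∧
        ((s'.setN .e 0 (i + 1)).setN .x 0 (i + 1)).R = s.R ∧
        IsLast (slot n m s o) w (i + 1) (((s'.setN .e 0 (i + 1)).setN .x 0 (i + 1)).N .e 0) := by
      refine fun hM => ⟨by simp [hx], fun a h4 h5 => ?_, h2, by simpa using IsLast.here hM⟩
      rw [← h1 a h4 h5]; funext y; simp [h4, h5]
    have hM : (slot n m s o).Meets i w ↔
        0 < s.R .wt (o + i) ∧ (s.N .fst (o + i) = w ∨ s.N .snd (o + i) = w) := by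
      simp [Net.Meets, slot, hi]
    refine HT.cond (fun hb => HT.mono (HT.skip (hskip ?_)) (T := 1) (by omega)) (fun hb =>
      HT.cond (fun hb1 => HT.mono (HT.setN ?_) (T := 1) (by omega)) (fun hb1 =>
        HT.cond (fun hb2 => HT.setN ?_) (fun hb2 => HT.skip (hskip ?_))))
    all_goals
      simp only [HTest.Holds, RExp.eval, NExp.eval, eqTest_holds, e1, e2, e3, e4, hx, h2, Nat.cast_zero, not_le] at *
    · rw [hM]; exact fun h => absurd h.1 (not_lt.2 hb)
    · exact hset (hM.2 ⟨hb, Or.inl hb1⟩)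
    · exact hset (hM.2 ⟨hb, Or.inr hb2⟩)
    · rw [hM]; tauto

end FibonacciHolant


namespace FibonacciHolant

variable {n m : ℕ} {s : HState}

/-! ### Expansion of a node -/

/-- Since `childProg` first advances `dst` by a slot, starting from 3·o puts the children into the
slots 3j + 1, 3j + 2, 3j + 3. For u ≥ n the sequence is taken as 0, the convention of `slot`,
instead of reading a foreign cell. The entries f₀, f₁ keep the sequence of u until the second child
is made; only then does a loop overwrite them. -/
def branchProg : HProg :=
  .setN .e 0 (NArr.reg .e - 1) ;;
  .setN .u 0 (.get .fst (NArr.reg .o + NArr.reg .e) + .get .snd (NArr.reg .o + NArr.reg .e) -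
    NArr.reg .w) ;;
  .cond (.natLe (NArr.reg .u + 1) (NArr.reg .rn))
    (.setR .f₀ (NArr.reg .j) (.get .g₀ (NArr.reg .o + NArr.reg .u)) ;;
     .setR .f₁ (NArr.reg .j) (.get .g₁ (NArr.reg .o + NArr.reg .u)))
    (.setR .f₀ (NArr.reg .j) 0 ;; .setR .f₁ (NArr.reg .j) 0) ;;
  .setR .dev (NArr.reg .j) (.get .wt (NArr.reg .o + NArr.reg .e) - 1) ;;
  .setN .src 0 (NArr.reg .o) ;;
  .setN .dst 0 (NArr.reg .o + NArr.reg .o + NArr.reg .o) ;;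
  childProg 1 (NArr.reg .u) 1 1 (NArr.reg .w) ;;
  renameProg ;;
  childProg 2 (NArr.reg .u) (.get .f₁ (NArr.reg .j))
    (.get .f₀ (NArr.reg .j) + RArr.reg .c * .get .f₁ (NArr.reg .j)) (NArr.reg .w) ;;
  childProg 3 (NArr.reg .w) 1 1 (NArr.reg .u) ;;
  .cond (eqTest (NArr.reg .u) (NArr.reg .w))
    (.setR .f₀ (NArr.reg .j) (1 + .get .wt (NArr.reg .o + NArr.reg .e)) ;;
     .setR .f₁ (NArr.reg .j) (RArr.reg .c * .get .wt (NArr.reg .o + NArr.reg .e)) ;;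
     .setR .dev (NArr.reg .j) 0) .skip

/-- The registers and arrays that are unchanged when the node `j` is expanded. -/
structure NodeFrame (s s' : HState) (j k : ℕ) : Prop where
  N : ∀ a, a ∉ [NArr.x, .fst, .snd, .act, .sel, .src, .dst, .e, .u, .w] → s'.N a = s.N a
  R : ∀ a, a ∉ [RArr.wt, .g₀, .g₁, .f₀, .f₁, .dev] → s'.R a = s.R a
  below : SameBelow s s' k
  act : ∀ i ≤ 3 * j, s'.N .act i = s.N .act i
  sel : ∀ i ≠ j, s'.N .sel i = s.N .sel i
  f₀ : ∀ i ≠ j, s'.R .f₀ i = s.R .f₀ i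
  f₁ : ∀ i ≠ j, s'.R .f₁ i = s.R .f₁ i
  dev : ∀ i ≠ j, s'.R .dev i = s.R .dev i

theorem NodeFrame.trans {s₁ s₂ s₃ : HState} {j k : ℕ} (h : NodeFrame s₁ s₂ j k)
    (h' : NodeFrame s₂ s₃ j k) : NodeFrame s₁ s₃ j k where
  N a ha := (h'.N a ha).trans (h.N a ha)
  R a ha := (h'.R a ha).trans (h.R a ha)
  below := h.below.trans h'.below
  act i hi := (h'.act i hi).trans (h.act i hi)
  sel i hi := (h'.sel i hi).trans (h.sel i hi)
  f₀ i hi := (h'.f₀ i hi).trans (h.f₀ i hi)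
  f₁ i hi := (h'.f₁ i hi).trans (h.f₁ i hi)
  dev i hi := (h'.dev i hi).trans (h.dev i hi)

theorem SameBelow.of_eq {s' : HState} {k : ℕ} (h1 : s'.N .fst = s.N .fst) (h2 : s'.N .snd = s.N .snd)
    (h3 : s'.R .wt = s.R .wt) (h4 : s'.R .g₀ = s.R .g₀) (h5 : s'.R .g₁ = s.R .g₁) :
    SameBelow s s' k := by
  constructor <;> intro i _ <;> simp only [h1, h2, h3, h4, h5]

theorem ChildFrame.nodeFrame {s' : HState} {j k i₀ a₀ : ℕ} (h : ChildFrame s s')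
    (hb : SameBelow s s' k) (ha : ∀ i, s'.N .act i = if i = i₀ then a₀ else s.N .act i)
    (hi : 3 * j < i₀) : NodeFrame s s' j k where
  N a h1 := by
    simp only [List.mem_cons, not_or] at h1
    exact h.N a (by tauto) (by tauto) (by tauto) (by tauto) (by tauto)
  R a h1 := by
    simp only [List.mem_cons, not_or] at h1
    exact h.R a (by tauto) (by tauto) (by tauto)
  below := hb
  act i h1 := by rw [ha, if_neg (by omega)]
  sel i _ := by rw [h.N] <;> simp
  f₀ i _ := by rw [h.R] <;> simp
  f₁ i _ := by rw [h.R] <;> simp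
  dev i _ := by rw [h.R] <;> simp

/-- What the networks and registers look like when an edge at the base vertex has been found. -/
structure Branched (s s' : HState) (n m j e : ℕ) : Prop where
  frame : NodeFrame s s' j ((3 * j + 1) * (n + m))
  sel : s'.N .sel = s.N .sel
  seq : (s'.R .f₀ j, s'.R .f₁ j) = if (slot n m s (j * (n + m))).other e (s.N .w 0) = s.N .w 0
    then (1 + (slot n m s (j * (n + m))).wt e, s.R .c 0 * (slot n m s (j * (n + m))).wt e)
    else (slot n m s (j * (n + m))).gate ((slot n m s (j * (n + m))).other e (s.N .w 0))
  dev : s'.R .dev j = if (slot n m s (j * (n + m))).other e (s.N .w 0) = s.N .w 0 then 0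
    else (slot n m s (j * (n + m))).wt e - 1
  child₁ : Net.Agree n m (slot n m s' ((3 * j + 1) * (n + m)))
    ((slot n m s (j * (n + m))).contract e (s.N .w 0)
      ((slot n m s (j * (n + m))).other e (s.N .w 0)))
  child₂ : Net.Agree n m (slot n m s' ((3 * j + 2) * (n + m)))
    ((slot n m s (j * (n + m))).delete e ((slot n m s (j * (n + m))).other e (s.N .w 0))
      (shift (s.R .c 0) ((slot n m s (j * (n + m))).gate
        ((slot n m s (j * (n + m))).other e (s.N .w 0)))))
  child₃ : Net.Agree n m (slot n m s' ((3 * j + 3) * (n + m)))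
    ((slot n m s (j * (n + m))).delete e (s.N .w 0) (1, 1))
  act₁ : s'.N .act (3 * j + 1) = s.N .w 0
  act₂ : s'.N .act (3 * j + 2) = s.N .w 0
  act₃ : s'.N .act (3 * j + 3) = (slot n m s (j * (n + m))).other e (s.N .w 0)

theorem branchProg_spec {j e : ℕ} (hn : s.N .rn 0 = n) (hm : s.N .rm 0 = m)
    (hS : s.N .rs 0 = n + m) (hj : s.N .j 0 = j) (ho : s.N .o 0 = j * (n + m))
    (he : s.N .e 0 = e + 1) (hem : e < m) :
    HT branchProg s ((n + m) * 27 + 40) fun s' => Branched s s' n m j e := by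
  set G := slot n m s (j * (n + m)) with hG
  set u := G.other e (s.N .w 0) with hu
  have hufs : s.N .fst (j * (n + m) + e) + s.N .snd (j * (n + m) + e) - s.N .w 0 = u := by
    simp [hu, Net.other, hG, slot, hem]
  -- the sequence of the other end
  have key : ∀ s₁ : HState, (∀ a, a ≠ .e → a ≠ .u → s₁.N a = s.N a) → s₁.R = s.R →
      s₁.N .e 0 = e → s₁.N .u 0 = u → ∀ {T : ℕ} {P : HProg} {Q : HState → Prop},
      (∀ s₂ : HState, (∀ a, a ≠ .e → a ≠ .u → s₂.N a = s.N a) → s₂.N .e 0 = e → s₂.N .u 0 = u →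
        (∀ a, a ≠ .f₀ → a ≠ .f₁ → s₂.R a = s.R a) → (∀ i ≠ j, s₂.R .f₀ i = s.R .f₀ i) →
        (∀ i ≠ j, s₂.R .f₁ i = s.R .f₁ i) → (s₂.R .f₀ j, s₂.R .f₁ j) = G.gate u → HT P s₂ T Q) →
      HT (.cond (.natLe (NArr.reg .u + 1) (NArr.reg .rn))
        (.setR .f₀ (NArr.reg .j) (.get .g₀ (NArr.reg .o + NArr.reg .u)) ;;
         .setR .f₁ (NArr.reg .j) (.get .g₁ (NArr.reg .o + NArr.reg .u)))
        (.setR .f₀ (NArr.reg .j) 0 ;; .setR .f₁ (NArr.reg .j) 0) ;; P) s₁ (3 + T) Q := by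
    intro s₁ a1 a2 a3 a4 T P Q hQ
    have b1 : s₁.N .rn 0 = n := by simp [a1 .rn, hn]
    have b2 : s₁.N .j 0 = j := by simp [a1 .j, hj]
    have b3 : s₁.N .o 0 = j * (n + m) := by simp [a1 .o, ho]
    refine HT.seq (T := 3) (HT.cond (T := 2) (fun hb => HT.setR_seq (HT.setR ?_)) fun hb =>
      HT.setR_seq (HT.setR ?_))
    all_goals
      simp only [HTest.Holds, NExp.eval, RExp.eval, HState.setR_N, HState.setR_R, b1, b2, b3, a2, a4, reduceCtorEq, false_and, if_false] at hb ⊢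
      refine hQ _ a1 a3 a4 ?_ ?_ ?_ ?_
    · intro a h1 h2; funext i; simp [h1, h2, a2]
    · intro i h1; simp [h1, a2]
    · intro i h1; simp [h1, a2]
    · simp [hG, slot, show u < n by omega]
    · intro a h1 h2; funext i; simp [h1, h2, a2]
    · intro i h1; simp [h1, a2]
    · intro i h1; simp [h1, a2]
    · simp [hG, slot, show ¬ u < n by omega]
  refine HT.mono (HT.setN_seq (HT.setN_seq (key _ ?_ ?_ ?_ ?_ (T := (n + m) * 27 + 35)
    fun s₂ n2 e2 u2 r2 f2 f2' hF => ?_))) (by omega)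
  · intro a h1 h2; funext i; simp [h1, h2]
  · rfl
  · simp [he]
  · simp [he, ho, hufs]
  clear key
  have o2 : s₂.N .o 0 = j * (n + m) := by simp [n2 .o, ho]
  have j2 : s₂.N .j 0 = j := by simp [n2 .j, hj]
  have wt2 : s₂.R .wt = s.R .wt := by simp [r2 .wt]
  suffices H : ∀ s₃ : HState, (∀ a, a ≠ .e → a ≠ .u → a ≠ .src → a ≠ .dst → s₃.N a = s.N a) →
      (∀ a, a ≠ .f₀ → a ≠ .f₁ → a ≠ .dev → s₃.R a = s.R a) →
      s₃.N .e 0 = e → s₃.N .u 0 = u → s₃.N .src 0 = j * (n + m) → s₃.N .dst 0 = 3 * j * (n + m) →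
      (∀ i ≠ j, s₃.R .f₀ i = s.R .f₀ i) → (∀ i ≠ j, s₃.R .f₁ i = s.R .f₁ i) →
      (∀ i ≠ j, s₃.R .dev i = s.R .dev i) →
      (s₃.R .f₀ j, s₃.R .f₁ j) = G.gate u → s₃.R .dev j = G.wt e - 1 →
      HT (childProg 1 (NArr.reg .u) 1 1 (NArr.reg .w) ;;
  renameProg ;;
  childProg 2 (NArr.reg .u) (.get .f₁ (NArr.reg .j))
    (.get .f₀ (NArr.reg .j) + RArr.reg .c * .get .f₁ (NArr.reg .j)) (NArr.reg .w) ;;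
  childProg 3 (NArr.reg .w) 1 1 (NArr.reg .u) ;;
  .cond (eqTest (NArr.reg .u) (NArr.reg .w))
    (.setR .f₀ (NArr.reg .j) (1 + .get .wt (NArr.reg .o + NArr.reg .e)) ;;
     .setR .f₁ (NArr.reg .j) (RArr.reg .c * .get .wt (NArr.reg .o + NArr.reg .e)) ;;
     .setR .dev (NArr.reg .j) 0) .skip) s₃ ((n + m) * 27 + 32) fun s' => Branched s s' n m j e by
    refine HT.mono (HT.setR_seq (HT.setN_seq (HT.setN_seq (H _ ?_ ?_ ?_ ?_ ?_ ?_ ?_ ?_ ?_ ?_ ?_))))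
      (by omega)
    · intro a h1 h2 h3 h4; rw [← n2 a h1 h2]; funext i; simp [h3, h4]
    · intro a h1 h2 h3; rw [← r2 a h1 h2]; funext i; simp [h3]
    · simp [e2]
    · simp [u2]
    · simp [o2]
    · simp [o2]; ring
    · intro i hi; simp [f2 i hi]
    · intro i hi; simp [f2' i hi]
    · intro i hi; simp [r2, hi, j2]
    · simp [hF]
    · simp [j2, o2, e2, wt2, hG, slot, hem]
  clear hF f2 f2' r2 u2 e2 n2 o2 j2 wt2 s₂
  intro s₃ n3 r3 e3 u3 src3 dst3 f3 f3' dv3 hF hD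
  have w3 : s₃.N .w 0 = s.N .w 0 := by simp [n3 .w]
  have j3 : s₃.N .j 0 = j := by simp [n3 .j, hj]
  have slot3 : slot n m s₃ (j * (n + m)) = G := by
    simp [hG, slot, n3 .fst, n3 .snd, r3 .wt, r3 .g₀, r3 .g₁]
  have fr3 : NodeFrame s s₃ j ((3 * j + 1) * (n + m)) := by
    refine ⟨?_, ?_, .of_eq ?_ ?_ ?_ ?_ ?_, ?_, ?_, f3, f3', dv3⟩
    · intro a ha
      simp only [List.mem_cons, not_or] at ha
      exact n3 a (by tauto) (by tauto) (by tauto) (by tauto)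
    · intro a ha
      simp only [List.mem_cons, not_or] at ha
      exact r3 a (by tauto) (by tauto) (by tauto)
    · simp [n3]
    · simp [n3]
    · simp [r3]
    · simp [r3]
    · simp [r3]
    · simp [n3]
    · simp [n3]
  have sel3 : s₃.N .sel = s.N .sel := by simp [n3 .sel]
  have d1 : 3 * j * (n + m) + (n + m) = (3 * j + 1) * (n + m) := by ring
  have d2 : (3 * j + 1) * (n + m) + (n + m) = (3 * j + 2) * (n + m) := by ring
  have d3 : (3 * j + 2) * (n + m) + (n + m) = (3 * j + 3) * (n + m) := by ring
  have d0 : j * (n + m) ≤ 3 * j * (n + m) := Nat.mul_le_mul_right _ (by omega)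
  -- the first child
  refine HT.mono (HT.seq ((childProg_spec (n := n) (m := m) (o := j * (n + m))
    (d := 3 * j * (n + m)) (e := e) (j := j) (t' := u) (a' := s.N .w 0) (y := (1, 1))
    ?_ src3 dst3 e3 j3 d0 ?_ ?_ ?_ ?_).post ?_)) (T := (n + m) * 7 + 7 + ((n + m) * 20 + 25)) (by omega)
  · simp [n3 .rs, hS]
  · simp
  · simp
  · intro s' h; simp [h.N .u, u3]
  · intro s' h; simp [h.N .w, w3]
  rintro s₄ ⟨c4, b4, dst4, act4, ag4⟩
  rw [d1] at b4 dst4 ag4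
  rw [slot3] at ag4
  have fr4 := fr3.trans (c4.nodeFrame b4 act4 (by omega))
  refine HT.mono (HT.seq ((renameProg_spec (m := m) (d := (3 * j + 1) * (n + m)) (u := u)
    (w := s.N .w 0) ?_ dst4 ?_ ?_).post ?_)) (T := m * 6 + 2 + ((n + m) * 14 + 18)) (by omega)
  · simp [fr4.N .rm, hm]
  · simp [c4.N .u, u3]
  · simp [c4.N .w, w3]
  intro s₅ h5
  have ag5 := h5.slot_agree ag4
  have b5 : SameBelow s₄ s₅ ((3 * j + 1) * (n + m)) := by
    constructor <;> intro i hi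
    · rw [h5.fst, if_neg (by omega)]
    · rw [h5.snd, if_neg (by omega)]
    all_goals rw [h5.frameR]
  have act5 : s₅.N .act = s₄.N .act := by simp [h5.frameN .act]
  have fr5 : NodeFrame s₄ s₅ j ((3 * j + 1) * (n + m)) := by
    refine ⟨?_, ?_, b5, ?_, ?_, ?_, ?_, ?_⟩
    · intro a ha
      simp only [List.mem_cons, not_or] at ha
      exact h5.frameN a (by tauto) (by tauto) (by tauto)
    · simp [h5.frameR]
    · simp [act5]
    · simp [h5.frameN .sel]
    all_goals simp [h5.frameR]
  have cN : ∀ a, a ≠ .x → a ≠ .fst → a ≠ .snd → a ≠ .dst → a ≠ .act → s₅.N a = s₃.N a := by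
    intro a g1 g2 g3 g4 g5
    rw [h5.frameN a g1 g2 g3, c4.N a g1 g2 g3 g4 g5]
  have cR : ∀ a, a ≠ .wt → a ≠ .g₀ → a ≠ .g₁ → s₅.R a = s₃.R a := by
    intro a g1 g2 g3
    rw [h5.frameR, c4.R a g1 g2 g3]
  have dst5 : s₅.N .dst 0 = (3 * j + 1) * (n + m) := by rw [h5.frameN .dst, dst4] <;> simp
  have fr35 := (c4.nodeFrame b4 act4 (by omega)).trans fr5 (j := j)
  have c5 : s₅.R .c = s.R .c := by rw [cR .c, r3 .c] <;> simp
  have slot5 : slot n m s₅ (j * (n + m)) = G := by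
    rw [← slot3]; exact fr35.below.slot_eq (by rw [← d1]; omega)
  have F5 : s₅.R .f₀ j = (G.gate u).1 ∧ s₅.R .f₁ j = (G.gate u).2 := by
    rw [cR, cR, ← hF] <;> simp
  have rs5 : s₅.N .rs 0 = n + m := by simp [cN .rs, n3 .rs, hS]
  have src5 : s₅.N .src 0 = j * (n + m) := by simp [cN .src, src3]
  have e5 : s₅.N .e 0 = e := by simp [cN .e, e3]
  have j5 : s₅.N .j 0 = j := by simp [cN .j, j3]
  have u5 : s₅.N .u 0 = u := by simp [cN .u, u3]
  have w5 : s₅.N .w 0 = s.N .w 0 := by simp [cN .w, w3]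
  -- the second child
  refine HT.mono (HT.seq ((childProg_spec (n := n) (m := m) (o := j * (n + m))
    (d := (3 * j + 1) * (n + m)) (e := e) (j := j) (t' := u) (a' := s.N .w 0)
    (y := shift (s.R .c 0) (G.gate u)) rs5 src5 dst5 e5 j5 (by omega) ?_ ?_ ?_ ?_).post ?_))
    (T := (n + m) * 7 + 7 + ((n + m) * 7 + 11)) (by omega)
  · intro s' h; simp [h.N .j, j5, h.R .f₁, F5, shift]
  · intro s' h; simp [h.N .j, j5, h.R .f₁, h.R .f₀, h.R .c, F5, shift, c5]
  · intro s' h; simp [h.N .u, u5]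
  · intro s' h; simp [h.N .w, w5]
  rintro s₆ ⟨c6, b6, dst6, act6, ag6⟩
  rw [d2] at b6 dst6 ag6
  rw [slot5] at ag6
  have slot6 : slot n m s₆ (j * (n + m)) = G := by
    rw [← slot5]; exact b6.slot_eq (by rw [← d2, ← d1]; omega)
  -- the third child
  refine HT.mono (HT.seq ((childProg_spec (n := n) (m := m) (o := j * (n + m))
    (d := (3 * j + 2) * (n + m)) (e := e) (j := j) (t' := s.N .w 0) (a' := u)
    (y := (1, 1)) ?_ ?_ dst6 ?_ ?_ (by omega) ?_ ?_ ?_ ?_).post ?_))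
    (T := (n + m) * 7 + 7 + 4) (by omega)
  · simp [c6.N .rs, rs5]
  · simp [c6.N .src, src5]
  · simp [c6.N .e, e5]
  · simp [c6.N .j, j5]
  · simp
  · simp
  · intro s' h; simp [h.N .w, c6.N .w, w5]
  · intro s' h; simp [h.N .u, c6.N .u, u5]
  rintro s₇ ⟨c7, b7, dst7, act7, ag7⟩
  rw [d3] at b7 dst7 ag7
  rw [slot6] at ag7
  have fr7 : NodeFrame s s₇ j ((3 * j + 1) * (n + m)) :=
    (fr3.trans fr35).trans (((c6.nodeFrame b6 act6 (by omega)).trans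
      (c7.nodeFrame (b7.mono (by omega)) act7 (by omega))) |> fun h =>
        ⟨h.N, h.R, h.below.mono (by omega), h.act, h.sel, h.f₀, h.f₁, h.dev⟩)
  have F7 : s₇.R .f₀ j = (G.gate u).1 ∧ s₇.R .f₁ j = (G.gate u).2 := by
    rw [c7.R, c7.R, c6.R, c6.R] <;> simp [F5]
  have D7 : s₇.R .dev j = G.wt e - 1 := by rw [c7.R, c6.R, cR, hD] <;> simp
  have u7 : s₇.N .u 0 = u := by rw [c7.N, c6.N, u5] <;> simp
  have w7 : s₇.N .w 0 = s.N .w 0 := by rw [c7.N, c6.N, w5] <;> simp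
  have j7 : s₇.N .j 0 = j := by rw [c7.N, c6.N, j5] <;> simp
  have e7 : s₇.N .e 0 = e := by rw [c7.N, c6.N, e5] <;> simp
  have o7 : s₇.N .o 0 = j * (n + m) := by rw [c7.N, c6.N, cN, n3, ho] <;> simp
  have c7' : s₇.R .c = s.R .c := by rw [c7.R, c6.R, c5] <;> simp
  have wt7 : s₇.R .wt (j * (n + m) + e) = G.wt e := by
    rw [fr7.below.wt _ (by rw [← d1]; omega)]; simp [hG, slot, hem]
  have sel7 : s₇.N .sel = s.N .sel := by rw [c7.N, c6.N, cN, sel3] <;> simp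
  -- The outcomes of the final test differ only in the entry j of f₀, f₁ and dev.
  have fin : ∀ s' : HState, s'.N = s₇.N → (∀ a, a ≠ .f₀ → a ≠ .f₁ → a ≠ .dev → s'.R a = s₇.R a) →
      (∀ i ≠ j, s'.R .f₀ i = s₇.R .f₀ i) → (∀ i ≠ j, s'.R .f₁ i = s₇.R .f₁ i) →
      (∀ i ≠ j, s'.R .dev i = s₇.R .dev i) →
      (s'.R .f₀ j, s'.R .f₁ j) = (if u = s.N .w 0 then (1 + G.wt e, s.R .c 0 * G.wt e)
        else G.gate u) → s'.R .dev j = (if u = s.N .w 0 then 0 else G.wt e - 1) →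
      Branched s s' n m j e := by
    intro s' hN hR h0 h1 h2 hF' hD'
    have hsl : ∀ k, slot n m s' k = slot n m s₇ k := fun k => by
      simp [slot, hN, hR .wt, hR .g₀, hR .g₁]
    refine ⟨fr7.trans ⟨?_, ?_, .of_eq ?_ ?_ ?_ ?_ ?_, ?_, ?_, h0, h1, h2⟩, by rw [hN, sel7], hF', hD',
      ?_, ?_, ?_, ?_, ?_, ?_⟩
    · intro a _; rw [hN]
    · intro a ha
      simp only [List.mem_cons, not_or] at ha
      exact hR a (by tauto) (by tauto) (by tauto)
    · rw [hN]
    · rw [hN]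
    · simp [hR]
    · simp [hR]
    · simp [hR]
    · simp [hN]
    · simp [hN]
    · rw [hsl, b7.slot_eq (by rw [← d3, ← d2]; omega), b6.slot_eq (by rw [← d2])]
      exact ag5
    · rw [hsl, b7.slot_eq (by rw [← d3])]
      exact ag6
    · rw [hsl]; exact ag7
    · rw [hN, act7, if_neg (by omega), act6, if_neg (by omega), act5, act4, if_pos rfl]
    · rw [hN, act7, if_neg (by omega), act6, if_pos rfl]
    · rw [hN, act7, if_pos rfl]
  refine HT.cond (T := 3) (fun hb => HT.setR_seq (HT.setR_seq (HT.setR ?_))) (fun hb =>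
    HT.mono (HT.skip ?_) (T := 1) (by omega))
  · rw [eqTest_holds] at hb
    simp only [NExp.eval, u7, w7] at hb
    simp only [NExp.eval, RExp.eval, HState.setR_N, HState.setR_R, j7, o7, e7, c7', wt7, reduceCtorEq,
      false_and, if_false]
    refine fin _ rfl ?_ ?_ ?_ ?_ ?_ ?_
    · intro a h1 h2 h3; funext i; simp [h1, h2, h3]
    · intro i hi; simp [hi]
    · intro i hi; simp [hi]
    · intro i hi; simp [hi]
    · rw [if_pos hb]; simp
    · rw [if_pos hb]; simp
  · rw [eqTest_holds] at hb
    simp only [NExp.eval, u7, w7] at hb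
    refine fin _ rfl (fun _ _ _ _ => rfl) (fun _ _ => rfl) (fun _ _ => rfl) (fun _ _ => rfl) ?_ ?_
    · rw [if_neg hb, F7.1, F7.2]
    · rw [if_neg hb, D7]

def expandProg : HProg :=
  .setN .w 0 (.get .act (NArr.reg .j)) ;;
  scanProg ;;
  .setN .sel (NArr.reg .j) (NArr.reg .e) ;;
  .cond (.natLe 1 (NArr.reg .e)) branchProg .skip

/-- The node `j` of the recursion tree that is stored in memory. -/
def NodeAt (n m : ℕ) (s : HState) (j : ℕ) : Prop :=
  NodeSpec (s.R .c 0) n m (slot n m s (j * (n + m))) (s.N .act j) (s.N .sel j)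
    (s.R .f₀ j, s.R .f₁ j) (s.R .dev j) (slot n m s ((3 * j + 1) * (n + m)))
    (slot n m s ((3 * j + 2) * (n + m))) (slot n m s ((3 * j + 3) * (n + m)))
    (s.N .act (3 * j + 1)) (s.N .act (3 * j + 2)) (s.N .act (3 * j + 3))

/-- Goodness is not assumed: the program also expands useless nodes, such as those under a loop, and
the error analysis disregards them. -/
theorem expandProg_spec {j : ℕ} (hn : s.N .rn 0 = n) (hm : s.N .rm 0 = m)
    (hS : s.N .rs 0 = n + m) (hj : s.N .j 0 = j) (ho : s.N .o 0 = j * (n + m)) :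
    HT expandProg s ((n + m) * 33 + 50) fun s' =>
      NodeFrame s s' j ((3 * j + 1) * (n + m)) ∧ NodeAt n m s' j := by
  refine HT.mono (HT.setN_seq (HT.seq ((scanProg_spec (m := m) (n := n) (o := j * (n + m))
    (w := s.N .act j) ?_ ?_ ?_).post ?_))) (T := 1 + (m * 6 + 3 + ((n + m) * 27 + 42))) (by omega)
  · simp [hm]
  · simp [ho]
  · simp [hj]
  rintro s₁ ⟨n1, r1, hl⟩
  have hslot0 : slot n m (s.setN .w (NExp.eval s 0) (NExp.eval s (.get .act (NArr.reg .j))))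
      (j * (n + m)) = slot n m s (j * (n + m)) := by simp [slot]
  rw [hslot0] at hl
  have j1 : s₁.N .j 0 = j := by simp [n1 .j, hj]
  refine HT.mono (HT.setN_seq ?_) (T := 1 + ((n + m) * 27 + 41)) (by omega)
  simp only [NExp.eval, j1]
  set s₂ := s₁.setN .sel j (s₁.N .e 0) with hs₂
  have n2 : ∀ a, a ≠ .x → a ≠ .e → a ≠ .w → a ≠ .sel → s₂.N a = s.N a := by
    intro a h1 h2 h3 h4
    have := n1 a h1 h2
    funext i
    simp [hs₂, h4, this, h3]
  have r2 : s₂.R = s.R := r1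
  have fr2 : NodeFrame s s₂ j ((3 * j + 1) * (n + m)) := by
    refine ⟨?_, ?_, .of_eq ?_ ?_ ?_ ?_ ?_, ?_, ?_, ?_, ?_, ?_⟩
    · intro a ha
      simp only [List.mem_cons, not_or] at ha
      exact n2 a (by tauto) (by tauto) (by tauto) (by tauto)
    · intro a _; rw [r2]
    · simp [n2]
    · simp [n2]
    · simp [r2]
    · simp [r2]
    · simp [r2]
    · simp [n2]
    · intro i hi; simp [hs₂, hi, n1]
    all_goals simp [r2]
  have sel2 : s₂.N .sel j = s₁.N .e 0 := by simp [hs₂]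
  have e2 : s₂.N .e 0 = s₁.N .e 0 := by simp [hs₂]
  have w2 : s₂.N .w 0 = s.N .act j := by simp [hs₂, n1 .w, hj]
  have slot2 : slot n m s₂ (j * (n + m)) = slot n m s (j * (n + m)) := by
    simp [slot, n2 .fst, n2 .snd, r2]
  rcases hl with ⟨hl, hnone⟩ | ⟨e, hl, hem, hmeet, hlast⟩
  · refine HT.cond (T := (n + m) * 27 + 40) (fun hb => ?_) fun hb => HT.mono (HT.skip ?_) (by omega)
    · simp [e2, hl] at hb
    · refine ⟨fr2, ?_⟩
      rw [NodeAt, sel2, hl, slot2, n2 .act (by simp) (by simp) (by simp) (by simp)]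
      exact ⟨fun _ => hnone, fun _ h => by omega, fun _ h => by omega, fun _ h => by omega,
        fun _ h => by omega, fun _ h => by omega, fun _ h => by omega⟩
  · refine HT.cond (T := (n + m) * 27 + 40) (fun _ => ?_) fun hb => ?_
    swap
    · simp [e2, hl] at hb
    refine (branchProg_spec (n := n) (m := m) (j := j) (e := e) ?_ ?_ ?_ ?_ ?_ ?_ hem).post ?_
    · simp [n2 .rn, hn]
    · simp [n2 .rm, hm]
    · simp [n2 .rs, hS]
    · simp [n2 .j, hj]
    · simp [n2 .o, ho]
    · rw [e2, hl]
    intro s' h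
    refine ⟨fr2.trans h.frame, ?_⟩
    have hw : s'.N .act j = s₂.N .w 0 := by
      rw [h.frame.act j (by omega), w2, n2 .act] <;> simp
    rw [NodeAt, h.sel, sel2, hl, hw, h.frame.below.slot_eq (by ring_nf; omega),
      h.frame.R .c (by simp)]
    have hE : ∀ e', e + 1 = e' + 1 → e' = e := fun e' h => by omega
    constructor
    · intro h; omega
    all_goals intro e' he'; obtain rfl := hE e' he'
    · rw [slot2, w2]; exact ⟨hem, hmeet, hlast⟩
    · exact h.seq
    · exact h.dev
    · exact ⟨h.child₁, h.act₁⟩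
    · exact ⟨h.child₂, h.act₂⟩
    · exact ⟨h.child₃, h.act₃⟩

end FibonacciHolant


namespace FibonacciHolant

variable {n m N : ℕ} {c : ℝ} {s : HState}

/-! ### Expansion and evaluation of the tree -/

theorem NodeAt.congr {s' : HState} {j : ℕ} (h : NodeAt n m s j)
    (hN : ∀ a ∈ [NArr.fst, .snd, .act, .sel], s'.N a = s.N a)
    (hR : ∀ a ∈ [RArr.wt, .g₀, .g₁, .f₀, .f₁, .dev, .c], s'.R a = s.R a) : NodeAt n m s' j := by
  have hs : ∀ k, slot n m s' k = slot n m s k := fun k => by simp [slot, hN, hR]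
  unfold NodeAt
  simp only [hs, hN .act (by simp), hN .sel (by simp), hR .f₀ (by simp), hR .f₁ (by simp),
    hR .dev (by simp), hR .c (by simp)]
  exact h

/-- A node i < j involves slots up to 3i + 3 ≤ 3j only, while the expansion of j writes from the
slot 3j + 1 on. -/
theorem NodeAt.frame {s' : HState} {i j : ℕ} (h : NodeAt n m s i)
    (hf : NodeFrame s s' j ((3 * j + 1) * (n + m))) (hij : i < j) : NodeAt n m s' i := by
  have hs : ∀ k ≤ 3 * j, slot n m s' (k * (n + m)) = slot n m s (k * (n + m)) := fun k hk =>
    hf.below.slot_eq (by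
      have := Nat.mul_le_mul_right (n + m) (show k + 1 ≤ 3 * j + 1 by omega)
      linarith)
  unfold NodeAt
  rw [hs i (by omega), hs _ (by omega), hs _ (by omega), hs _ (by omega), hf.act i (by omega),
    hf.act _ (by omega), hf.act _ (by omega), hf.act _ (by omega), hf.sel i (by omega),
    hf.f₀ i (by omega), hf.f₁ i (by omega), hf.dev i (by omega), hf.R .c (by simp)]
  exact h

/-- In increasing order each node is in place before its turn comes. The register o follows j(n + m)
by additions. -/
def expandAll : HProg :=
  .setN .o 0 0 ;;
  forLoop .j (NArr.reg .cnt) (expandProg ;; .setN .o 0 (NArr.reg .o + NArr.reg .rs))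

/-- The effect of expanding the first `k` nodes of the tree. -/
structure Grown (s s' : HState) (n m k : ℕ) : Prop where
  N : ∀ a, a ∉ [NArr.x, .fst, .snd, .act, .sel, .src, .dst, .e, .u, .w, .o, .j] → s'.N a = s.N a
  R : ∀ a, a ∉ [RArr.wt, .g₀, .g₁, .f₀, .f₁, .dev] → s'.R a = s.R a
  below : SameBelow s s' (n + m)
  act : s'.N .act 0 = s.N .act 0
  node : ∀ j < k, NodeAt n m s' j

theorem expandAll_spec (hn : s.N .rn 0 = n) (hm : s.N .rm 0 = m) (hS : s.N .rs 0 = n + m)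
    (hN : s.N .cnt 0 = N) :
    HT expandAll s (N * ((n + m) * 33 + 53) + 3) fun s' => Grown s s' n m N := by
  refine HT.mono ((HT.setN_seq (HT.forLoop (k := N) (T := (n + m) * 33 + 51) (Inv := fun i s' =>
    Grown s s' n m i ∧ s'.N .o 0 = i * (n + m)) ?_ ?_ ?_)).post fun _ h => h.1) (by ring_nf; omega)
  · refine ⟨⟨?_, fun _ _ => rfl, .of_eq ?_ ?_ ?_ ?_ ?_, ?_, ?_⟩, by simp⟩
    · intro a ha
      simp only [List.mem_cons, not_or] at ha
      funext i; simp [ha]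
    · funext i; simp
    · funext i; simp
    · rfl
    · rfl
    · rfl
    · simp
    · intro j hj; omega
  · rintro i s' ⟨h, -⟩
    simp [h.N .cnt, hN]
  · rintro i hi s₁ hj ⟨h, ho⟩
    refine HT.seq (T := (n + m) * 33 + 50) (T' := 1)
      ((expandProg_spec (n := n) (m := m) (j := i) ?_ ?_ ?_ hj ho).post ?_)
    · simp [h.N .rn, hn]
    · simp [h.N .rm, hm]
    · simp [h.N .rs, hS]
    rintro s₂ ⟨hf, hnode⟩
    refine HT.setN ?_
    have e1 : s₂.N .o 0 = i * (n + m) := by rw [hf.N .o (by simp), ho]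
    have e2 : s₂.N .rs 0 = n + m := by rw [hf.N .rs (by simp), h.N .rs (by simp), hS]
    have e3 : s₂.N .j 0 = i := by rw [hf.N .j (by simp), hj]
    simp only [NExp.eval, e1, e2]
    refine ⟨by simp [e3], ⟨?_, ?_, ?_, ?_, ?_⟩, by simp; ring⟩
    · intro a ha
      rw [← h.N a ha, ← hf.N a (by simp only [List.mem_cons, not_or] at ha ⊢; tauto)]
      simp only [List.mem_cons, not_or] at ha
      funext y; simp [ha]
    · intro a ha
      rw [← h.R a ha, ← hf.R a ha]; rfl
    · refine h.below.trans ((hf.below.mono (Nat.le_mul_of_pos_left _ (by omega))).trans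
        (.of_eq ?_ ?_ rfl rfl rfl))
      · funext y; simp
      · funext y; simp
    · simp [hf.act 0, h.act]
    · intro j hj'
      refine NodeAt.congr (s := s₂) ?_ ?_ fun _ _ => rfl
      · rcases Nat.lt_succ_iff_lt_or_eq.1 hj' with hlt | rfl
        · exact (h.node j hlt).frame hf hlt
        · exact hnode
      · intro a ha
        simp only [List.mem_cons, List.not_mem_nil, or_false] at ha
        rcases ha with rfl | rfl | rfl | rfl <;> funext y <;> simp

/-! ### Expressions for the edge factors -/

def pairExp (a₀ a₁ X : RExp) : RExp := a₀ * X + a₁ * (1 - X)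

def convExp₁ (a₀ a₁ b₀ b₁ : RExp) : RExp := a₀ * b₀ + a₁ * b₁
def convExp₂ (c a₀ a₁ b₀ b₁ : RExp) : RExp := a₁ * b₀ + a₀ * b₁ + c * a₁ * b₁

def corrExp (c F₀ F₁ X₂ X₃ : RExp) : RExp :=
  pairExp F₁ (F₀ + c * F₁) X₃ /
    (pairExp F₀ F₁ X₃ + pairExp F₁ (F₀ + c * F₁) X₃ * pairExp 1 (1 + c) X₂)

def edgeFactorExp (c F₀ F₁ δ X₁ X₂ X₃ a₀ a₁ : RExp) : RExp :=
  pairExp (convExp₁ a₀ a₁ F₀ F₁) (convExp₂ c a₀ a₁ F₀ F₁) X₁ /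
    pairExp (convExp₁ 1 1 F₀ F₁) (convExp₂ c 1 1 F₀ F₁) X₁ +
  δ * (pairExp a₁ (a₀ + c * a₁) X₂ * corrExp c F₀ F₁ X₂ X₃)

theorem eval_edgeFactorExp (c F₀ F₁ δ X₁ X₂ X₃ a₀ a₁ : RExp) :
    (edgeFactorExp c F₀ F₁ δ X₁ X₂ X₃ a₀ a₁).eval s = edgeFactor (c.eval s)
      (F₀.eval s, F₁.eval s) (δ.eval s) (X₁.eval s) (X₂.eval s) (X₃.eval s)
      (a₀.eval s, a₁.eval s) := by
  simp [edgeFactorExp, corrExp, pairExp, convExp₁, convExp₂, edgeFactor, corr, pair, conv, shift]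

def nodeFactorExp (j : NExp) (a₀ a₁ : RExp) : RExp :=
  edgeFactorExp RArr.c.reg (.get .f₀ j) (.get .f₁ j) (.get .dev j) (.get .val (j + j + j + 1))
    (.get .val (j + j + j + 2)) (.get .val (j + j + j + 3)) a₀ a₁

/-- The factor that is computed at the node `j`. -/
noncomputable def nodeFactor (s : HState) (j : ℕ) (a : ℝ × ℝ) : ℝ :=
  edgeFactor (s.R .c 0) (s.R .f₀ j, s.R .f₁ j) (s.R .dev j) (s.R .val (3 * j + 1))
    (s.R .val (3 * j + 2)) (s.R .val (3 * j + 3)) a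

theorem eval_nodeFactorExp {j : NExp} {a₀ a₁ : RExp} {j' : ℕ} (hj : j.eval s = j') :
    (nodeFactorExp j a₀ a₁).eval s = nodeFactor s j' (a₀.eval s, a₁.eval s) := by
  rw [nodeFactorExp, eval_edgeFactorExp, nodeFactor]
  simp [hj, show j' + j' + j' = 3 * j' by ring]

/-- The order is decreasing, so that children precede their parents; entries from N on keep the
preset value 1. -/
def evalAll : HProg :=
  forLoop .x (NArr.reg .cnt)
    (.setN .j 0 (NArr.reg .cnt - (NArr.reg .x + 1)) ;;
     .cond (.natLe 1 (.get .sel (NArr.reg .j)))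
      (.setR .val (NArr.reg .j)
        (nodeFactorExp (NArr.reg .j) 1 0 / nodeFactorExp (NArr.reg .j) 1 1))
      (.setR .val (NArr.reg .j) 1))

/-- The effect of evaluating the nodes of the tree from `k` on. -/
structure Evaluated (s s' : HState) (N k : ℕ) : Prop where
  frameN : ∀ a, a ≠ .x → a ≠ .j → s'.N a = s.N a
  frameR : ∀ a, a ≠ .val → s'.R a = s.R a
  leaf : ∀ j, N ≤ j → j ≤ 3 * N → s'.R .val j = 1
  val_none : ∀ j, k ≤ j → j < N → s.N .sel j = 0 → s'.R .val j = 1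
  val_some : ∀ j, k ≤ j → j < N → s.N .sel j ≠ 0 →
    s'.R .val j = nodeFactor s' j (1, 0) / nodeFactor s' j (1, 1)

theorem evalAll_spec (hN : s.N .cnt 0 = N) (hleaf : ∀ j, N ≤ j → j ≤ 3 * N → s.R .val j = 1) :
    HT evalAll s (N * 5 + 2) fun s' => Evaluated s s' N 0 := by
  refine (HT.forLoop (k := N) (T := 3) (Inv := fun i s' => Evaluated s s' N (N - i)) ?_ ?_ ?_).post
    fun s' h => by simpa using h
  · refine ⟨?_, fun _ _ => rfl, hleaf, ?_, ?_⟩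
    · intro a h1 h2; funext i; simp [h1]
    · intro j h1 h2; omega
    · intro j h1 h2; omega
  · intro i s' h
    simp [h.frameN .cnt, hN]
  · intro i hi s₁ hx h
    refine HT.setN_seq (T := 2) ?_
    have e1 : s₁.N .cnt 0 = N := by simp [h.frameN .cnt, hN]
    rw [show (NArr.reg .cnt - (NArr.reg .x + 1)).eval s₁ = N - (i + 1) by simp [e1, hx]]
    change HT _ (s₁.setN .j 0 _) _ _
    have hlt : N - (i + 1) < N := by omega
    have hN1 : N - i = N - (i + 1) + 1 := by omega
    rw [hN1] at h
    generalize N - (i + 1) = j at hlt h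
    clear hN1
    have hj1 : ∀ s', (s₁.setN .j 0 j).N = s'.N → (NArr.reg .j).eval s' = j := by
      intro s' h; simp [← h]
    have fin : ∀ v : ℝ, (s.N .sel j = 0 → v = 1) → (s.N .sel j ≠ 0 →
        v = nodeFactor s₁ j (1, 0) / nodeFactor s₁ j (1, 1)) →
        ((s₁.setN .j 0 j).setR .val j v).N .x 0 = i ∧
        Evaluated s (((s₁.setN .j 0 j).setR .val j v).setN .x 0 (i + 1)) N j := by
      intro v h0 h1
      -- Children of nodes from j on have indices larger than j, so writing the value of j does not
      -- disturb their factors.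
      have hnf : ∀ j' ≥ j, ∀ a, nodeFactor (((s₁.setN .j 0 j).setR .val j v).setN .x 0 (i + 1)) j' a
          = nodeFactor s₁ j' a := by
        intro j' hj' a
        simp [nodeFactor, show 3 * j' + 1 ≠ j by omega, show 3 * j' + 2 ≠ j by omega,
          show 3 * j' + 3 ≠ j by omega]
      refine ⟨by simp [hx], ?_, ?_, ?_, ?_, ?_⟩
      · intro a g1 g2; rw [← h.frameN a g1 g2]; funext y; simp [g1, g2]
      · intro a g1; rw [← h.frameR a g1]; funext y; simp [g1]
      · intro j' g1 g2; simp [show j' ≠ j by omega, h.leaf j' g1 g2]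
      · intro j' g1 g2 g3
        rcases Nat.eq_or_lt_of_le g1 with rfl | g4
        · simp [h0 g3]
        · simp [show j' ≠ j by omega, h.val_none j' g4 g2 g3]
      · intro j' g1 g2 g3
        rw [hnf j' g1, hnf j' g1]
        rcases Nat.eq_or_lt_of_le g1 with rfl | g4
        · simp [h1 g3]
        · simp [show j' ≠ j by omega, h.val_some j' g4 g2 g3]
    have hsel : (NExp.get NArr.sel (NArr.reg .j)).eval (s₁.setN .j 0 j) = s.N .sel j := by
      simp [h.frameN .sel]
    refine HT.cond (T := 1) (fun hb => HT.setR ?_) fun hb => HT.setR ?_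
    · rw [hj1 _ rfl]
      refine fin _ (fun h0 => ?_) fun _ => ?_
      · simp only [HTest.Holds, hsel, h0] at hb; simp at hb
      · rw [RExp.eval_div, eval_nodeFactorExp (hj1 _ rfl), eval_nodeFactorExp (hj1 _ rfl)]
        simp [nodeFactor]
    · rw [hj1 _ rfl]
      refine fin _ (fun _ => by simp) fun h0 => ?_
      simp only [HTest.Holds, hsel] at hb
      simp at hb; omega

/-! ### The contraction of all edges -/

/-- The registers are set up for the contraction of the edges. -/
structure Ready (n m N : ℕ) (c : ℝ) (s : HState) : Prop where
  rn : s.N .rn 0 = n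
  rm : s.N .rm 0 = m
  rs : s.N .rs 0 = n + m
  cnt : s.N .cnt 0 = N
  c : s.R .c 0 = c
  leaf : ∀ j, N ≤ j → j ≤ 3 * N → s.R .val j = 1

/-- The round i treats the edge m - 1 - i. Its contraction is already stored as the first child of
the root; it is moved to slot 0, and the sequence at its base is filled in. -/
def roundProg : HProg :=
  .setN .act 0 (.get .fst (NArr.reg .rm - (NArr.reg .i + 1))) ;;
  expandAll ;;
  evalAll ;;
  .setR .acc 0 (RArr.reg .acc * nodeFactorExp 0 (.get .g₀ (NArr.reg .act))
    (.get .g₁ (NArr.reg .act))) ;;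
  .setN .src 0 (NArr.reg .rs) ;;
  .setN .dst 0 0 ;;
  copySlot ;;
  .setR .g₀ (NArr.reg .act) (convExp₁ 1 1 (.get .f₀ 0) (.get .f₁ 0)) ;;
  .setR .g₁ (NArr.reg .act) (convExp₂ RArr.c.reg 1 1 (.get .f₀ 0) (.get .f₁ 0))

/-- The predicate Q is abstract, which separates the program from the analysis: later Q is
`Progress`. The bound on `fst k` is needed because `slot` shows the stored sequences only at
vertices below n. -/
theorem roundProg_spec {k : ℕ} (hr : Ready n m N c s) (hi : s.N .i 0 + (k + 1) = m)
    {Q : Net → ℝ → ℕ → Prop} (hQ : Q (slot n m s 0) (s.R .acc 0) (k + 1))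
    (hlt : ∀ G acc, Q G acc (k + 1) → G.fst k < n)
    (hstep : ∀ {node : ℕ → Net} {act sl : ℕ → ℕ} {Fs : ℕ → ℝ × ℝ} {δs val : ℕ → ℝ} {acc : ℝ}
      {G' : Net}, TreeSpec c n m N node act sl Fs δs val → act 0 = (node 0).fst k →
      Q (node 0) acc (k + 1) → Net.Agree n m G' ((node 1).setGate (act 0) (conv c (1, 1) (Fs 0))) →
      Q G' (acc * edgeFactor c (Fs 0) (δs 0) (val 1) (val 2) (val 3) ((node 0).gate (act 0))) k) :
    HT roundProg s (N * ((n + m) * 33 + 58) + (n + m) * 7 + 13) fun s' => s'.N .i 0 = s.N .i 0 ∧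
      Ready n m N c s' ∧ Q (slot n m s' 0) (s'.R .acc 0) k := by
  have hkm : m - (s.N .i 0 + 1) = k := by omega
  refine HT.mono (HT.setN_seq (HT.seq ((expandAll_spec (n := n) (m := m) (N := N) ?_ ?_ ?_ ?_).post
    fun s₂ h2 => HT.seq ((evalAll_spec (N := N) ?_ ?_).post fun s₃ h3 => ?_))))
    (T := 1 + (N * ((n + m) * 33 + 53) + 3 + (N * 5 + 2 + ((n + m) * 7 + 7)))) (by ring_nf; omega)
  · simp [hr.rn]
  · simp [hr.rm]
  · simp [hr.rs]
  · simp [hr.cnt]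
  · simp [h2.N .cnt, hr.cnt]
  · intro j g1 g2; simp [h2.R .val, hr.leaf j g1 g2]
  have hk : k < m := by omega
  set s₁ := s.setN .act (NExp.eval s 0)
    (NExp.eval s (.get .fst (NArr.reg .rm - (NArr.reg .i + 1)))) with hs₁
  have act1 : s₁.N .act 0 = (slot n m s 0).fst k := by simp [hs₁, hr.rm, hkm, slot, hk]
  have N1 : ∀ a, a ≠ .act → s₁.N a = s.N a := fun a ha => by funext y; simp [hs₁, ha]
  have slot1 : slot n m s₁ 0 = slot n m s 0 := by simp [slot, hs₁]
  have slot3 : ∀ y, slot n m s₃ y = slot n m s₂ y := fun y => by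
    simp [slot, h3.frameN .fst, h3.frameN .snd, h3.frameR .wt, h3.frameR .g₀, h3.frameR .g₁]
  have slot0 : slot n m s₃ (0 * (n + m)) = slot n m s 0 := by
    rw [slot3, Nat.zero_mul, h2.below.slot_eq (by omega), slot1]
  have act3 : s₃.N .act 0 = (slot n m s 0).fst k := by
    rw [h3.frameN .act (by simp) (by simp), h2.act, act1]
  have c3 : s₃.R .c 0 = c := by
    rw [h3.frameR .c (by simp), h2.R .c (by simp), ← hr.c]; rfl
  have hT : TreeSpec c n m N (fun j => slot n m s₃ (j * (n + m))) (s₃.N .act) (s₃.N .sel)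
      (fun j => (s₃.R .f₀ j, s₃.R .f₁ j)) (s₃.R .dev) (s₃.R .val) := by
    have hsel : s₃.N .sel = s₂.N .sel := h3.frameN _ (by simp) (by simp)
    constructor
    · intro j hj
      have := (h2.node j hj).congr (s' := s₃) ?_ ?_
      · rwa [NodeAt, c3] at this
      · intro a ha
        refine h3.frameN a ?_ ?_ <;> rintro rfl <;> simp at ha
      · intro a ha
        refine h3.frameR a ?_; rintro rfl; simp at ha
    · exact h3.leaf
    · intro j hj h0; exact h3.val_none j (Nat.zero_le _) hj (by rwa [← hsel])
    · intro j hj h0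
      rw [h3.val_some j (Nat.zero_le _) hj (by rwa [← hsel]), nodeFactor, nodeFactor, c3]
  have acc3 : s₃.R .acc 0 = s.R .acc 0 := by
    rw [h3.frameR .acc (by simp), h2.R .acc (by simp)]; rfl
  have hw : (slot n m s 0).fst k < n := hlt _ _ hQ
  have gate3 : (slot n m s 0).gate (s₃.N .act 0) =
      (s₃.R .g₀ (s₃.N .act 0), s₃.R .g₁ (s₃.N .act 0)) := by
    have : ∀ w < n, (slot n m s 0).gate w = (s₃.R .g₀ w, s₃.R .g₁ w) := fun w hw => by
      rw [← slot0]; simp [slot, hw]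
    rw [act3]; exact this _ hw
  have hfin := fun G' hG' => hstep (G' := G') (acc := s₃.R .acc 0) hT (by simp only [slot0, act3])
    (by rw [slot0, acc3]; exact hQ) hG'
  simp only [slot0, gate3] at hfin
  have N3 : ∀ a, a ∉ [NArr.x, .fst, .snd, .act, .sel, .src, .dst, .e, .u, .w, .o, .j] →
      s₃.N a = s.N a := by
    intro a ha
    have h4 := ha
    simp only [List.mem_cons, not_or] at h4
    rw [h3.frameN a (by tauto) (by tauto), h2.N a ha, N1 a (by tauto)]
  refine HT.mono (HT.setR_seq (HT.setN_seq (HT.setN_seq (HT.seq ((copySlot_spec (k := n + m)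
    (k' := 0) (S := n + m) ?_ ?_ ?_ ?_).post fun s₄ h4 => ?_))))) (T := 1 + (1 + (1 + ((n + m) * 7 + 2 + 2)))) (by omega)
  · simp [N3 .rs, hr.rs]
  · simp [N3 .rs, hr.rs]
  · simp
  · omega
  have eacc : (nodeFactorExp 0 (.get .g₀ (NArr.reg .act)) (.get .g₁ (NArr.reg .act))).eval s₃ =
      edgeFactor c (s₃.R .f₀ 0, s₃.R .f₁ 0) (s₃.R .dev 0) (s₃.R .val 1) (s₃.R .val 2) (s₃.R .val 3)
        (s₃.R .g₀ (s₃.N .act 0), s₃.R .g₁ (s₃.N .act 0)) := by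
    rw [eval_nodeFactorExp (j' := 0) rfl, nodeFactor, c3]; simp
  have a4 : (NArr.reg .act).eval s₄ = s₃.N .act 0 := by simp [h4.frameN .act]
  have f4 : ∀ a, a ≠ .wt → a ≠ .g₀ → a ≠ .g₁ → a ≠ .acc → s₄.R a = s₃.R a := by
    intro a g1 g2 g3 g4
    rw [h4.frameR a g1 g2 g3]; funext y; simp [g4]
  have acc4 : s₄.R .acc 0 = s₃.R .acc 0 * edgeFactor c (s₃.R .f₀ 0, s₃.R .f₁ 0) (s₃.R .dev 0)
      (s₃.R .val 1) (s₃.R .val 2) (s₃.R .val 3)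
        (s₃.R .g₀ (s₃.N .act 0), s₃.R .g₁ (s₃.N .act 0)) := by
    rw [h4.frameR .acc (by simp) (by simp) (by simp), ← eacc]; simp
  have slot4 : slot n m s₄ 0 = slot n m s₃ (1 * (n + m)) := by
    rw [h4.slot_eq]; simp [slot]
  have v1 : (convExp₁ 1 1 (.get .f₀ 0) (.get .f₁ 0)).eval s₄ =
      (conv c (1, 1) (s₃.R .f₀ 0, s₃.R .f₁ 0)).1 := by
    simp [convExp₁, conv, f4 .f₀, f4 .f₁]
  have v2 : (convExp₂ RArr.c.reg 1 1 (.get .f₀ 0) (.get .f₁ 0)).eval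
      (s₄.setR .g₀ (s₃.N .act 0) (conv c (1, 1) (s₃.R .f₀ 0, s₃.R .f₁ 0)).1) =
      (conv c (1, 1) (s₃.R .f₀ 0, s₃.R .f₁ 0)).2 := by
    simp [convExp₂, conv, f4 .f₀, f4 .f₁, f4 .c, c3]
  refine HT.setR_seq (HT.setR ?_)
  rw [a4, v1, v2]
  rw [show (NArr.reg .act).eval (s₄.setR .g₀ (s₃.N .act 0)
    (conv c (1, 1) (s₃.R .f₀ 0, s₃.R .f₁ 0)).1) = s₃.N .act 0 from a4]
  have N4 : ∀ a, a ∉ [NArr.x, .fst, .snd, .act, .sel, .src, .dst, .e, .u, .w, .o, .j] →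
      s₄.N a = s.N a := by
    intro a ha
    rw [← N3 a ha]
    simp only [List.mem_cons, not_or] at ha
    rw [h4.frameN a (by tauto) (by tauto) (by tauto)]; funext y; simp [ha]
  refine ⟨?_, ⟨?_, ?_, ?_, ?_, ?_, ?_⟩, ?_⟩
  · simp [N4 .i]
  · simp [N4 .rn, hr.rn]
  · simp [N4 .rm, hr.rm]
  · simp [N4 .rs, hr.rs]
  · simp [N4 .cnt, hr.cnt]
  · simp [f4 .c, c3]
  · intro j g1 g2
    simp [f4 .val, h3.leaf j g1 g2]
  · rw [HState.setR_R, if_neg (by simp), HState.setR_R, if_neg (by simp), acc4]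
    refine hfin _ ⟨?_, ?_, ?_, ?_⟩
    · intro e he; rw [← slot4]; simp [slot, Net.setGate]
    · intro e he; rw [← slot4]; simp [slot, Net.setGate]
    · intro e he; rw [← slot4]; simp [slot, Net.setGate]
    · intro v hv; rw [← slot4]
      by_cases hvw : v = s₃.N .act 0
      · subst hvw; simp [slot, Net.setGate, hv]
      · simp [slot, Net.setGate, hv, hvw]

theorem Ready.congr {s' : HState} (h : Ready n m N c s)
    (hN : ∀ a ∈ [NArr.rn, .rm, .rs, .cnt], s'.N a 0 = s.N a 0) (hR : s'.R = s.R) :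
    Ready n m N c s' where
  rn := by rw [hN _ (by simp), h.rn]
  rm := by rw [hN _ (by simp), h.rm]
  rs := by rw [hN _ (by simp), h.rs]
  cnt := by rw [hN _ (by simp), h.cnt]
  c := by rw [hR, h.c]
  leaf := by rw [hR]; exact h.leaf

def contractAll : HProg := forLoop .i (NArr.reg .rm) roundProg

theorem contractAll_spec (hr : Ready n m N c s) {Q : Net → ℝ → ℕ → Prop}
    (hQ : Q (slot n m s 0) (s.R .acc 0) m)
    (hlt : ∀ k < m, ∀ G acc, Q G acc (k + 1) → G.fst k < n)
    (hstep : ∀ k < m, ∀ {node : ℕ → Net} {act sl : ℕ → ℕ} {Fs : ℕ → ℝ × ℝ} {δs val : ℕ → ℝ}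
      {acc : ℝ} {G' : Net}, TreeSpec c n m N node act sl Fs δs val → act 0 = (node 0).fst k →
      Q (node 0) acc (k + 1) → Net.Agree n m G' ((node 1).setGate (act 0) (conv c (1, 1) (Fs 0))) →
      Q G' (acc * edgeFactor c (Fs 0) (δs 0) (val 1) (val 2) (val 3) ((node 0).gate (act 0))) k) :
    HT contractAll s (m * (N * ((n + m) * 33 + 58) + (n + m) * 7 + 15) + 2) fun s' =>
      Ready n m N c s' ∧ Q (slot n m s' 0) (s'.R .acc 0) 0 := by
  refine (HT.forLoop (k := m) (Inv := fun i s' => Ready n m N c s' ∧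
    Q (slot n m s' 0) (s'.R .acc 0) (m - i)) ?_ ?_ ?_).post fun s' h => by simpa using h
  · refine ⟨hr.congr ?_ rfl, ?_⟩
    · intro a ha
      simp only [List.mem_cons, List.not_mem_nil, or_false] at ha
      rcases ha with rfl | rfl | rfl | rfl <;> simp
    · rw [Nat.sub_zero]
      convert hQ using 1 <;> simp [slot]
  · intro i s' h
    simp [h.1.rm]
  · rintro i hi s₁ hs ⟨h1, h2⟩
    obtain ⟨k, hk⟩ : ∃ k, m = i + (k + 1) := ⟨m - i - 1, by omega⟩
    rw [show m - i = k + 1 by omega] at h2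
    refine (roundProg_spec (k := k) h1 (by omega) h2 (hlt k (by omega))
      (hstep k (by omega))).post ?_
    rintro s₂ ⟨g1, g2, g3⟩
    refine ⟨by rw [g1, hs], g2.congr ?_ rfl, ?_⟩
    · intro a ha
      simp only [List.mem_cons, List.not_mem_nil, or_false] at ha
      rcases ha with rfl | rfl | rfl | rfl <;> simp
    · rw [show m - (i + 1) = k by omega]
      convert g3 using 1 <;> simp [slot]

def prodProg : HProg :=
  forLoop .x (NArr.reg .rn) (.setR .acc 0 (RArr.reg .acc * .get .g₀ (NArr.reg .x)))

theorem prodProg_spec (hn : s.N .rn 0 = n) :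
    HT prodProg s (n * 3 + 2) fun s' => s'.R .acc 0 =
      s.R .acc 0 * ∏ v ∈ Finset.range n, ((slot n m s 0).gate v).1 := by
  refine (HT.forLoop (k := n) (Inv := fun i s' => s'.N .rn 0 = n ∧ s'.R .g₀ = s.R .g₀ ∧
    s'.R .acc 0 = s.R .acc 0 * ∏ v ∈ Finset.range i, s.R .g₀ v) ?_ ?_ ?_).post ?_
  · simp [hn]
  · intro i s' h
    simp [h.1]
  · rintro i hi s₁ hx ⟨h1, h2, h3⟩
    refine HT.setR ?_
    refine ⟨by simp [hx], by simp [h1], by funext y; simp [h2], ?_⟩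
    simp [hx, h2, h3, Finset.prod_range_succ, mul_assoc]
  · rintro s' ⟨-, -, h⟩
    rw [h]
    congr 1
    refine Finset.prod_congr rfl fun v hv => ?_
    simp [slot, Finset.mem_range.1 hv]

end FibonacciHolant


namespace FibonacciHolant

variable {n m : ℕ} {s : HState}

/-! ### Reading the input -/

/-- Degrees are counted because the input does not contain the lengths of the functions. The number
of edges is counted once more as a real, there being no conversion from natural numbers to reals. -/
def parseEdges : HProg :=
  forLoop .x (NArr.reg .rm)
    (.setN .fst (NArr.reg .x) (.get .inp (NArr.reg .x + NArr.reg .x + 2)) ;;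
     .setN .snd (NArr.reg .x) (.get .inp (NArr.reg .x + NArr.reg .x + 3)) ;;
     .setR .wt (NArr.reg .x) (.get .inp (NArr.reg .x + 1)) ;;
     .setN .deg (.get .fst (NArr.reg .x)) (.get .deg (.get .fst (NArr.reg .x)) + 1) ;;
     .setN .deg (.get .snd (NArr.reg .x)) (.get .deg (.get .snd (NArr.reg .x)) + 1) ;;
     .setR .mr 0 (RArr.reg .mr + 1))

/-- The degree of `v` in the graph with the edges below `m`. -/
def degree (E₁ E₂ : ℕ → ℕ) (m v : ℕ) : ℕ :=
  ∑ e ∈ Finset.range m, ((if E₁ e = v then 1 else 0) + (if E₂ e = v then 1 else 0))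

/-- The edges below `k` have been read. -/
structure EdgesRead (s s' : HState) (E₁ E₂ : ℕ → ℕ) (L : ℕ → ℝ) (k : ℕ) : Prop where
  N : ∀ a, a ≠ .x → a ≠ .fst → a ≠ .snd → a ≠ .deg → s'.N a = s.N a
  R : ∀ a, a ≠ .wt → a ≠ .mr → s'.R a = s.R a
  fst : ∀ e < k, s'.N .fst e = E₁ e
  snd : ∀ e < k, s'.N .snd e = E₂ e
  wt : ∀ e < k, s'.R .wt e = L e
  deg : ∀ v, s'.N .deg v = degree E₁ E₂ k v
  mr : s'.R .mr 0 = k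

theorem parseEdges_spec {E₁ E₂ : ℕ → ℕ} {L : ℕ → ℝ} (hm : s.N .rm 0 = m)
    (hE₁ : ∀ e < m, s.N .inp (e + e + 2) = E₁ e) (hE₂ : ∀ e < m, s.N .inp (e + e + 3) = E₂ e)
    (hL : ∀ e < m, s.R .inp (e + 1) = L e) (hdeg : ∀ v, s.N .deg v = 0) (hmr : s.R .mr 0 = 0) :
    HT parseEdges s (m * 8 + 2) fun s' => EdgesRead s s' E₁ E₂ L m := by
  refine HT.forLoop (k := m) (T := 6) (Inv := fun i s' => EdgesRead s s' E₁ E₂ L i) ?_ ?_ ?_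
  · refine ⟨?_, fun _ _ _ => rfl, ?_, ?_, ?_, ?_, ?_⟩
    · intro a h1 h2 h3 h4; funext i; simp [h1]
    · intro e he; omega
    · intro e he; omega
    · intro e he; omega
    · intro v; simp [hdeg, degree]
    · simp [hmr]
  · intro i s' h
    simp [h.N .rm, hm]
  · intro i hi s₁ hx h
    have e1 := hE₁ i hi
    have e2 := hE₂ i hi
    have e3 := hL i hi
    have i1 : s₁.N .inp = s.N .inp := h.N _ (by simp) (by simp) (by simp) (by simp)
    have i2 : s₁.R .inp = s.R .inp := h.R _ (by simp) (by simp)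
    refine HT.setN_seq (HT.setN_seq (HT.setR_seq (HT.setN_seq (HT.setN_seq (HT.setR ?_)))))
    simp only [NExp.eval, RExp.eval, HState.setN_N, HState.setR_N,
      HState.setR_R, HState.setN_R, reduceCtorEq, false_and, if_false, true_and, hx, i1, i2, e1, e2,
      e3, if_true]
    refine ⟨?_, ?_, ?_, ?_, ?_, ?_, ?_⟩
    · intro a h1 h2 h3 h4; rw [← h.N a h1 h2 h3 h4]; funext y; simp [h1, h2, h3, h4]
    · intro a h1 h2; rw [← h.R a h1 h2]; funext y; simp [h1, h2]
    · intro e he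
      rcases Nat.lt_succ_iff_lt_or_eq.1 he with h1 | rfl
      · simp [h1.ne, h.fst e h1]
      · simp
    · intro e he
      rcases Nat.lt_succ_iff_lt_or_eq.1 he with h1 | rfl
      · simp [h1.ne, h.snd e h1]
      · simp
    · intro e he
      rcases Nat.lt_succ_iff_lt_or_eq.1 he with h1 | rfl
      · simp [h1.ne, h.wt e h1]
      · simp
    · intro v
      have := h.deg
      simp only [degree] at this ⊢
      rw [Finset.sum_range_succ]
      by_cases h1 : v = E₁ i <;> by_cases h2 : v = E₂ i <;>
        simp [h1, h2, this, eq_comm] <;> split_ifs <;> simp_all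
    · simp [h.mr]

/-- The values at v occupy deg v + 1 cells. At degree 0 there is no second term, and repeating the
first is admissible when p ≤ 1. The coefficient is read off any vertex of degree at least 2 with f_1
> 0, and defaults to 1. -/
def parseGates : HProg :=
  .setN .pos 0 (NArr.reg .rm + 1) ;;
  .setR .c 0 1 ;;
  forLoop .x (NArr.reg .rn)
    (.setR .g₀ (NArr.reg .x) (.get .inp (NArr.reg .pos)) ;;
     .cond (.natLe 1 (.get .deg (NArr.reg .x)))
      (.setR .g₁ (NArr.reg .x) (.get .inp (NArr.reg .pos + 1)))
      (.setR .g₁ (NArr.reg .x) (.get .inp (NArr.reg .pos))) ;;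
     .cond (.natLe 2 (.get .deg (NArr.reg .x)))
      (.cond (.realLe (.get .inp (NArr.reg .pos + 1)) 0) .skip
        (.setR .c 0 ((.get .inp (NArr.reg .pos + 2) - .get .inp (NArr.reg .pos)) /
          .get .inp (NArr.reg .pos + 1)))) .skip ;;
     .setN .pos 0 (NArr.reg .pos + .get .deg (NArr.reg .x) + 1))

/-- The sequences of the vertices below `k` have been read. -/
structure GatesRead (s s' : HState) (d : ℕ → ℕ) (f : ℕ → ℕ → ℝ) (m k : ℕ) : Prop where
  N : ∀ a, a ≠ .x → a ≠ .pos → s'.N a = s.N a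
  R : ∀ a, a ≠ .g₀ → a ≠ .g₁ → a ≠ .c → s'.R a = s.R a
  g₀ : ∀ v < k, s'.R .g₀ v = f v 0
  g₁ : ∀ v < k, s'.R .g₁ v = if 1 ≤ d v then f v 1 else f v 0
  pos : s'.N .pos 0 = m + 1 + ∑ u ∈ Finset.range k, (d u + 1)
  c : (∃ v < k, 2 ≤ d v ∧ 0 < f v 1 ∧ s'.R .c 0 = (f v 2 - f v 0) / f v 1) ∨
    s'.R .c 0 = 1 ∧ ∀ v < k, 2 ≤ d v → f v 1 ≤ 0

theorem HT.cond_congr {b : HTest} {P P' : HProg} {T : ℕ} {Q : HState → Prop} {B : Prop}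
    (hB : b.Holds s ↔ B) (h₁ : B → HT P s T Q) (h₂ : ¬ B → HT P' s T Q) :
    HT (.cond b P P') s (T + 1) Q :=
  HT.cond (fun h => h₁ (hB.1 h)) fun h => h₂ (mt hB.2 h)

theorem parseGates_spec {d : ℕ → ℕ} {f : ℕ → ℕ → ℝ} (hn : s.N .rn 0 = n) (hm : s.N .rm 0 = m)
    (hd : s.N .deg = d)
    (hf : ∀ v < n, ∀ k ≤ d v, s.R .inp (m + 1 + ∑ u ∈ Finset.range v, (d u + 1) + k) = f v k) :
    HT parseGates s (n * 9 + 4) fun s' => GatesRead s s' d f m n := by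
  refine HT.mono (HT.setN_seq (HT.setR_seq (HT.forLoop (k := n) (T := 7) (Inv := fun i s' =>
    GatesRead s s' d f m i) ?_ ?_ ?_))) (by omega)
  · refine ⟨?_, ?_, ?_, ?_, ?_, Or.inr ⟨?_, ?_⟩⟩
    · intro a h1 h2; funext i; simp [h1, h2]
    · intro a h1 h2 h3; funext i; simp [h3]
    · intro v hv; omega
    · intro v hv; omega
    · simp [hm]
    · simp
    · intro v hv; omega
  · intro i s' h
    simp [h.N .rn, hn]
  · intro i hi s₁ hx h
    have i1 : s₁.N .deg = d := by rw [h.N _ (by simp) (by simp), hd]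
    have i2 : s₁.R .inp = s.R .inp := h.R _ (by simp) (by simp) (by simp)
    have hfi := hf i hi
    have h0 := hfi 0 (by omega)
    rw [Nat.add_zero] at h0
    have hpos := h.pos
    set p₀ := m + 1 + ∑ u ∈ Finset.range i, (d u + 1) with hp₀
    -- the first two terms of the sequence
    suffices H : ∀ s₂ : HState, s₂.N = s₁.N → (∀ a, a ≠ .g₀ → a ≠ .g₁ → s₂.R a = s₁.R a) →
        (∀ y, s₂.R .g₀ y = if y = i then f i 0 else s₁.R .g₀ y) →
        (∀ y, s₂.R .g₁ y = if y = i then (if 1 ≤ d i then f i 1 else f i 0) else s₁.R .g₁ y) →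
        HT (.cond (.natLe 2 (.get .deg (NArr.reg .x)))
      (.cond (.realLe (.get .inp (NArr.reg .pos + 1)) 0) .skip
        (.setR .c 0 ((.get .inp (NArr.reg .pos + 2) - .get .inp (NArr.reg .pos)) /
          .get .inp (NArr.reg .pos + 1)))) .skip ;;
     .setN .pos 0 (NArr.reg .pos + .get .deg (NArr.reg .x) + 1)) s₂ 4 fun s' => s'.N .x 0 = i ∧
        GatesRead s (s'.setN .x 0 (i + 1)) d f m (i + 1) by
      refine HT.setR_seq (HT.seq (T := 2) (HT.cond_congr (B := 1 ≤ d i) (T := 1) ?_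
        (fun hb => HT.setR (H _ ?_ ?_ ?_ ?_)) (fun hb => HT.setR (H _ ?_ ?_ ?_ ?_))))
      · simp [hx, i1]
      · simp
      · intro a h1 h2; funext y; simp [h1, h2]
      · intro y; simp [hx, hpos, i2, h0]
      · intro y; simp [hx, hpos, i2, hfi 1 hb, hb]
      · simp
      · intro a h1 h2; funext y; simp [h1, h2]
      · intro y; simp [hx, hpos, i2, h0]
      · intro y; simp only [HState.setR_R, hb]; simp [hx, hpos, i2, h0]
    intro s₂ n2 r2 g2 g2'
    have fin : ∀ s₃ : HState, s₃.N = s₂.N → (∀ a, a ≠ .c → s₃.R a = s₂.R a) →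
        ((∃ v < i + 1, 2 ≤ d v ∧ 0 < f v 1 ∧ s₃.R .c 0 = (f v 2 - f v 0) / f v 1) ∨
          s₃.R .c 0 = 1 ∧ ∀ v < i + 1, 2 ≤ d v → f v 1 ≤ 0) →
        HT (.setN .pos 0 (NArr.reg .pos + .get .deg (NArr.reg .x) + 1)) s₃ 1 fun s' =>
          s'.N .x 0 = i ∧ GatesRead s (s'.setN .x 0 (i + 1)) d f m (i + 1) := by
      intro s₃ n3 r3 hc
      have e1 : (NArr.reg .pos + .get .deg (NArr.reg .x) + 1).eval s₃ = p₀ + d i + 1 := by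
        simp [n3, n2, hx, hpos, i1]
      refine HT.setN ?_
      rw [e1]
      refine ⟨by simp [n3, n2, hx], ?_, ?_, ?_, ?_, ?_, hc⟩
      · intro a h1 h2; rw [← h.N a h1 h2]; funext y; simp [h1, h2, n3, n2]
      · intro a h1 h2 h3; rw [← h.R a h1 h2 h3, ← r2 a h1 h2, ← r3 a h3]; rfl
      · intro v hv
        change s₃.R .g₀ v = _
        rw [r3 _ (by simp), g2]
        rcases Nat.lt_succ_iff_lt_or_eq.1 hv with h1 | rfl
        · rw [if_neg h1.ne, h.g₀ v h1]
        · rw [if_pos rfl]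
      · intro v hv
        change s₃.R .g₁ v = _
        rw [r3 _ (by simp), g2']
        rcases Nat.lt_succ_iff_lt_or_eq.1 hv with h1 | rfl
        · rw [if_neg h1.ne, h.g₁ v h1]
        · rw [if_pos rfl]
      · simp [Finset.sum_range_succ, hp₀]; ring
    have c2 : s₂.R .c = s₁.R .c := r2 _ (by simp) (by simp)
    have inp2 : s₂.R .inp = s.R .inp := by rw [r2 _ (by simp) (by simp), i2]
    have hskip : (2 ≤ d i → f i 1 ≤ 0) →
        ((∃ v < i + 1, 2 ≤ d v ∧ 0 < f v 1 ∧ s₂.R .c 0 = (f v 2 - f v 0) / f v 1) ∨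
          s₂.R .c 0 = 1 ∧ ∀ v < i + 1, 2 ≤ d v → f v 1 ≤ 0) := by
      intro hi2
      rw [c2]
      rcases h.c with ⟨v, hv, h2⟩ | ⟨h1, h2⟩
      · exact Or.inl ⟨v, by omega, h2⟩
      · refine Or.inr ⟨h1, fun v hv => ?_⟩
        rcases Nat.lt_succ_iff_lt_or_eq.1 hv with h3 | rfl
        exacts [h2 v h3, hi2]
    refine HT.seq (T := 3) (HT.cond_congr (B := 2 ≤ d i) (T := 2) ?_ (fun hb =>
      HT.cond_congr (B := f i 1 ≤ 0) (T := 1) ?_ (fun hb1 => HT.skip (fin _ rfl (fun _ _ => rfl)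
        (hskip fun _ => hb1))) (fun hb1 => HT.setR (fin _ rfl ?_ ?_)))
      (fun hb => HT.mono (HT.skip (fin _ rfl (fun _ _ => rfl) (hskip fun h => absurd h hb)))
        (by omega)))
    · simp [n2, hx, i1]
    · simp [n2, hpos, inp2, hfi 1 (by omega)]
    · intro a ha; funext y; simp [ha]
    · refine Or.inl ⟨i, by omega, hb, not_le.1 hb1, ?_⟩
      simp [n2, hpos, inp2, hfi 1 (by omega), hfi 2 hb, h0]

/-! ### The size of the recursion tree -/

/-- The exponent is fixed with the program, so the power is a single expression. -/
def powExp (x : RExp) : ℕ → RExp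
  | 0 => 1
  | k + 1 => powExp x k * x

theorem eval_powExp (x : RExp) (k : ℕ) : (powExp x k).eval s = x.eval s ^ k := by
  induction k with
  | zero => simp [powExp]
  | succ k ih => simp [powExp, ih, pow_succ]

/-- The ceiling is found by counting in a natural and a real register in parallel. The preset values
reach up to 3N, the last child of the node N - 1. -/
def countProg (K q : ℕ) : HProg :=
  .setR .bnd 0 (powExp (.lit K * (RArr.reg .mr + 1) * (1 / RArr.reg .inp + 1)) q) ;;
  .setN .cnt 0 0 ;;
  .setR .r 0 0 ;;
  .loop (.neg (.realLe (RArr.reg .bnd) (RArr.reg .r)))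
    (.setN .cnt 0 (NArr.reg .cnt + 1) ;; .setR .r 0 (RArr.reg .r + 1)) ;;
  .setR .acc 0 1 ;;
  forLoop .x (NArr.reg .cnt + NArr.reg .cnt + NArr.reg .cnt + 1) (.setR .val (NArr.reg .x) 1)

theorem countProg_spec {K q N : ℕ} {ε : ℝ} (hmr : s.R .mr 0 = m) (hε : s.R .inp 0 = ε)
    (hN : N = ⌈((K : ℝ) * (m + 1) * (1 / ε + 1)) ^ q⌉₊) :
    HT (countProg K q) s (N * 12 + 20) fun s' => (∀ a, a ≠ .cnt → a ≠ .x → s'.N a = s.N a) ∧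
      (∀ a, a ≠ .bnd → a ≠ .r → a ≠ .acc → a ≠ .val → s'.R a = s.R a) ∧ s'.N .cnt 0 = N ∧
      s'.R .acc 0 = 1 ∧ ∀ j ≤ 3 * N, s'.R .val j = 1 := by
  set B := ((K : ℝ) * (m + 1) * (1 / ε + 1)) ^ q with hB
  refine HT.mono (HT.setR_seq (HT.setN_seq (HT.setR_seq (HT.seq ((HT.loop (k := N) (T := 2)
    (Inv := fun i s' => (∀ a, a ≠ .cnt → s'.N a = s.N a) ∧
      (∀ a, a ≠ .bnd → a ≠ .r → s'.R a = s.R a) ∧ s'.R .bnd 0 = B ∧ s'.N .cnt 0 = i ∧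
      s'.R .r 0 = i) ?_ ?_ ?_).post fun s₁ hs₁ => HT.setR_seq ((HT.forLoop (k := 3 * N + 1) (T := 1)
        (Inv := fun i s' => (∀ a, a ≠ .cnt → a ≠ .x → s'.N a = s.N a) ∧
      (∀ a, a ≠ .bnd → a ≠ .r → a ≠ .acc → a ≠ .val → s'.R a = s.R a) ∧ s'.N .cnt 0 = N ∧
      s'.R .acc 0 = 1 ∧ ∀ j < i, s'.R .val j = 1) ?_ ?_ ?_).post ?_))))))
      (T := 1 + (1 + (1 + (N * 3 + 1 + (1 + ((3 * N + 1) * 3 + 2)))))) (by omega)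
  · refine ⟨?_, ?_, ?_, ?_, ?_⟩
    · intro a ha; funext y; simp [ha]
    · intro a h1 h2; funext y; simp [h1, h2]
    · simp [eval_powExp, hmr, hε, hB]
    · simp
    · simp
  · rintro i hi s₁ ⟨-, -, h1, -, h2⟩
    simp [h1, h2, hN, Nat.lt_ceil]
  · rintro i hi s₁ ⟨h1, h2, h3, h4, h5⟩
    refine HT.setN_seq (T := 1) (HT.setR ?_)
    refine ⟨?_, ?_, ?_, ?_, ?_⟩
    · intro a ha; rw [← h1 a ha]; funext y; simp [ha]
    · intro a g1 g2; rw [← h2 a g1 g2]; funext y; simp [g2]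
    · simp [h3]
    · simp [h4]
    · simp [h5]
  · obtain ⟨h1, h2, h3, h4, h5⟩ := hs₁
    refine ⟨?_, ?_, ?_, ?_, ?_⟩
    · intro a g1 g2; rw [← h1 a g1]; funext y; simp [g2]
    · intro a g1 g2 g3 g4; rw [← h2 a g1 g2]; funext y; simp [g3]
    · simp [h4]
    · simp
    · intro j hj; omega
  · rintro i s' ⟨-, -, h, -⟩
    simp [h]; ring
  · rintro i hi s₂ hx ⟨h1, h2, h3, h4, h5⟩
    refine HT.setR ⟨by simp [hx], ?_, ?_, ?_, ?_, ?_⟩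
    · intro a g1 g2; rw [← h1 a g1 g2]; funext y; simp [g2]
    · intro a g1 g2 g3 g4; rw [← h2 a g1 g2 g3 g4]; funext y; simp [g4]
    · simp [h3]
    · simp [h4]
    · intro j hj
      rcases Nat.lt_succ_iff_lt_or_eq.1 hj with g | rfl
      · simp [h5 j g, hx, g.ne]
      · simp [hx]
  · rintro s' ⟨h1, h2, h3, h4, h5⟩
    exact ⟨h1, h2, h3, h4, fun j hj => h5 j (by omega)⟩

end FibonacciHolant


namespace FibonacciHolant

/-! ### The layout of the input -/

theorem getD_flatten {α : Type*} {L : List (List α)} {len : ℕ → ℕ} {d : α}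
    (hlen : ∀ u (hu : u < L.length), L[u].length = len u) {v : ℕ} (hv : v < L.length) {k : ℕ}
    (hk : k < len v) :
    L.flatten.getD (∑ u ∈ Finset.range v, len u + k) d = L[v].getD k d := by
  induction L generalizing len v with
  | nil => simp at hv
  | cons l L ih =>
    have h0 : l.length = len 0 := hlen 0 (by simp)
    rw [List.flatten_cons]
    cases v with
    | zero =>
      rw [Finset.range_zero, Finset.sum_empty, Nat.zero_add, List.getD_append _ _ _ _ (by omega)]
      rfl
    | succ v =>
      rw [Finset.sum_range_succ', List.getD_append_right _ _ _ _ (by omega), h0,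
        show ∑ u ∈ Finset.range v, len (u + 1) + len 0 + k - len 0 =
          ∑ u ∈ Finset.range v, len (u + 1) + k by omega,
        ih (len := fun u => len (u + 1)) (fun u hu => hlen (u + 1) (Nat.succ_lt_succ hu))
          (by simpa using hv) hk]
      rfl

theorem length_flatten_eq {α : Type*} {L : List (List α)} {len : ℕ → ℕ}
    (hlen : ∀ u (hu : u < L.length), L[u].length = len u) :
    L.flatten.length = ∑ u ∈ Finset.range L.length, len u := by
  induction L generalizing len with
  | nil => simp
  | cons l L ih =>
    have h0 : l.length = len 0 := hlen 0 (by simp)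
    rw [List.flatten_cons, List.length_append, List.length_cons, Finset.sum_range_succ', h0,
      ih (len := fun u => len (u + 1)) (fun u hu => hlen (u + 1) (Nat.succ_lt_succ hu))]
    omega

variable (Ω : HolantInstance) (ε : ℝ)

/-- The first end of the edge `e`. -/
def firstEnd (e : ℕ) : ℕ := if h : e < Ω.m then (Ω.ends ⟨e, h⟩).1 else 0

/-- The second end of the edge `e`. -/
def secondEnd (e : ℕ) : ℕ := if h : e < Ω.m then (Ω.ends ⟨e, h⟩).2 else 0

noncomputable def edgeWeight (e : ℕ) : ℝ := if h : e < Ω.m then Ω.weight ⟨e, h⟩ else 0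

/-- The value of the function at `v` on inputs of Hamming weight `k`. -/
noncomputable def sigValue (v k : ℕ) : ℝ := if h : v < Ω.n then (Ω.sig ⟨v, h⟩).getD k 0 else 0

def vertexDegree (v : ℕ) : ℕ := degree (firstEnd Ω) (secondEnd Ω) Ω.m v

theorem length_sig_eq (v : Fin Ω.n) : (Ω.sig v).length = vertexDegree Ω v + 1 := by
  rw [Ω.length_sig, vertexDegree, degree, Finset.sum_range]
  congr 1
  refine Finset.sum_congr rfl fun e _ => ?_
  simp [endCount, firstEnd, secondEnd, Fin.ext_iff]

/-- Each edge adds at most 2 in total; the inequality suffices to bound the length of the input. -/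
theorem sum_vertexDegree_le : ∑ v ∈ Finset.range Ω.n, vertexDegree Ω v ≤ 2 * Ω.m := by
  simp only [vertexDegree, degree]
  rw [Finset.sum_comm]
  calc _ ≤ ∑ e ∈ Finset.range Ω.m, 2 := Finset.sum_le_sum fun e _ => by
        rw [Finset.sum_add_distrib, Finset.sum_ite_eq, Finset.sum_ite_eq]
        split_ifs <;> omega
    _ = 2 * Ω.m := by simp [mul_comm]

theorem input_nats_zero : (Ω.input ε).nats 0 = Ω.n := rfl
theorem input_nats_one : (Ω.input ε).nats 1 = Ω.m := rfl
theorem input_reals_zero : (Ω.input ε).reals 0 = ε := rfl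

theorem input_nats_end {e : ℕ} (he : e < Ω.m) :
    (Ω.input ε).nats (e + e + 2) = firstEnd Ω e ∧ (Ω.input ε).nats (e + e + 3) = secondEnd Ω e := by
  have key : ∀ k < 2, (Ω.input ε).nats (e + e + (k + 2)) =
      [((Ω.ends ⟨e, he⟩).1 : ℕ), ((Ω.ends ⟨e, he⟩).2 : ℕ)].getD k 0 := by
    intro k hk
    have := getD_flatten (d := 0) (len := fun _ => 2)
      (L := List.ofFn fun e => [((Ω.ends e).1 : ℕ), ((Ω.ends e).2 : ℕ)]) (by simp) (v := e)
      (by simpa using he) (k := k) hk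
    rw [List.getElem_ofFn] at this
    rw [← this]
    simp [HolantInstance.input, show e + e + (k + 2) = (e * 2 + k) + 1 + 1 by ring]
  exact ⟨by simpa [firstEnd, he] using key 0 (by omega),
    by simpa [secondEnd, he] using key 1 (by omega)⟩

theorem input_nats_eq_zero {i : ℕ} (hi : Ω.n + (4 * Ω.m + 2) ≤ i) : (Ω.input ε).nats i = 0 := by
  refine List.getD_eq_default _ _ ?_
  rw [List.length_cons, List.length_cons, length_flatten_eq (len := fun _ => 2) (by simp)]
  simp; omega

theorem input_reals_weight {e : ℕ} (he : e < Ω.m) :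
    (Ω.input ε).reals (e + 1) = edgeWeight Ω e := by
  simp only [HolantInstance.input, List.getD_cons_succ]
  rw [List.getD_append _ _ _ _ (by simpa using he)]
  simp [edgeWeight, he]

theorem input_reals_sig {v : ℕ} (hv : v < Ω.n) {k : ℕ} (hk : k ≤ vertexDegree Ω v) :
    (Ω.input ε).reals (Ω.m + 1 + ∑ u ∈ Finset.range v, (vertexDegree Ω u + 1) + k) =
      sigValue Ω v k := by
  rw [show Ω.m + 1 + ∑ u ∈ Finset.range v, (vertexDegree Ω u + 1) + k =
    (Ω.m + (∑ u ∈ Finset.range v, (vertexDegree Ω u + 1) + k)) + 1 by ring]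
  simp only [HolantInstance.input, List.getD_cons_succ]
  rw [List.getD_append_right _ _ _ _ (by simp), List.length_ofFn, Nat.add_sub_cancel_left,
    getD_flatten (len := fun u => vertexDegree Ω u + 1) _ (by simpa using hv) (by omega)]
  · simp [sigValue, hv]
  · intro u hu
    rw [List.getElem_ofFn, length_sig_eq]

theorem input_reals_eq_zero {i : ℕ} (hi : Ω.n + (4 * Ω.m + 2) ≤ i) : (Ω.input ε).reals i = 0 := by
  refine List.getD_eq_default _ _ ?_
  rw [List.length_cons, List.length_append,
    length_flatten_eq (len := fun u => vertexDegree Ω u + 1)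
      (fun u hu => by rw [List.getElem_ofFn, length_sig_eq]), Finset.sum_add_distrib]
  have := sum_vertexDegree_le Ω
  simp; omega

/-! ### The recurrence is determined by the data -/

variable {Ω ε} {c p : ℝ}

theorem fibonacciFamily_mono {p' : ℝ} (hp : p' ≤ p) {f : List ℝ} (h0 : ∀ x ∈ f, 0 ≤ x)
    (hf : f ∈ fibonacciFamily c p) : f ∈ fibonacciFamily c p' := by
  refine ⟨hf.1, fun i hi => (mul_le_mul_of_nonneg_right hp ?_).trans (hf.2 i hi)⟩
  rw [List.getD_eq_getElem _ _ (by omega)]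
  exact h0 _ (List.getElem_mem _)

/-- If f_1 = 0, then f_1 ≥ p f_0 forces f_0 = 0, and the recurrence propagates the zeros. -/
theorem eq_zero_of_mem_fibonacciFamily (hp : 0 < p) {f : List ℝ} (h0 : ∀ x ∈ f, 0 ≤ x)
    (hf : f ∈ fibonacciFamily c p) (hl : 2 < f.length) (h1 : f.getD 1 0 ≤ 0) {i : ℕ}
    (hi : i < f.length) : f.getD i 0 = 0 := by
  have hnn : ∀ j < f.length, 0 ≤ f.getD j 0 := fun j hj => by
    rw [List.getD_eq_getElem _ _ hj]; exact h0 _ (List.getElem_mem _)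
  have e1 : f.getD 1 0 = 0 := le_antisymm h1 (hnn 1 (by omega))
  have e0 : f.getD 0 0 = 0 := by
    have := hf.2 0 (by omega)
    rw [Nat.zero_add, e1] at this
    exact le_antisymm (nonpos_of_mul_nonpos_right this hp) (hnn 0 (by omega))
  induction i using Nat.strong_induction_on with
  | _ i ih =>
    match i with
    | 0 => exact e0
    | 1 => exact e1
    | i + 2 => rw [hf.1 i hi, ih (i + 1) (by omega) (by omega), ih i (by omega) (by omega)]; ring

theorem sigValue_eq (v : Fin Ω.n) (k : ℕ) : sigValue Ω v k = (Ω.sig v).getD k 0 := by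
  simp [sigValue]

/-- The instance is one for the recurrence with the coefficient found in the data. -/
theorem isOver_of_detected {Λ : Set ℝ} {p' c' : ℝ} (hp : 0 < p) (hp' : p' ≤ p)
    (hΩ : Ω.IsOver (fibonacciFamily c p) Λ)
    (h : (∃ v < Ω.n, 2 ≤ vertexDegree Ω v ∧ 0 < sigValue Ω v 1 ∧
        c' = (sigValue Ω v 2 - sigValue Ω v 0) / sigValue Ω v 1) ∨
      c' = 1 ∧ ∀ v < Ω.n, 2 ≤ vertexDegree Ω v → sigValue Ω v 1 ≤ 0) :
    (c' = c ∨ c' = 1) ∧ Ω.IsOver (fibonacciFamily c' p') Λ := by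
  have hmono : Ω.IsOver (fibonacciFamily c p') Λ :=
    ⟨fun v => fibonacciFamily_mono hp' (Ω.sig_nonneg v) (hΩ.1 v), hΩ.2⟩
  rcases h with ⟨v, hv, h2, h1, hc⟩ | ⟨hc, h⟩
  · have hcc : c' = c := by
      have := (hΩ.1 ⟨v, hv⟩).1 0 (by rw [length_sig_eq]; exact Nat.succ_le_succ h2)
      rw [hc, div_eq_iff h1.ne']
      have e := sigValue_eq (Ω := Ω) ⟨v, hv⟩
      simp only at e
      rw [e 2, e 1, e 0]
      linarith
    rw [hcc]; exact ⟨Or.inl rfl, hmono⟩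
  -- Functions of arity at least 2 vanish here, so they satisfy the recurrence with any coefficient;
  -- shorter ones impose no recurrence.
  · refine ⟨Or.inr hc, fun v => ⟨fun i hi => ?_, (hmono.1 v).2⟩, hΩ.2⟩
    have hl : 2 < (Ω.sig v).length := by omega
    have hd : 2 ≤ vertexDegree Ω v := by rw [length_sig_eq] at hl; omega
    have hz := fun {i} hi => eq_zero_of_mem_fibonacciFamily hp (Ω.sig_nonneg v) (hΩ.1 v) hl
      (by rw [← sigValue_eq]; exact h v v.2 hd) (i := i) hi
    rw [hz hi, hz (by omega), hz (by omega)]; ring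

/-! ### The initial network -/

/-- A zero sequence remains zero under shifts, so every term of Z has a factor 0. -/
theorem netZ_eq_zero {n m v : ℕ} {E₁ E₂ : ℕ → ℕ} {L : ℕ → ℝ} {g : ℕ → ℝ × ℝ} (hv : v < n)
    (hg : g v = 0) : netZ c n E₁ E₂ L m g = 0 := by
  have hs : ∀ u (g : ℕ → ℝ × ℝ), g v = 0 → shiftAt c u g v = 0 := by
    intro u g hg
    by_cases h : v = u
    · subst h; simp [shiftAt, hg, shift]
    · simp [shiftAt, h, hg]
  induction m generalizing g with
  | zero => exact Finset.prod_eq_zero (Finset.mem_range.2 hv) (by simp [hg])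
  | succ m ih => rw [netZ, ih hg, ih (hs _ _ (hs _ _ hg))]; simp

/-- The network of the instance `Ω`. -/
structure IsNetOf (Ω : HolantInstance) (G : Net) : Prop where
  fst : ∀ e < Ω.m, G.fst e = firstEnd Ω e
  snd : ∀ e < Ω.m, G.snd e = secondEnd Ω e
  wt : ∀ e < Ω.m, G.wt e = edgeWeight Ω e
  fst_gate : ∀ v < Ω.n, (G.gate v).1 = sigValue Ω v 0
  snd_gate : ∀ v < Ω.n, (G.gate v).2 =
    if 1 ≤ vertexDegree Ω v then sigValue Ω v 1 else sigValue Ω v 0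

/-- Either some vertex carries the zero sequence and Z = 0, or all sequences are admissible and Z >
0 by `netZ_pos`: a vertex of positive degree meets a live edge, and one of degree 0 has f_0 > 0. So
Z = 0 is recognised exactly. -/
theorem IsNetOf.progress {G : Net} (hG : IsNetOf Ω G) {δ₀ κ : ℝ} (hP : Params c p δ₀)
    (hΩ : Ω.IsOver (fibonacciFamily c p) (Set.Icc (1 - δ₀) (1 + δ₀))) :
    Progress c p δ₀ κ Ω.partitionFunction Ω.n Ω.m G 1 Ω.m := by
  have hZ : Ω.partitionFunction = G.total c Ω.n Ω.m := by
    refine partitionFunction_eq_netZ Ω hΩ _ _ _ _ ?_ ?_ ?_ ?_ ?_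
    · intro e; rw [hG.fst e e.2]; simp [firstEnd]
    · intro e; rw [hG.snd e e.2]; simp [secondEnd]
    · intro e; rw [hG.wt e e.2]; simp [edgeWeight]
    · intro v; rw [hG.fst_gate v v.2, sigValue_eq]
    · intro v hv
      rw [length_sig_eq] at hv
      rw [hG.snd_gate v v.2, if_pos (by omega), sigValue_eq]
  have hδ := hP.hδ
  have hwt : ∀ e < Ω.m, 1 - δ₀ ≤ G.wt e ∧ G.wt e ≤ 1 + δ₀ := by
    intro e he
    rw [hG.wt e he, edgeWeight, dif_pos he]
    exact hΩ.2 ⟨e, he⟩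
  have hnn : ∀ v < Ω.n, ∀ k ≤ vertexDegree Ω v, 0 ≤ sigValue Ω v k := by
    intro v hv k hk
    have hl := length_sig_eq Ω ⟨v, hv⟩
    simp only at hl
    rw [sigValue, dif_pos hv, List.getD_eq_getElem _ _ (by omega)]
    exact Ω.sig_nonneg _ _ (List.getElem_mem _)
  have hle : ∀ v < Ω.n, p * (G.gate v).1 ≤ (G.gate v).2 := by
    intro v hv
    rw [hG.fst_gate v hv, hG.snd_gate v hv]
    split_ifs with h
    · have := (hΩ.1 ⟨v, hv⟩).2 0 (by rw [length_sig_eq]; exact Nat.succ_le_succ h)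
      simpa [sigValue, hv] using this
    · exact mul_le_of_le_one_left (hnn v hv 0 (Nat.zero_le _)) hP.hp1
  have hall : (∀ v < Ω.n, G.gate v ≠ 0) → G.AllAdm Ω.n Ω.m p := by
    intro h v hv
    have h1 : 0 ≤ (G.gate v).1 := by rw [hG.fst_gate v hv]; exact hnn v hv 0 (Nat.zero_le _)
    have h2 : 0 < (G.gate v).2 := by
      have h3 := hle v hv
      refine lt_of_le_of_ne ((mul_nonneg hP.hp.le h1).trans h3) fun h4 => h v hv ?_
      rw [← h4] at h3
      exact Prod.ext (le_antisymm (nonpos_of_mul_nonpos_right h3 hP.hp) h1) h4.symm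
    refine ⟨⟨h1, hle v hv, h2⟩, ?_⟩
    by_cases hd : 1 ≤ vertexDegree Ω v
    · right
      obtain ⟨e, he, h5⟩ := Finset.exists_ne_zero_of_sum_ne_zero
        (show degree (firstEnd Ω) (secondEnd Ω) Ω.m v ≠ 0 from Nat.one_le_iff_ne_zero.1 hd)
      have he := Finset.mem_range.1 he
      refine ⟨e, he, by linarith [(hwt e he).1], ?_⟩
      rw [hG.fst e he, hG.snd e he]
      by_contra h6
      rw [not_or] at h6
      simp [h6] at h5
    · left
      rw [hG.snd_gate v hv, if_neg hd, ← hG.fst_gate v hv] at h2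
      exact h2
  refine ⟨⟨?_, ?_, ?_, ?_⟩, fun h => ⟨hall fun v hv h0 => h ?_, 1, by rw [hZ, mul_one], by simp,
    by simp, zero_le_one⟩, fun h => Or.inr ?_⟩
  · intro e he; rw [hG.fst e he]; simp [firstEnd, he]
  · intro e he; rw [hG.snd e he]; simp [secondEnd, he]
  · intro e he; rw [abs_le]; constructor <;> linarith [hwt e he]
  · intro e h1 h2; omega
  · rw [hZ]; exact netZ_eq_zero hv h0
  · by_contra! hne
    have hA := hall hne
    refine (netZ_pos (m := Ω.m) hP.hc (fun e he => ?_) (fun v hv => ⟨(hA v hv).1.fst_nonneg,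
      (hA v hv).1.snd_pos⟩) fun v hv => (hA v hv).2).ne' (hZ.symm.trans h)
    linarith [hwt e he]

end FibonacciHolant


namespace FibonacciHolant

/-! ### The approximation scheme -/

theorem Contracts.mono {c p δ₀ δ₁ ν θ K : ℝ} {ψ : ℝ → ℝ} (h : Contracts c p δ₀ ν θ K ψ)
    (hδ : δ₁ ≤ δ₀) : Contracts c p δ₁ ν θ K ψ where
  ν_pos := h.ν_pos
  abs_le := h.abs_le
  mem F hF δ hd := h.mem F hF δ (hd.trans hδ)
  contract F hF δ hd := h.contract F hF δ (hd.trans hδ)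
  approx F hF δ hd := h.approx F hF δ (hd.trans hδ)

def mainProg (K q : ℕ) : HProg :=
  .setN .rn 0 (NArr.reg .inp) ;;
  .setN .rm 0 (.get .inp 1) ;;
  .setN .rs 0 (NArr.reg .rn + NArr.reg .rm) ;;
  parseEdges ;;
  parseGates ;;
  countProg K q ;;
  contractAll ;;
  prodProg

/-- The number of nodes of the recursion tree. -/
noncomputable def treeSize (K q m : ℕ) (ε : ℝ) : ℕ :=
  ⌈((K : ℝ) * (m + 1) * (1 / ε + 1)) ^ q⌉₊

/-- With X = (m+1)(1/ε+1) the relative error per edge is 1/(4X), so the three ratios are needed up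
to 1/(4KX) in the coordinate ψ. The tree has at least (MX)^q nodes, and M ≥ 96K = 4K · 24 yields the
factor 24^q ≥ 6^q · 4 required by `Progress.step`. -/
theorem Progress.steps {c p δ₀ ν θ K Z₀ ε : ℝ} {ψ : ℝ → ℝ} {n m q M : ℕ}
    (hP : Params c p δ₀) (hψ : Contracts c p δ₀ ν θ K ψ) (hθ : 0 < θ) (hK : 0 < K)
    (hq : 4 * θ ^ q ≤ 1) (hM : 96 * K ≤ M) (hε : 0 < ε) {k : ℕ} (hk : k < m)
    {node : ℕ → Net} {act sl : ℕ → ℕ} {Fs : ℕ → ℝ × ℝ} {δs val : ℕ → ℝ} {acc : ℝ} {G' : Net}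
    (hT : TreeSpec c n m (treeSize M q m ε) node act sl Fs δs val) (hact : act 0 = (node 0).fst k)
    (h : Progress c p δ₀ (1 / (4 * ((m + 1) * (1 / ε + 1)))) Z₀ n m (node 0) acc (k + 1))
    (hG' : Net.Agree n m G' ((node 1).setGate (act 0) (conv c (1, 1) (Fs 0)))) :
    Progress c p δ₀ (1 / (4 * ((m + 1) * (1 / ε + 1)))) Z₀ n m G' (acc * edgeFactor c (Fs 0) (δs 0)
      (val 1) (val 2) (val 3) ((node 0).gate (act 0))) k := by
  set X : ℝ := (m + 1) * (1 / ε + 1) with hX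
  have hX1 : 1 ≤ X := by
    have h1 : (0 : ℝ) ≤ m := Nat.cast_nonneg m
    have h2 : 0 < 1 / ε := by positivity
    nlinarith
  have hX0 : 0 < X := by linarith
  have hκ : K * (1 / (4 * K * X)) = 1 / (4 * X) := by field_simp
  have hq1 : 1 ≤ q := by
    rcases Nat.eq_zero_or_pos q with rfl | h
    · norm_num at hq
    · exact h
  have hMX : 0 < (M : ℝ) * (m + 1) * (1 / ε + 1) := by
    rw [mul_assoc, ← hX]
    exact mul_pos (by linarith) hX0
  have hN : ((M : ℝ) * (m + 1) * (1 / ε + 1)) ^ q ≤ treeSize M q m ε := Nat.le_ceil _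
  rw [← hκ] at h ⊢
  refine Progress.step hP hψ hθ hK hq hT ?_ (by positivity) ?_ ?_ hk hact h hG'
  · exact Nat.ceil_pos.2 (pow_pos hMX q)
  · have h24 : (24 : ℝ) ≤ 1 / (4 * K * X) * (M * (m + 1) * (1 / ε + 1)) := by
      rw [mul_assoc (M : ℝ), ← hX, div_mul_eq_mul_div, le_div_iff₀ (by positivity)]
      nlinarith
    calc (6 : ℝ) ^ q * 4 ≤ 6 ^ q * 4 ^ q := by
          refine mul_le_mul_of_nonneg_left ?_ (by positivity)
          calc (4 : ℝ) = 4 ^ 1 := by norm_num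
            _ ≤ 4 ^ q := pow_le_pow_right₀ (by norm_num) hq1
      _ = 24 ^ q := by rw [← mul_pow]; norm_num
      _ ≤ (1 / (4 * K * X) * (M * (m + 1) * (1 / ε + 1))) ^ q := pow_le_pow_left₀ (by norm_num) h24 q
      _ = (1 / (4 * K * X)) ^ q * (M * (m + 1) * (1 / ε + 1)) ^ q := mul_pow _ _ _
      _ ≤ _ := mul_le_mul_of_nonneg_left hN (by positivity)
  · rw [hκ, div_le_one (by positivity)]; linarith

/-- The constants for which the scheme works for the recurrence with the coefficient `c`. -/
structure Works (c p δ₀ : ℝ) (M q : ℕ) : Prop where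
  params : Params c p δ₀
  contracts : ∃ (ν θ K : ℝ) (ψ : ℝ → ℝ), 0 < θ ∧ 0 < K ∧ 4 * θ ^ q ≤ 1 ∧ 96 * K ≤ M ∧ Contracts c p δ₀ ν θ K ψ

/-- A bound for the running time of the main program. -/
def mainTime (n m N : ℕ) : ℕ :=
  3 + (m * 8 + 2) + (n * 9 + 4) + (N * 12 + 20) +
    (m * (N * ((n + m) * 33 + 58) + (n + m) * 7 + 15) + 2) + (n * 3 + 2)

theorem mainProg_spec {c p p' δ₀ ε : ℝ} {M q : ℕ} {Ω : HolantInstance} {s : HState} (hp : 0 < p)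
    (hp' : p' ≤ p) (hΩ : Ω.IsOver (fibonacciFamily c p) (Set.Icc (1 - δ₀) (1 + δ₀)))
    (hc : Works c p' δ₀ M q) (h1 : Works 1 p' δ₀ M q) (hε : 0 < ε)
    (hN : s.N .inp = (Ω.input ε).nats) (hR : s.R .inp = (Ω.input ε).reals)
    (hdeg : ∀ v, s.N .deg v = 0) (hmr : s.R .mr 0 = 0) :
    HT (mainProg M q) s (mainTime Ω.n Ω.m (treeSize M q Ω.m ε)) fun s' =>
      (Ω.partitionFunction ≠ 0 → (1 - ε) * Ω.partitionFunction < s'.R .acc 0 ∧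
        s'.R .acc 0 < (1 + ε) * Ω.partitionFunction) ∧
      (Ω.partitionFunction = 0 → s'.R .acc 0 = 0) := by
  have hends := fun e he => input_nats_end Ω ε (e := e) he
  refine HT.mono (HT.setN_seq (HT.setN_seq (HT.setN_seq ?_)))
    (T := 1 + (1 + (1 + ((Ω.m * 8 + 2) + ((Ω.n * 9 + 4) + ((treeSize M q Ω.m ε * 12 + 20) +
      ((Ω.m * (treeSize M q Ω.m ε * ((Ω.n + Ω.m) * 33 + 58) + (Ω.n + Ω.m) * 7 + 15) + 2) +
        (Ω.n * 3 + 2))))))))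
    (by rw [mainTime]; omega)
  suffices H : ∀ s₁ : HState, s₁.N .rn 0 = Ω.n → s₁.N .rm 0 = Ω.m → s₁.N .rs 0 = Ω.n + Ω.m →
      s₁.N .inp = s.N .inp → s₁.N .deg = s.N .deg → s₁.R = s.R →
      HT (parseEdges ;; parseGates ;; countProg M q ;; contractAll ;; prodProg) s₁
        ((Ω.m * 8 + 2) + ((Ω.n * 9 + 4) + ((treeSize M q Ω.m ε * 12 + 20) +
      ((Ω.m * (treeSize M q Ω.m ε * ((Ω.n + Ω.m) * 33 + 58) + (Ω.n + Ω.m) * 7 + 15) + 2) +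
        (Ω.n * 3 + 2))))) fun s' =>
      (Ω.partitionFunction ≠ 0 → (1 - ε) * Ω.partitionFunction < s'.R .acc 0 ∧
        s'.R .acc 0 < (1 + ε) * Ω.partitionFunction) ∧
      (Ω.partitionFunction = 0 → s'.R .acc 0 = 0) by
    refine H _ ?_ ?_ ?_ ?_ ?_ rfl
    · simp [hN, input_nats_zero]
    · simp [hN, input_nats_one]
    · simp [hN, input_nats_zero, input_nats_one]
    · funext i; simp
    · funext i; simp
  intro s₁ hn hm hs i1 d1 r1
  refine HT.seq ((parseEdges_spec (E₁ := firstEnd Ω) (E₂ := secondEnd Ω) (L := edgeWeight Ω)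
    hm ?_ ?_ ?_ ?_ ?_).post fun s₂ h2 => HT.seq ((parseGates_spec (m := Ω.m) (n := Ω.n)
      (d := vertexDegree Ω) (f := sigValue Ω) ?_ ?_ ?_ ?_).post fun s₃ h3 =>
        HT.seq ((countProg_spec (m := Ω.m) (N := treeSize M q Ω.m ε) (ε := ε) ?_ ?_ rfl).post
          fun s₄ h4 => ?_)))
  · intro e he; rw [i1, hN, (hends e he).1]
  · intro e he; rw [i1, hN, (hends e he).2]
  · intro e he; rw [r1, hR, input_reals_weight Ω ε he]
  · intro v; rw [d1, hdeg]
  · rw [r1, hmr]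
  · simp [h2.N .rn, hn]
  · simp [h2.N .rm, hm]
  · funext v; exact h2.deg v
  · intro v hv k hk
    rw [h2.R _ (by simp) (by simp), r1, hR, input_reals_sig Ω ε hv hk]
  · rw [h3.R _ (by simp) (by simp) (by simp), h2.mr]
  · rw [h3.R _ (by simp) (by simp) (by simp), h2.R _ (by simp) (by simp), r1, hR,
      input_reals_zero]
  obtain ⟨n4, r4, cnt4, acc4, val4⟩ := h4
  -- The coefficient found in the data is c or 1, and the constants are good for both.
  have hcw : Works (s₃.R .c 0) p' δ₀ M q ∧
      Ω.IsOver (fibonacciFamily (s₃.R .c 0) p') (Set.Icc (1 - δ₀) (1 + δ₀)) := by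
    obtain ⟨h5, h6⟩ := isOver_of_detected hp hp' hΩ h3.c
    refine ⟨?_, h6⟩
    rcases h5 with h5 | h5 <;> rw [h5]
    exacts [hc, h1]
  obtain ⟨⟨hP, ν, θ, K, ψ, hθ, hK, hq, hMK, hψ⟩, hΩ'⟩ := hcw
  have hready : Ready Ω.n Ω.m (treeSize M q Ω.m ε) (s₃.R .c 0) s₄ := by
    refine ⟨?_, ?_, ?_, cnt4, ?_, fun j _ hj => val4 j hj⟩
    · simp [n4 .rn, h3.N .rn, h2.N .rn, hn]
    · simp [n4 .rm, h3.N .rm, h2.N .rm, hm]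
    · simp [n4 .rs, h3.N .rs, h2.N .rs, hs]
    · simp [r4 .c]
  have hnet : IsNetOf Ω (slot Ω.n Ω.m s₄ 0) := by
    refine ⟨?_, ?_, ?_, ?_, ?_⟩
    · intro e he
      simp [slot, he, n4 .fst, h3.N .fst, h2.fst e he]
    · intro e he
      simp [slot, he, n4 .snd, h3.N .snd, h2.snd e he]
    · intro e he
      simp [slot, he, r4 .wt, h3.R .wt, h2.wt e he]
    · intro v hv
      simp [slot, hv, r4 .g₀, h3.g₀ v hv]
    · intro v hv
      simp [slot, hv, r4 .g₁, h3.g₁ v hv]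
  refine HT.seq ((contractAll_spec (Q := fun G acc k => Progress (s₃.R .c 0) p' δ₀
    (1 / (4 * ((Ω.m + 1) * (1 / ε + 1)))) Ω.partitionFunction Ω.n Ω.m G acc k) hready ?_ ?_ ?_).post
    fun s₅ h5 => (prodProg_spec (n := Ω.n) (m := Ω.m) h5.1.rn).post fun s₆ h6 => ?_)
  · rw [acc4]; exact hnet.progress hP hΩ'
  · intro k hk G acc h; exact h.shape.fst_lt k hk
  · intro k hk node act sl Fs δs val acc G' hT hact h hG'
    exact Progress.steps hP hψ hθ hK hq hMK hε hk hT hact h hG'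
  · rw [h6]
    have he0 : 0 < 1 / ε := by positivity
    have hm0 : (0 : ℝ) ≤ Ω.m := Nat.cast_nonneg _
    have hX : 0 < ((Ω.m : ℝ) + 1) * (1 / ε + 1) := by positivity
    have hmX : (Ω.m : ℝ) ≤ ((Ω.m : ℝ) + 1) * (1 / ε + 1) := by nlinarith
    -- This gives 2mκ = m/(2X) ≤ ε/2 < ε for κ = 1/(4X), as `Progress.finish` demands.
    have hmX' : (Ω.m : ℝ) ≤ ε * (((Ω.m : ℝ) + 1) * (1 / ε + 1)) := by
      have : ε * (((Ω.m : ℝ) + 1) * (1 / ε + 1)) = ((Ω.m : ℝ) + 1) * (1 + ε) := by field_simp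
      rw [this]; nlinarith
    have hZ0 : 0 ≤ Ω.partitionFunction := by
      refine Finset.sum_nonneg fun σ _ => mul_nonneg (Finset.prod_nonneg fun e _ => ?_)
        (Finset.prod_nonneg fun v _ => ?_)
      · split_ifs
        exacts [Ω.weight_nonneg e, zero_le_one]
      · by_cases hl : Ω.hamming σ v < (Ω.sig v).length
        · rw [List.getD_eq_getElem _ _ hl]; exact Ω.sig_nonneg v _ (List.getElem_mem _)
        · rw [List.getD_eq_default _ _ (not_lt.1 hl)]
    refine h5.2.finish (by positivity) ?_ ?_ hZ0
    · rw [mul_one_div, ← mul_div_assoc, div_lt_iff₀ (by positivity)]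
      nlinarith [mul_pos hε hX]
    · rw [mul_one_div, ← mul_div_assoc, div_le_one (by positivity)]
      linarith

/-- The main cost is m rounds over a tree whose nodes take O(n + m) steps each. The tree size is
O(Y^{2q}), since MX ≤ MY²; the factors m and n + m give the remaining Y². -/
theorem mainTime_le {M q n m : ℕ} {ε : ℝ} (hε : 0 < ε) :
    (((n + (4 * m + 2)) * 4 + 1 + (mainTime n m (treeSize M q m ε) + 1) : ℕ) : ℝ) ≤
      ((1000 * (M ^ q + 1) : ℕ) : ℝ) * ((n : ℝ) + m + 1 / ε + 1) ^ (2 * q + 2) := by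
  set Y : ℝ := (n : ℝ) + m + 1 / ε + 1 with hY
  have hn0 : (0 : ℝ) ≤ n := Nat.cast_nonneg n
  have hm0 : (0 : ℝ) ≤ m := Nat.cast_nonneg m
  have he0 : 0 < 1 / ε := by positivity
  have hY1 : 1 ≤ Y := by linarith
  have hN : (treeSize M q m ε : ℝ) ≤ (M ^ q + 1) * Y ^ (2 * q) := by
    have h1 : ((M : ℝ) * (m + 1) * (1 / ε + 1)) ^ q ≤ M ^ q * Y ^ (2 * q) := by
      rw [pow_mul, ← mul_pow]
      refine pow_le_pow_left₀ (by positivity) ?_ q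
      rw [mul_assoc]
      refine mul_le_mul_of_nonneg_left ?_ (Nat.cast_nonneg M)
      rw [sq]
      exact mul_le_mul (by linarith) (by linarith) (by linarith) (by linarith)
    have h2 := (Nat.ceil_lt_add_one (a := ((M : ℝ) * (m + 1) * (1 / ε + 1)) ^ q)
      (by positivity)).le
    have h3 : (1 : ℝ) ≤ Y ^ (2 * q) := one_le_pow₀ hY1
    rw [treeSize]; linarith
  set N : ℝ := (treeSize M q m ε : ℝ) with hNdef
  set B : ℝ := (M ^ q + 1) * Y ^ (2 * q) with hB
  have hN0 : 0 ≤ N := Nat.cast_nonneg _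
  have hB1 : 1 ≤ B := by
    have h3 : (1 : ℝ) ≤ Y ^ (2 * q) := one_le_pow₀ hY1
    have h4 : (0 : ℝ) ≤ (M : ℝ) ^ q := by positivity
    nlinarith
  have hgoal : ((1000 * (M ^ q + 1) : ℕ) : ℝ) * Y ^ (2 * q + 2) = 1000 * (B * Y ^ 2) := by
    rw [hB, pow_add]; push_cast; ring
  rw [hgoal, mainTime]
  push_cast
  rw [← hNdef]
  have hY2 : Y ≤ Y ^ 2 := by nlinarith
  have hYB : Y ^ 2 ≤ B * Y ^ 2 := le_mul_of_one_le_left (by positivity) hB1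
  have hBY : B ≤ B * Y ^ 2 := le_mul_of_one_le_right (by linarith) (by nlinarith)
  have hnm : (n : ℝ) + m ≤ Y := by linarith
  have a1 : (m : ℝ) * (N * ((n + m) * 33 + 58)) ≤ 91 * (B * Y ^ 2) := by
    have b1 : ((n : ℝ) + m) * 33 + 58 ≤ 91 * Y := by linarith
    have b2 : N * (((n : ℝ) + m) * 33 + 58) ≤ B * (91 * Y) := mul_le_mul hN b1 (by positivity) (by linarith)
    calc _ ≤ Y * (B * (91 * Y)) := mul_le_mul (by linarith) b2 (by positivity) (by linarith)
      _ = _ := by ring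
  have a2 : (m : ℝ) * ((n + m) * 7 + 15) ≤ 22 * Y ^ 2 := by
    calc _ ≤ Y * (22 * Y) := mul_le_mul (by linarith) (by linarith) (by positivity) (by linarith)
      _ = _ := by ring
  linarith

theorem hasFPTAS {c p p' δ₀ : ℝ} {M q : ℕ} (hp : 0 < p) (hp' : p' ≤ p) (hc : Works c p' δ₀ M q)
    (h1 : Works 1 p' δ₀ M q) :
    HasFPTAS (fibonacciFamily c p) (Set.Icc (1 - δ₀) (1 + δ₀)) := by
  refine ⟨.seq copyInput (.seq (mainProg M q).compile (.writeReal (.lit 0) RArr.acc.reg.compile)),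
    1000 * (M ^ q + 1), 2 * q + 2, fun Ω hΩ ε hε => ?_⟩
  obtain ⟨M₁, r₁, hM₁⟩ := copyInput_runs (input_nats_zero Ω ε) (input_nats_one Ω ε)
    (fun i hi => input_nats_eq_zero Ω ε hi) (fun i hi => input_reals_eq_zero Ω ε hi)
  obtain ⟨t, s', ht, hE, hs'⟩ := mainProg_spec
    (s := copiedState (Ω.input ε) (Ω.n + (4 * Ω.m + 2))) hp hp' hΩ hc h1 hε
    (by
      funext i; simp only [copiedState]; split_ifs with h
      · rfl
      · exact (input_nats_eq_zero Ω ε (not_lt.1 h)).symm)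
    (by
      funext i; simp only [copiedState]; split_ifs with h
      · rfl
      · exact (input_reals_eq_zero Ω ε (not_lt.1 h)).symm) (fun _ => rfl) rfl
  obtain ⟨M₂, r₂, hM₂⟩ := hE.runs hM₁
  refine ⟨_, _, .seq r₁ (.seq r₂ (.writeReal M₂ _ _)), ?_, ?_⟩
  · refine le_trans ?_ (mainTime_le hε)
    exact_mod_cast Nat.add_le_add_left (Nat.add_le_add_right ht 1) _
  · rw [hM₂.eval_rexp]
    exact hs'

/-- Replacing p by p' ≤ min(c/3, 1/3) enlarges the family and gives `Params` for both c and 1. The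
larger of the two rates determines q, the larger of the two constants K determines M. -/
theorem exists_works {c p : ℝ} (hc : 0 < c) (hp : 0 < p) : ∃ (p' δ₀ : ℝ) (M q : ℕ), p' ≤ p ∧
    0 < δ₀ ∧ δ₀ ≤ 1 / 2 ∧ Works c p' δ₀ M q ∧ Works 1 p' δ₀ M q := by
  obtain ⟨p', hp'0, h1, h2, h3⟩ : ∃ p', 0 < p' ∧ p' ≤ p ∧ p' ≤ c / 3 ∧ p' ≤ 1 / 3 :=
    ⟨min p (min (c / 3) (1 / 3)), by positivity, min_le_left _ _,
      (min_le_right _ _).trans (min_le_left _ _), (min_le_right _ _).trans (min_le_right _ _)⟩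
  obtain ⟨δ₁, ν₁, θ₁, K₁, ψ₁, hδ₁, hδ₁', hθ₁, hθ₁', hK₁, hc₁⟩ :=
    exists_contracts hc hp'0 (by linarith)
  obtain ⟨δ₂, ν₂, θ₂, K₂, ψ₂, hδ₂, hδ₂', hθ₂, hθ₂', hK₂, hc₂⟩ :=
    exists_contracts one_pos hp'0 (by linarith)
  obtain ⟨q, hq⟩ := exists_pow_lt_of_lt_one (show (0 : ℝ) < 1 / 4 by norm_num) (max_lt hθ₁' hθ₂')
  have hq₁ : 4 * θ₁ ^ q ≤ 1 := by
    have := pow_le_pow_left₀ hθ₁.le (le_max_left θ₁ θ₂) q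
    linarith
  have hq₂ : 4 * θ₂ ^ q ≤ 1 := by
    have := pow_le_pow_left₀ hθ₂.le (le_max_right θ₁ θ₂) q
    linarith
  have hM := Nat.le_ceil (96 * max K₁ K₂)
  have hm₁ := le_max_left K₁ K₂
  have hm₂ := le_max_right K₁ K₂
  have hδ := (min_le_left δ₁ δ₂).trans hδ₁'
  exact ⟨p', min δ₁ δ₂, ⌈96 * max K₁ K₂⌉₊, q, h1, lt_min hδ₁ hδ₂, hδ,
    ⟨⟨hc, hp'0, by linarith, by linarith, hδ⟩,
      ν₁, θ₁, K₁, ψ₁, hθ₁, hK₁, hq₁, by linarith, hc₁.mono (min_le_left _ _)⟩,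
    ⟨⟨one_pos, hp'0, by linarith, by linarith, hδ⟩,
      ν₂, θ₂, K₂, ψ₂, hθ₂, hK₂, hq₂, by linarith, hc₂.mono (min_le_right _ _)⟩⟩

end FibonacciHolant

theorem theorem1 (c p : ℝ) (hc : 0 < c) (hp : 0 < p) :
    ∃ l₁ l₂ : ℝ, 0 < l₁ ∧ l₁ < 1 ∧ 1 < l₂ ∧
      HasFPTAS (fibonacciFamily c p) (Set.Icc l₁ l₂) := by
  obtain ⟨p', δ₀, M, q, hp', hδ, hδ', h1, h2⟩ := FibonacciHolant.exists_works hc hp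
  exact ⟨1 - δ₀, 1 + δ₀, by linarith, by linarith, by linarith,
    FibonacciHolant.hasFPTAS hp hp' h1 h2⟩
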